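/- **Notation.** Let $n\ge 1$, $[p,q]=\{p,\dots,q\}$, $[q]=[1,q]$. For $i\in\mathbb Z$ let $i'=i-\frac12$; a *letter* is an element of $\frac12\mathbb Z=\{\dots<1'<1<2'<2<\dots\}$, primed if it is some $i'$. Removing primes replaces a letter $x$ by $\lceil x\rceil$; $\mathsf{unprime}$ does this to every letter of a word. **Crystals.** Let $B$ be a nonempty set with a map $\mathrm{wt}:B\to\mathbb Z^n$ and let $0\notin B$. For $g:B\to B\sqcup\{0\}$ set $g(0)=0$. For operators $e_i,f_i$ let $\varepsilon_i(b)=\max\{k\ge0:e_i^k(b)\ne0\}$ and $\varphi_i(b)=\max\{k\ge0:f_i^k(b)\neq0\}$ in $\mathbb N\sqcup\{\infty\}$. Given $e_i,f_i:B\to B\sqcup\{0\}$ for $i\in[n-1]$, $B$ is a *$\mathfrak{gl}_n$-crystal* if for all $b,c\in B$, $i\in[n-1]$: (S1) $e_i(b)=c\iff f_i(c)=b$, in which case $\mathrm{wt}(c)-\mathrm{wt}(b)=\mathbf e_i-\mathbf e_{i+1}$; (S2) $\varepsilon_i(b),\varphi_i(b)$ are finite and $\varphi_i(b)-\varepsilon_i(b)=\mathrm{wt}(b)_i-\mathrm{wt}(b)_{i+1}$.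 It is a *$\mathfrak q_n$-crystal* if moreover $\mathrm{wt}(B)\subset\mathbb N^n$ and, when $n\ge2$, there are operators $e_{\bar1},f_{\bar1}$ such that for all $b,c\in B$: (P1) $e_{\bar1}(b)=c\iff f_{\bar1}(c)=b$, in which case $\mathrm{wt}(c)-\mathrm{wt}(b)=\mathbf e_1-\mathbf e_2$ and $\varepsilon_i(b)=\varepsilon_i(c)$, $\varphi_i(b)=\varphi_i(c)$ for $i\in[3,n-1]$; (P2) $e_i,f_i$ commute with $e_{\bar1},f_{\bar1}$ for $i\in[3,n-1]$; (P3) $\varepsilon_{\bar1}(b)+\varphi_{\bar1}(b)$ is $0$ if $\mathrm{wt}(b)_1=\mathrm{wt}(b)_2=0$ and is $1$ otherwise. It is a *$\mathfrak q_n^+$-crystal* if moreover there are operators $e_0,f_0$ such that for all $b,c\in B$: (Q1) $e_0(b)=c\iff f_0(c)=b$, in which case $\mathrm{wt}(b)=\mathrm{wt}(c)$ and $\varepsilon_i(b)=\varepsilon_i(c)$, $\varphi_i(b)=\varphi_i(c)$ for all $i\in[n-1]$ and, if $n\ge2$, for $i=\bar1$; (Q2) $e_i,f_i$ commute with $e_0,f_0$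 for $i\in[2,n-1]$; (Q3) $\varepsilon_0(b)+\varphi_0(b)$ is $0$ if $\mathrm{wt}(b)_1=0$ and is $1$ otherwise. **Involution words.** Let $S_{\mathbb Z}$ be the group of permutations of $\mathbb Z$ with finite support, $s_i=(i,i+1)$, and let $\circ$ be the associative product on $S_{\mathbb Z}$ with $\pi\circ s_i=\pi$ if $\pi(i)>\pi(i+1)$ and $\pi\circ s_i=\pi s_i$ otherwise. For an integer word $a=a_1\cdots a_k$ let $\delta(a)=s_{a_k}\circ\cdots\circ s_{a_1}\circ1\circ s_{a_1}\circ\cdots\circ s_{a_k}$. For $z\in S_{\mathbb Z}$ with $z=z^{-1}$, an *involution word* for $z$ is a word $a$ of minimal length with $\delta(a)=z$; an index $i$ is a *commutation* of $a$ if $a_i$ and $a_i+1$ are both fixed by $\delta(a_1\cdots a_{i-1})$. A *primed involution word* for $z$ is a word of letters whose unprimed form is an involution word for $z$ and whose primed letters occur only at commutations. Let $\mathsf{Incr}^+_n(z)$ be the set of $n$-tuples $a=(a^1,\dots,a^n)$ of strictly increasing, possibly empty, words of letters whose concatenation $a^1a^2\cdots a^n$ is a primed involution word for $z$, with $\mathrm{wt}(a)=(\ell(a^1),\dots,\ell(a^n))$.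 Let $\hat c_i(z)=|\{j\in\mathbb Z: z(j)\le i<j,\ z(i)>z(j)\}|$ for $i\in\mathbb Z$, let $\mu(z)$ be the transpose of the partition sorting $(\hat c_i(z))_{i\in\mathbb Z}$, and let $\ell(\mu(z))$ be its number of nonzero parts. **Operators.** For strictly increasing words $v,w$, form $\mathsf{pair}(v,w)$ by going through the letters of $w$ from largest to smallest, pairing each $w_j$ with the smallest not yet paired $v_i$ with $\lceil v_i\rceil>\lceil w_j\rceil$, if there is one, and then adding $(v_i,w_j)$. Let $i\in[n-1]$; "unpaired" refers to $\mathsf{pair}(a^i,a^{i+1})$. * $f_i(a)=0$ if $a^i$ has no unpaired letter. Otherwise let $x$ be the largest unpaired letter of $a^i$ and $y$ the smallest integer $\ge\lceil x\rceil$ not in $\mathsf{unprime}(a^{i+1})$. If $x$ is primed, remove $x$ from $a^i$ and add $y'$ to $a^{i+1}$. If not, remove $x$ from $a^i$ and add $y$ to $a^{i+1}$; then for each integer $v\in[x,y-1]$ with $v+1\in a^i$ and $v'\in a^{i+1}$ replace $v+1\in a^i$ by $(v+1)'$ and $v'\in a^{i+1}$ by $v$. * $e_i(a)=0$ if $a^{i+1}$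 has no unpaired letter. Otherwise let $y$ be the smallest unpaired letter of $a^{i+1}$ and $x$ the largest integer $\le\lceil y\rceil$ not in $\mathsf{unprime}(a^i)$. If $y$ is primed, remove $y$ from $a^{i+1}$ and add $x'$ to $a^i$. If not, remove $y$ from $a^{i+1}$ and add $x$ to $a^i$; then for each integer $v\in[x,y-1]$ with $(v+1)'\in a^i$ and $v\in a^{i+1}$ replace $(v+1)'\in a^i$ by $v+1$ and $v\in a^{i+1}$ by $v'$. * ($n\ge2$) $f_{\bar1}(a)=0$ if $a^1$ is empty or its first letter is not strictly smaller than every letter of $a^2$. Otherwise, if $a^1$ has at least two letters and exactly one of its first two letters is primed, reverse the primes on these two letters and move the modified first letter to the start of $a^2$; in the remaining case move the first letter of $a^1$ to the start of $a^2$. * ($n\ge2$) $e_{\bar1}(a)=0$ if $a^2$ is empty or its first letter is not strictly smaller than every letter of $a^1$. Otherwise, if $a^1$ is nonempty and exactly one of the first letters of $a^1$ and $a^2$ is primed, reverse the primes on these two letters and move the modified first letter of $a^2$ to the start of $a^1$; in the remaining case move the first letter of $a^2$ to the start of $a^1$. * $f_0(a)=0$ if $a^1$ is empty or begins with a primed letter;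 otherwise $f_0$ adds a prime to the first letter of $a^1$. $e_0(a)=0$ if $a^1$ is empty or begins with an unprimed letter; otherwise $e_0$ removes the prime from the first letter of $a^1$. **Proposition.** Let $n\ge1$ and let $z\in S_{\mathbb Z}$ satisfy $z=z^{-1}$ and $\ell(\mu(z))\le n$. Then $\mathsf{Incr}^+_n(z)$ is nonempty, all the operators above are well-defined maps $\mathsf{Incr}^+_n(z)\to\mathsf{Incr}^+_n(z)\sqcup\{0\}$, and relative to these operators and the weight map $\mathrm{wt}$ the set $\mathsf{Incr}^+_n(z)$ is a $\mathfrak q^+_n$-crystal. -/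

import Mathlib

namespace QPlus

/-! ## Abstract crystals

The auxiliary element `0` is modelled by `none`, so operators are maps `B → Option B`.
Indices are counted from `0`: the operator with index `i : Fin (n - 1)` is the one usually written
with index `i + 1`, and `low i`, `high i` are the corresponding coordinates of `ℤ ^ n`. -/

def low {n : ℕ} (i : Fin (n - 1)) : Fin n := ⟨i.1, by have := i.2; omega⟩

def high {n : ℕ} (i : Fin (n - 1)) : Fin n := ⟨i.1 + 1, by have := i.2; omega⟩

def fstIdx {n : ℕ} (h : 1 ≤ n) : Fin n := ⟨0, h⟩

def sndIdx {n : ℕ} (h : 2 ≤ n) : Fin n := ⟨1, h⟩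

/-- A weight map together with raising and lowering operators: `e i`, `f i` for the ordinary
indices, `eBar`, `fBar` for the queer index (present only when `2 ≤ n`), and `e0`, `f0`. -/
structure CrystalData (n : ℕ) (B : Type*) where
  wt : B → Fin n → ℤ
  e : Fin (n - 1) → B → Option B
  f : Fin (n - 1) → B → Option B
  eBar : 2 ≤ n → B → Option B
  fBar : 2 ≤ n → B → Option B
  e0 : B → Option B
  f0 : B → Option B

/-- The `k`-th power of an operator, with the convention that `0` is sent to `0`. -/
def iter {B : Type*} (g : B → Option B) : ℕ → B → Option B
  | 0, b => some b
  | k + 1, b => (iter g k b).bind g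

/-- The string length `max {k : g ^ k (b) ≠ 0}`, an element of `ℕ ∪ {∞}`. -/
noncomputable def strLen {B : Type*} (g : B → Option B) (b : B) : ℕ∞ :=
  ⨆ (k : ℕ) (_ : iter g k b ≠ none), (k : ℕ∞)

/-- Two operators commute (with the convention that `0` is sent to `0`). -/
def OpsCommute {B : Type*} (g h : B → Option B) : Prop :=
  ∀ b, (g b).bind h = (h b).bind g

/-- Abstract (seminormal) `gl_n`-crystals. -/
structure IsGLCrystal {n : ℕ} {B : Type*} (C : CrystalData n B) : Prop where
  nonempty : Nonempty B
  e_iff_f : ∀ i b c, C.e i b = some c ↔ C.f i c = some b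
  wt_e : ∀ i b c, C.e i b = some c →
    C.wt c - C.wt b = Pi.single (low i) 1 - Pi.single (high i) 1
  strLen_e_finite : ∀ i b, strLen (C.e i) b ≠ ⊤
  strLen_f_finite : ∀ i b, strLen (C.f i) b ≠ ⊤
  strLen_sub : ∀ i b, ((strLen (C.f i) b).toNat : ℤ) - ((strLen (C.e i) b).toNat : ℤ) =
    C.wt b (low i) - C.wt b (high i)

/-- Abstract `q_n`-crystals. When `n = 1` these are just nonempty sets with a weight map
to `ℕ`. -/
structure IsQCrystal {n : ℕ} {B : Type*} (C : CrystalData n B) : Prop extends IsGLCrystal C where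
  wt_nonneg : ∀ b i, 0 ≤ C.wt b i
  eBar_iff_fBar : ∀ (h : 2 ≤ n) b c, C.eBar h b = some c ↔ C.fBar h c = some b
  wt_eBar : ∀ (h : 2 ≤ n) b c, C.eBar h b = some c →
    C.wt c - C.wt b = Pi.single (fstIdx (by omega)) 1 - Pi.single (sndIdx h) 1
  strLen_eBar : ∀ (h : 2 ≤ n) b c, C.eBar h b = some c → ∀ i : Fin (n - 1), 2 ≤ i.1 →
    strLen (C.e i) b = strLen (C.e i) c ∧ strLen (C.f i) b = strLen (C.f i) c
  comm_bar : ∀ (h : 2 ≤ n) (i : Fin (n - 1)), 2 ≤ i.1 →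
    OpsCommute (C.e i) (C.eBar h) ∧ OpsCommute (C.e i) (C.fBar h) ∧
    OpsCommute (C.f i) (C.eBar h) ∧ OpsCommute (C.f i) (C.fBar h)
  strLen_bar_zero : ∀ (h : 2 ≤ n) b,
    (C.wt b (fstIdx (by omega)) = 0 ∧ C.wt b (sndIdx h) = 0) →
    strLen (C.eBar h) b + strLen (C.fBar h) b = 0
  strLen_bar_one : ∀ (h : 2 ≤ n) b,
    ¬ (C.wt b (fstIdx (by omega)) = 0 ∧ C.wt b (sndIdx h) = 0) →
    strLen (C.eBar h) b + strLen (C.fBar h) b = 1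

/-- Abstract `q⁺_n`-crystals. -/
structure IsQPlusCrystal {n : ℕ} {B : Type*} (C : CrystalData n B) : Prop
    extends IsQCrystal C where
  e0_iff_f0 : ∀ b c, C.e0 b = some c ↔ C.f0 c = some b
  wt_e0 : ∀ b c, C.e0 b = some c → C.wt b = C.wt c
  strLen_e0 : ∀ b c, C.e0 b = some c → ∀ i : Fin (n - 1),
    strLen (C.e i) b = strLen (C.e i) c ∧ strLen (C.f i) b = strLen (C.f i) c
  strLen_bar_e0 : ∀ (h : 2 ≤ n) b c, C.e0 b = some c →
    strLen (C.eBar h) b = strLen (C.eBar h) c ∧ strLen (C.fBar h) b = strLen (C.fBar h) c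
  comm_zero : ∀ i : Fin (n - 1), 1 ≤ i.1 →
    OpsCommute (C.e i) C.e0 ∧ OpsCommute (C.e i) C.f0 ∧
    OpsCommute (C.f i) C.e0 ∧ OpsCommute (C.f i) C.f0
  strLen_zero_zero : ∀ (h : 1 ≤ n) b, C.wt b (fstIdx h) = 0 →
    strLen C.e0 b + strLen C.f0 b = 0
  strLen_zero_one : ∀ (h : 1 ≤ n) b, C.wt b (fstIdx h) ≠ 0 →
    strLen C.e0 b + strLen C.f0 b = 1

/-! ## Primed letters -/

/-- A letter `i` or `i' = i - 1/2`, where `i = val` is an integer. -/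
@[ext] structure PLetter where
  val : ℤ
  primed : Bool
  deriving DecidableEq

/-- Twice the half-integer that the letter stands for. -/
def PLetter.twice (x : PLetter) : ℤ := 2 * x.val - (if x.primed then 1 else 0)

theorem PLetter.twice_injective : Function.Injective PLetter.twice := by
  rintro ⟨a, p⟩ ⟨b, q⟩ h
  cases p <;> cases q <;> simp [PLetter.twice] at h ⊢ <;> omega

/-- The order `⋯ < 1' < 1 < 2' < 2 < ⋯` of half-integers. -/
instance : LinearOrder PLetter := LinearOrder.lift' PLetter.twice PLetter.twice_injective

def PLetter.toggle (x : PLetter) : PLetter := ⟨x.val, !x.primed⟩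

def unprime (w : List PLetter) : List ℤ := w.map PLetter.val

/-! ## Involution words -/

/-- The Demazure product `π ∘ s_i` for the simple transposition `s_i = (i, i + 1)`. -/
def demazureMul (π : Equiv.Perm ℤ) (i : ℤ) : Equiv.Perm ℤ :=
  if π i < π (i + 1) then π * Equiv.swap i (i + 1) else π

/-- `s_{b_1} ∘ s_{b_2} ∘ ⋯ ∘ s_{b_k}` for a word `b_1 b_2 ⋯ b_k`. -/
def demazureProd (b : List ℤ) : Equiv.Perm ℤ := b.foldl demazureMul 1

/-- `s_{a_k} ∘ ⋯ ∘ s_{a_1} ∘ 1 ∘ s_{a_1} ∘ ⋯ ∘ s_{a_k}` for a word `a_1 a_2 ⋯ a_k`. -/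
def invProd (a : List ℤ) : Equiv.Perm ℤ := demazureProd (a.reverse ++ a)

def IsInvWord (z : Equiv.Perm ℤ) (a : List ℤ) : Prop :=
  invProd a = z ∧ ∀ b : List ℤ, invProd b = z → a.length ≤ b.length

/-- The position `k` (counted from `0`) is a commutation of the word `a`. -/
def IsCommutation (a : List ℤ) (k : ℕ) : Prop :=
  ∃ h : k < a.length,
    invProd (a.take k) a[k] = a[k] ∧ invProd (a.take k) (1 + a[k]) = 1 + a[k]

/-- Primed involution words. -/
def IsPrimedInvWord (z : Equiv.Perm ℤ) (w : List PLetter) : Prop :=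
  IsInvWord z (unprime w) ∧
    ∀ (k : ℕ) (h : k < w.length), w[k].primed = true → IsCommutation (unprime w) k

/-- Factorizations into `n` strictly increasing primed words whose concatenation is a primed
involution word for `z`. -/
def Incr (n : ℕ) (z : Equiv.Perm ℤ) : Set (Fin n → List PLetter) :=
  {a | (∀ i, (a i).Pairwise (· < ·)) ∧ IsPrimedInvWord z (List.ofFn a).flatten}

/-! ## Involution shape -/

noncomputable def invCode (z : Equiv.Perm ℤ) (i : ℤ) : ℕ :=
  Set.ncard {j : ℤ | z j ≤ i ∧ i < j ∧ z j < z i}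

/-- The parts `μ(z)_1, μ(z)_2, …` (at `k = 0, 1, …`) of the transpose of the partition that
sorts the code: `μ(z)_{k + 1}` is the number of entries of the code that are at least `k + 1`. -/
noncomputable def invShape (z : Equiv.Perm ℤ) (k : ℕ) : ℕ :=
  Set.ncard {i : ℤ | k + 1 ≤ invCode z i}

/-- The number of nonzero parts of `μ(z)`. -/
noncomputable def invShapeLength (z : Equiv.Perm ℤ) : ℕ :=
  Set.ncard {k : ℕ | invShape z k ≠ 0}

/-! ## Operators on increasing factorizations -/

/-- The pairing of `v` and `w` (both strictly increasing). The letters of `w` are treated from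
largest to smallest, that is, the tail of `w` is treated before its head; each is paired with the
smallest unpaired letter of `v` whose unprimed value is strictly larger, if there is one. -/
def pairing (v : List PLetter) : List PLetter → List (PLetter × PLetter)
  | [] => []
  | y :: w =>
    match v.find? (fun x => decide (y.val < x.val ∧ ∀ p ∈ pairing v w, p.1 ≠ x)) with
    | none => pairing v w
    | some x => (x, y) :: pairing v w

def unpairedFst (v w : List PLetter) : List PLetter :=
  v.filter (fun x => decide (∀ p ∈ pairing v w, p.1 ≠ x))

def unpairedSnd (v w : List PLetter) : List PLetter :=
  w.filter (fun y => decide (∀ p ∈ pairing v w, p.2 ≠ y))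

theorem exists_gapAbove (L : List ℤ) (x : ℤ) : ∃ k : ℕ, x + (k : ℤ) ∉ L := by
  by_contra! h
  have hinj : Function.Injective (fun k : ℕ => x + (k : ℤ)) := fun a b hab => by
    simpa using hab
  exact (Set.infinite_range_of_injective hinj)
    ((L.finite_toSet).subset (by rintro _ ⟨k, rfl⟩; exact h k))

theorem exists_gapBelow (L : List ℤ) (y : ℤ) : ∃ k : ℕ, y - (k : ℤ) ∉ L := by
  by_contra! h
  have hinj : Function.Injective (fun k : ℕ => y - (k : ℤ)) := fun a b hab => by
    simpa using hab
  exact (Set.infinite_range_of_injective hinj)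
    ((L.finite_toSet).subset (by rintro _ ⟨k, rfl⟩; exact h k))

/-- The smallest integer `≥ x` that is not in `L`. -/
def gapAbove (L : List ℤ) (x : ℤ) : ℤ := x + (Nat.find (exists_gapAbove L x) : ℤ)

/-- The largest integer `≤ y` that is not in `L`. -/
def gapBelow (L : List ℤ) (y : ℤ) : ℤ := y - (Nat.find (exists_gapBelow L y) : ℤ)

/-- Add a letter to an increasing word. -/
def addLetter (x : PLetter) (w : List PLetter) : List PLetter := w.orderedInsert (· ≤ ·) x

/-- Replace two factors of a factorization. -/
def setTwo {n : ℕ} (a : Fin n → List PLetter) (i j : Fin n) (v w : List PLetter) :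
    Fin n → List PLetter :=
  Function.update (Function.update a i v) j w

/-- For every integer `m` with `x ≤ m ≤ y - 1` such that `m + 1` is in `v` and `m'` is in `w`,
replace `m + 1` in `v` by `(m + 1)'` and `m'` in `w` by `m`. -/
def shiftPrimesLeft (x y : ℤ) (v w : List PLetter) : List PLetter × List PLetter :=
  (v.map fun l =>
      if l.primed = false ∧ x ≤ l.val - 1 ∧ l.val - 1 ≤ y - 1 ∧ (⟨l.val - 1, true⟩ : PLetter) ∈ w
      then ⟨l.val, true⟩ else l,
    w.map fun l =>
      if l.primed = true ∧ x ≤ l.val ∧ l.val ≤ y - 1 ∧ (⟨l.val + 1, false⟩ : PLetter) ∈ v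
      then ⟨l.val, false⟩ else l)

/-- For every integer `m` with `x ≤ m ≤ y - 1` such that `(m + 1)'` is in `v` and `m` is in `w`,
replace `(m + 1)'` in `v` by `m + 1` and `m` in `w` by `m'`. -/
def shiftPrimesRight (x y : ℤ) (v w : List PLetter) : List PLetter × List PLetter :=
  (v.map fun l =>
      if l.primed = true ∧ x ≤ l.val - 1 ∧ l.val - 1 ≤ y - 1 ∧ (⟨l.val - 1, false⟩ : PLetter) ∈ w
      then ⟨l.val, false⟩ else l,
    w.map fun l =>
      if l.primed = false ∧ x ≤ l.val ∧ l.val ≤ y - 1 ∧ (⟨l.val + 1, true⟩ : PLetter) ∈ v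
      then ⟨l.val, true⟩ else l)

def incrF {n : ℕ} (i : Fin (n - 1)) (a : Fin n → List PLetter) :
    Option (Fin n → List PLetter) :=
  match (unpairedFst (a (low i)) (a (high i))).getLast? with
  | none => none
  | some x =>
    let y := gapAbove (unprime (a (high i))) x.val
    let v := (a (low i)).erase x
    let w := addLetter ⟨y, x.primed⟩ (a (high i))
    if x.primed = true then some (setTwo a (low i) (high i) v w)
    else
      let p := shiftPrimesLeft x.val y v w
      some (setTwo a (low i) (high i) p.1 p.2)

def incrE {n : ℕ} (i : Fin (n - 1)) (a : Fin n → List PLetter) :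
    Option (Fin n → List PLetter) :=
  match (unpairedSnd (a (low i)) (a (high i))).head? with
  | none => none
  | some y =>
    let x := gapBelow (unprime (a (low i))) y.val
    let v := addLetter ⟨x, y.primed⟩ (a (low i))
    let w := (a (high i)).erase y
    if y.primed = true then some (setTwo a (low i) (high i) v w)
    else
      let p := shiftPrimesRight x y.val v w
      some (setTwo a (low i) (high i) p.1 p.2)

def incrFBar {n : ℕ} (h : 2 ≤ n) (a : Fin n → List PLetter) : Option (Fin n → List PLetter) :=
  let i : Fin n := fstIdx (by omega)
  let j : Fin n := sndIdx h
  match a i with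
  | [] => none
  | x :: u =>
    if ∀ y ∈ a j, x < y then
      match u with
      | [] => some (setTwo a i j [] (x :: a j))
      | y :: t =>
        if x.primed = y.primed then some (setTwo a i j (y :: t) (x :: a j))
        else some (setTwo a i j (y.toggle :: t) (x.toggle :: a j))
    else none

def incrEBar {n : ℕ} (h : 2 ≤ n) (a : Fin n → List PLetter) : Option (Fin n → List PLetter) :=
  let i : Fin n := fstIdx (by omega)
  let j : Fin n := sndIdx h
  match a j with
  | [] => none
  | y :: u =>
    if ∀ x ∈ a i, y < x then
      match a i with
      | [] => some (setTwo a i j [y] u)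
      | x :: t =>
        if x.primed = y.primed then some (setTwo a i j (y :: x :: t) u)
        else some (setTwo a i j (y.toggle :: x.toggle :: t) u)
    else none

def incrF0 {n : ℕ} (h : 1 ≤ n) (a : Fin n → List PLetter) : Option (Fin n → List PLetter) :=
  match a (fstIdx h) with
  | [] => none
  | x :: u =>
    if x.primed = true then none
    else some (Function.update a (fstIdx h) (⟨x.val, true⟩ :: u))

def incrE0 {n : ℕ} (h : 1 ≤ n) (a : Fin n → List PLetter) : Option (Fin n → List PLetter) :=
  match a (fstIdx h) with
  | [] => none
  | x :: u =>
    if x.primed = true then some (Function.update a (fstIdx h) (⟨x.val, false⟩ :: u))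
    else none

end QPlus

namespace QPlus

open Equiv

/-! ## Involutions and the one-letter step -/

/-! Left and right Demazure multiplication commute, so `invProd` can be computed one letter at a
time: a letter `x` that is an ascent of the current involution `u` replaces `u` by `u * s_x` if `x`,
`x + 1` are fixed and by `s_x * u * s_x` otherwise, and a letter at a descent does nothing
(`invProd_eq_act`). Each effective step raises twice the number of inversions plus the number of
moved points by exactly 4, so involution words are precisely the words in which every letter is an
ascent (`isInvWord_iff`). With the condition on primes added this becomes the recursive predicate
`Leads`. All closure statements then follow from three rewriting rules for primed words: distant
letters commute together with their primes (`wordEqv_pair`); a braid move exchanges the marks of the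
two outer letters (`wordEqv_braid`); and the first two letters of a whole word may be exchanged
while the marks keep their positions (`leads_one_exchange`).

For the ordinary operators, consider two adjacent rows with underlying integer sets `V`, `W` and the
function `height V W t = #{m ∈ V : m ≤ t} - #{m ∈ W : m < t}`. A letter of the first row is unpaired
iff it is a strict record of the height from the left, and a letter of the second row iff it is a
strict record from the right (`unpaired_fst_iff`, `unpaired_snd_iff`). Hence `f_i` acts at the first
place where the height is maximal and `e_i` at the last one. Two copies of the same block of
consecutive integers can never follow each other in a primed involution word (`not_leads_blocks`).
This forces the first row to contain `x, …, x + k` and the second `x, …, x + k - 1`, with gaps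
around them, when `f_i` moves `x` to `x + k`. Such a configuration is a `Slide`. Iterated braid
moves (`wordEqv_blocks`) turn it into the configuration after the move, and the marks they produce
are exactly those prescribed by the definition of the operators. The move turns the first maximum
`x` into the last maximum `x + k` and leaves all other records alone. So `e_i` and `f_i` are inverse
to each other, and the string lengths are the numbers of unpaired letters.

The queer operators only touch the beginning of the word, where the starting involution is the
identity. There they are the exchange of the first two letters followed by commutations. The first
two rows cannot begin with the same integer (`head_val_ne`), so exactly one of `e`, `f` is defined
unless both rows are empty. The operators `e_0`, `f_0` work because the first letter of a word is
always a commutation.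

For nonemptiness, sweep through the positions from right to left and undo every descent that is met.
Each nonzero entry of the involution code is moved one step to the right and lowered by one, and the
letters used form a single increasing word (`exists_peel`). As the code is bounded by the number of
parts of its transpose, `n` sweeps reach the identity. -/

theorem swap_succ_apply (x j : ℤ) :
    swap x (x + 1) j = if j = x then x + 1 else if j = x + 1 then x else j :=
  swap_apply_def x (x + 1) j

theorem swap_succ_cases (x j : ℤ) :
    (j = x ∧ swap x (x + 1) j = x + 1) ∨ (j = x + 1 ∧ swap x (x + 1) j = x) ∨
      (j ≠ x ∧ j ≠ x + 1 ∧ swap x (x + 1) j = j) := by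
  rw [swap_succ_apply]
  by_cases h1 : j = x
  · simp [h1]
  · by_cases h2 : j = x + 1
    · simp [h2]
    · simp [h1, h2]

/-- The transposition `s_x` only reverses the order of the pair `x`, `x + 1`. -/
theorem swap_succ_lt_iff (x i j : ℤ) (h : ¬ (i = x ∧ j = x + 1)) (h' : ¬ (i = x + 1 ∧ j = x)) :
    swap x (x + 1) i < swap x (x + 1) j ↔ i < j := by
  rcases swap_succ_cases x i with hi | hi | hi <;> rcases swap_succ_cases x j with hj | hj | hj <;>
    omega

/-- The left Demazure product `s_x ∘ π`. -/
def lmul (x : ℤ) (π : Perm ℤ) : Perm ℤ :=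
  if π⁻¹ x < π⁻¹ (x + 1) then swap x (x + 1) * π else π

theorem inv_eq_of_apply {π : Perm ℤ} {i j : ℤ} (h : π i = j) : π⁻¹ j = i := by
  rw [← h]; simp

theorem apply_eq_of_inv {π : Perm ℤ} {i j : ℤ} (h : π⁻¹ j = i) : π i = j := by
  rw [← h]; simp

/-- Left multiplication by `s_x` permutes values and right multiplication by `s_i` permutes
positions. Neither affects the test for the other unless `π` maps `{i, i + 1}` onto `{x, x + 1}`. In
that case `s_x * π = π * s_i`, and both sides are the larger of the two permutations. -/
theorem lmul_demazureMul (x i : ℤ) (π : Perm ℤ) :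
    lmul x (demazureMul π i) = demazureMul (lmul x π) i := by
  have key : π i = x → π (i + 1) = x + 1 →
      swap x (x + 1) * π = π * swap i (i + 1) := by
    intro h1 h2
    have : swap x (x + 1) = swap (π i) (π (i + 1)) := by rw [h1, h2]
    rw [this, Equiv.swap_apply_apply]; simp
  have key' : π i = x + 1 → π (i + 1) = x →
      swap x (x + 1) * π = π * swap i (i + 1) := by
    intro h1 h2
    have : swap x (x + 1) = swap (π i) (π (i + 1)) := by rw [h1, h2, swap_comm]
    rw [this, Equiv.swap_apply_apply]; simp
  by_cases hx : π i = x ∧ π (i + 1) = x + 1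
  · have e1 := inv_eq_of_apply hx.1
    have e2 := inv_eq_of_apply hx.2
    have k := key hx.1 hx.2
    have : lmul x π = demazureMul π i := by
      unfold lmul demazureMul
      rw [e1, e2, hx.1, hx.2, if_pos (by omega), if_pos (by omega), k]
    rw [this]
    have hd : demazureMul π i = π * swap i (i + 1) := by
      unfold demazureMul; rw [hx.1, hx.2, if_pos (by omega)]
    rw [hd]
    unfold lmul demazureMul
    rw [if_neg, if_neg]
    · simp [hx.1, hx.2]
    · rw [mul_inv_rev, swap_inv, Perm.mul_apply, Perm.mul_apply, e1, e2]; simp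
  · by_cases hx' : π i = x + 1 ∧ π (i + 1) = x
    · have e1 := inv_eq_of_apply hx'.1
      have e2 := inv_eq_of_apply hx'.2
      have h1 : lmul x π = π := by
        unfold lmul; rw [e1, e2, if_neg (by omega)]
      have h2 : demazureMul π i = π := by
        unfold demazureMul; rw [hx'.1, hx'.2, if_neg (by omega)]
      rw [h1, h2, h1]
    · have a1 : (swap i (i + 1) (π⁻¹ x) < swap i (i + 1) (π⁻¹ (x + 1))) ↔
          (π⁻¹ x < π⁻¹ (x + 1)) := by
        apply swap_succ_lt_iff
        · rintro ⟨h1, h2⟩; exact hx ⟨apply_eq_of_inv h1, apply_eq_of_inv h2⟩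
        · rintro ⟨h1, h2⟩; exact hx' ⟨apply_eq_of_inv h2, apply_eq_of_inv h1⟩
      have a2 : (swap x (x + 1) (π i) < swap x (x + 1) (π (i + 1))) ↔ (π i < π (i + 1)) := by
        apply swap_succ_lt_iff
        · exact hx
        · exact hx'
      have b1 : (π * swap i (i + 1))⁻¹ x < (π * swap i (i + 1))⁻¹ (x + 1) ↔
          π⁻¹ x < π⁻¹ (x + 1) := by
        rw [mul_inv_rev, swap_inv]; exact a1
      have b2 : (swap x (x + 1) * π) i < (swap x (x + 1) * π) (i + 1) ↔ π i < π (i + 1) := a2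
      unfold lmul demazureMul
      by_cases c1 : π i < π (i + 1) <;> by_cases c2 : π⁻¹ x < π⁻¹ (x + 1) <;>
        simp only [c1, c2, if_true, if_false, b1, b2, mul_assoc]

theorem demazureProd_append_singleton (b : List ℤ) (x : ℤ) :
    demazureProd (b ++ [x]) = demazureMul (demazureProd b) x := by
  simp [demazureProd]

theorem demazureProd_cons (x : ℤ) (b : List ℤ) :
    demazureProd (x :: b) = lmul x (demazureProd b) := by
  induction b using List.reverseRecOn with
  | nil => simp [demazureProd, lmul, demazureMul]
  | append_singleton b y ih =>
    rw [← List.cons_append, demazureProd_append_singleton, ih, demazureProd_append_singleton,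
      lmul_demazureMul]

/-- The pair `x`, `x + 1` is fixed by `u`. -/
def FixedPair (u : Perm ℤ) (x : ℤ) : Prop := u x = x ∧ u (x + 1) = x + 1

instance (u : Perm ℤ) (x : ℤ) : Decidable (FixedPair u x) := by
  unfold FixedPair; infer_instance

/-- The involution `s_x ∘ u ∘ s_x`, for an involution `u`. -/
def invStep (u : Perm ℤ) (x : ℤ) : Perm ℤ :=
  if u x < u (x + 1) then
    if FixedPair u x then u * swap x (x + 1) else swap x (x + 1) * u * swap x (x + 1)
  else u

theorem inv_of_involutive {u : Perm ℤ} (hu : Function.Involutive u) : u⁻¹ = u := by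
  ext i
  rw [Perm.inv_eq_iff_eq]
  exact (hu i).symm

/-- An ascent at `x` of an involution whose values at `x`, `x + 1` are again `x`, `x + 1` fixes
them. -/
theorem demazureMul_lmul {u : Perm ℤ} (hu : Function.Involutive u) (x : ℤ) :
    demazureMul (lmul x u) x = invStep u x := by
  unfold lmul invStep
  rw [inv_of_involutive hu]
  by_cases h : u x < u (x + 1)
  · rw [if_pos h, if_pos h]
    unfold demazureMul
    by_cases hf : FixedPair u x
    · rw [if_pos hf, if_neg]
      · ext j
        simp only [Perm.mul_apply]
        rcases swap_succ_cases x j with hj | hj | hj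
        · rw [hj.2, hj.1, hf.1, hf.2]; simp
        · rw [hj.2, hj.1, hf.1, hf.2]; simp
        · rw [hj.2.2]
          apply swap_apply_of_ne_of_ne
          · intro h2; apply hj.1; rw [← hu j, h2, hf.1]
          · intro h2; apply hj.2.1; rw [← hu j, h2, hf.2]
      · simp [hf.1, hf.2]
    · rw [if_neg hf, if_pos]
      simp only [Perm.mul_apply]
      rw [swap_succ_lt_iff]
      · exact h
      · exact hf
      · rintro ⟨h1, h2⟩; omega
  · rw [if_neg h, if_neg h]
    unfold demazureMul
    rw [if_neg h]

theorem invStep_involutive {u : Perm ℤ} (hu : Function.Involutive u) (x : ℤ) :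
    Function.Involutive (invStep u x) := by
  unfold invStep
  split_ifs with h hf
  · intro j
    simp only [Perm.mul_apply]
    rcases swap_succ_cases x j with hj | hj | hj
    · rw [hj.2, hj.1, hf.2]; simp [hf.1]
    · rw [hj.2, hj.1, hf.1]; simp [hf.2]
    · rw [hj.2.2, swap_apply_of_ne_of_ne, hu]
      · intro h2; apply hj.1; rw [← hu j, h2, hf.1]
      · intro h2; apply hj.2.1; rw [← hu j, h2, hf.2]
  · intro j
    simp [Perm.mul_apply, hu _]
  · exact hu

/-- The involution reached from `u` by a word. -/
def act (u : Perm ℤ) (a : List ℤ) : Perm ℤ := a.foldl invStep u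

theorem act_involutive {u : Perm ℤ} (hu : Function.Involutive u) (a : List ℤ) :
    Function.Involutive (act u a) := by
  induction a generalizing u with
  | nil => exact hu
  | cons x a ih => exact ih (invStep_involutive hu x)

theorem one_involutive : Function.Involutive (1 : Perm ℤ) := fun _ => rfl

/-- Appending `x` to `a` surrounds the palindromic product for `a` by `s_x` on both sides, and this
two-sided Demazure multiplication is `invStep`. -/
theorem invProd_eq_act (a : List ℤ) : invProd a = act 1 a := by
  induction a using List.reverseRecOn with
  | nil => rfl
  | append_singleton a x ih =>
    have : (a ++ [x]).reverse ++ (a ++ [x]) = (x :: (a.reverse ++ a)) ++ [x] := by simp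
    unfold invProd
    rw [this, demazureProd_append_singleton, demazureProd_cons]
    change demazureMul (lmul x (invProd a)) x = _
    rw [ih, demazureMul_lmul (act_involutive one_involutive a)]
    simp [act]

/-- `w` is a primed word all of whose letters are ascents, with primes only at commutations,
leading from the involution `u` to `z`. -/
def Leads : Perm ℤ → List PLetter → Perm ℤ → Prop
  | u, [], z => u = z
  | u, l :: w, z => u l.val < u (l.val + 1) ∧ (l.primed = true → FixedPair u l.val) ∧
      Leads (invStep u l.val) w z

theorem leads_append {u z : Perm ℤ} {v w : List PLetter} :
    Leads u (v ++ w) z ↔ ∃ t, Leads u v t ∧ Leads t w z := by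
  induction v generalizing u with
  | nil => simp [Leads]
  | cons l v ih =>
    simp only [List.cons_append, Leads, ih]
    constructor
    · rintro ⟨h1, h2, t, h3, h4⟩; exact ⟨t, ⟨h1, h2, h3⟩, h4⟩
    · rintro ⟨t, ⟨h1, h2, h3⟩, h4⟩; exact ⟨h1, h2, t, h3, h4⟩

theorem Leads.involutive {u z : Perm ℤ} {w : List PLetter} (h : Leads u w z)
    (hu : Function.Involutive u) : Function.Involutive z := by
  induction w generalizing u with
  | nil => exact h ▸ hu
  | cons l w ih => exact ih h.2.2 (invStep_involutive hu _)

/-- Every letter of the word is an ascent when it is applied. -/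
def Ascending : Perm ℤ → List ℤ → Prop
  | _, [] => True
  | u, x :: a => u x < u (x + 1) ∧ Ascending (invStep u x) a

/-- Translates the recursive predicate, on which all rewriting is done, into the positional form
used in the definition of primed involution words. -/
theorem leads_iff {u z : Perm ℤ} {w : List PLetter} :
    Leads u w z ↔ Ascending u (unprime w) ∧ act u (unprime w) = z ∧
      ∀ (k : ℕ) (h : k < w.length), w[k].primed = true →
        FixedPair (act u ((unprime w).take k)) w[k].val := by
  induction w generalizing u with
  | nil => simp [Leads, Ascending, act, unprime]
  | cons l w ih =>
    simp only [Leads, ih, unprime, List.map_cons, Ascending, act, List.foldl_cons]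
    constructor
    · rintro ⟨h1, h2, h3, h4, h5⟩
      refine ⟨⟨h1, h3⟩, h4, ?_⟩
      intro k hk hp
      cases k with
      | zero => exact h2 hp
      | succ k => exact h5 k (by simpa using hk) hp
    · rintro ⟨⟨h1, h3⟩, h4, h5⟩
      exact ⟨h1, fun hp => h5 0 (by simp) hp, h3, h4,
        fun k hk hp => h5 (k + 1) (by simpa using hk) hp⟩

/-- A letter that meets a descent acts trivially and can be deleted. -/
theorem exists_shorter {u : Perm ℤ} {a : List ℤ} (h : ¬ Ascending u a) :
    ∃ b : List ℤ, b.length < a.length ∧ act u b = act u a := by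
  induction a generalizing u with
  | nil => simp [Ascending] at h
  | cons x a ih =>
    by_cases hx : u x < u (x + 1)
    · obtain ⟨b, hb, hab⟩ := ih (u := invStep u x) (fun h' => h ⟨hx, h'⟩)
      exact ⟨x :: b, by simpa using hb, by simpa [act] using hab⟩
    · refine ⟨a, by simp, ?_⟩
      simp [act, invStep, if_neg hx]

/-! ### The length function -/

def inversions (u : Perm ℤ) : Set (ℤ × ℤ) := {p | p.1 < p.2 ∧ u p.2 < u p.1}

def moved (u : Perm ℤ) : Set ℤ := {i | u i ≠ i}

/-- Both entries of an inversion lie between the bounds of the support, since a point outside these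
bounds is fixed and would force the other entry to be fixed as well. -/
theorem inversions_finite {u : Perm ℤ} (h : (moved u).Finite) : (inversions u).Finite := by
  obtain ⟨A, hA⟩ := h.bddBelow
  obtain ⟨B, hB⟩ := h.bddAbove
  have lo : ∀ i, i < A → u i = i := fun i hi => by
    by_contra hc; exact absurd (hA hc) (by omega)
  have hi : ∀ i, B < i → u i = i := fun i hi => by
    by_contra hc; exact absurd (hB hc) (by omega)
  apply ((Set.finite_Icc A B).prod (Set.finite_Icc A B)).subset
  rintro ⟨i, j⟩ ⟨h1, h2⟩
  simp only at h1 h2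
  simp only [Set.mem_prod, Set.mem_Icc]
  have hiA : A ≤ i := by
    by_contra hc
    have e1 := lo i (by omega)
    have e2 := lo (u j) (by omega)
    have := u.injective e2
    omega
  have hjB : j ≤ B := by
    by_contra hc
    have e1 := hi j (by omega)
    have e2 := hi (u i) (by omega)
    have := u.injective e2
    omega
  omega

/-- The transposition reverses no pair of positions other than `(x, x + 1)`, so it carries the old
inversions to inversions and adds that pair. -/
theorem inversions_mul_swap {u : Perm ℤ} {x : ℤ} (h : u x < u (x + 1)) :
    inversions (u * swap x (x + 1)) =
      insert (x, x + 1) ((fun p : ℤ × ℤ => (swap x (x + 1) p.1, swap x (x + 1) p.2)) ''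
        inversions u) := by
  ext ⟨i, j⟩
  simp only [inversions, Set.mem_ofPred_eq, Perm.mul_apply, Set.mem_insert_iff, Prod.mk.injEq,
    Set.mem_image, Prod.exists]
  constructor
  · rintro ⟨h1, h2⟩
    by_cases hij : i = x ∧ j = x + 1
    · exact Or.inl hij
    · refine Or.inr ⟨swap x (x + 1) i, swap x (x + 1) j, ⟨?_, h2⟩, by simp, by simp⟩
      rw [swap_succ_lt_iff _ _ _ hij (by omega)]; exact h1
  · rintro (⟨rfl, rfl⟩ | ⟨a, b, ⟨h1, h2⟩, rfl, rfl⟩)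
    · simpa using h
    · simp only [swap_apply_self]
      refine ⟨?_, h2⟩
      rw [swap_succ_lt_iff]
      · exact h1
      · rintro ⟨rfl, rfl⟩; omega
      · omega

theorem ncard_inversions_mul_swap {u : Perm ℤ} {x : ℤ} (hf : (moved u).Finite)
    (h : u x < u (x + 1)) :
    (inversions (u * swap x (x + 1))).ncard = (inversions u).ncard + 1 := by
  rw [inversions_mul_swap h, Set.ncard_insert_of_notMem _ ((inversions_finite hf).image _),
    Set.ncard_image_of_injective]
  · rintro ⟨a, b⟩ ⟨c, d⟩ hab
    simpa using hab
  · rintro ⟨⟨a, b⟩, ⟨h1, h2⟩, h3⟩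
    simp only [Prod.mk.injEq] at h3 h1
    have ha := swap_succ_cases x a
    have hb := swap_succ_cases x b
    omega

theorem inversions_swap_mul {u : Perm ℤ} {x : ℤ} (h : u⁻¹ x < u⁻¹ (x + 1)) :
    inversions (swap x (x + 1) * u) = insert (u⁻¹ x, u⁻¹ (x + 1)) (inversions u) := by
  ext ⟨i, j⟩
  simp only [inversions, Set.mem_ofPred_eq, Perm.mul_apply, Set.mem_insert_iff, Prod.mk.injEq]
  by_cases hij : u i = x ∧ u j = x + 1
  · have e1 := inv_eq_of_apply hij.1
    have e2 := inv_eq_of_apply hij.2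
    rw [hij.1, hij.2]
    simp only [swap_apply_left, swap_apply_right]
    omega
  · by_cases hij' : u i = x + 1 ∧ u j = x
    · have e1 := inv_eq_of_apply hij'.1
      have e2 := inv_eq_of_apply hij'.2
      rw [hij'.1, hij'.2]
      simp only [swap_apply_left, swap_apply_right]
      omega
    · rw [swap_succ_lt_iff _ _ _ (by tauto) (by tauto)]
      constructor
      · intro h'; exact Or.inr h'
      · rintro (⟨rfl, rfl⟩ | h')
        · exfalso; apply hij; simp
        · exact h'

theorem ncard_inversions_swap_mul {u : Perm ℤ} {x : ℤ} (hf : (moved u).Finite)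
    (h : u⁻¹ x < u⁻¹ (x + 1)) :
    (inversions (swap x (x + 1) * u)).ncard = (inversions u).ncard + 1 := by
  rw [inversions_swap_mul h, Set.ncard_insert_of_notMem _ (inversions_finite hf)]
  rintro ⟨h1, h2⟩
  simp at h2

theorem moved_mul_swap_finite {u : Perm ℤ} (hf : (moved u).Finite) (x : ℤ) :
    (moved (u * swap x (x + 1))).Finite := by
  apply (hf.union (Set.toFinite {x, x + 1})).subset
  intro i hi
  by_contra hc
  simp only [moved, Set.mem_union, Set.mem_ofPred_eq, Set.mem_insert_iff, Set.mem_singleton_iff,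
    not_or, not_not] at hc
  exact hi (by rw [Perm.mul_apply, swap_apply_of_ne_of_ne hc.2.1 hc.2.2, hc.1])

theorem moved_swap_mul_finite {u : Perm ℤ} (hf : (moved u).Finite) (x : ℤ) :
    (moved (swap x (x + 1) * u)).Finite := by
  apply (hf.union (Set.toFinite {x, x + 1})).subset
  intro i hi
  by_contra hc
  simp only [moved, Set.mem_union, Set.mem_ofPred_eq, Set.mem_insert_iff, Set.mem_singleton_iff,
    not_or, not_not] at hc
  exact hi (by rw [Perm.mul_apply, hc.1, swap_apply_of_ne_of_ne hc.2.1 hc.2.2])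

theorem moved_invStep_finite {u : Perm ℤ} (hf : (moved u).Finite) (x : ℤ) :
    (moved (invStep u x)).Finite := by
  unfold invStep
  split_ifs
  · exact moved_mul_swap_finite hf x
  · exact moved_mul_swap_finite (moved_swap_mul_finite hf x) x
  · exact hf

/-- Four times the length of an involution: twice its number of inversions plus the number of
points that it moves. -/
noncomputable def fourLength (u : Perm ℤ) : ℕ := 2 * (inversions u).ncard + (moved u).ncard

/-- A commutation creates one inversion and two moved points. Any other ascent creates two
inversions, one for each side of the conjugation, and keeps the number of moved points. Both
contributions are 4. -/
theorem fourLength_invStep {u : Perm ℤ} (hu : Function.Involutive u) (hf : (moved u).Finite)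
    {x : ℤ} (h : u x < u (x + 1)) : fourLength (invStep u x) = fourLength u + 4 := by
  unfold fourLength invStep
  rw [if_pos h]
  split_ifs with hx
  · have hm : moved (u * swap x (x + 1)) = insert x (insert (x + 1) (moved u)) := by
      ext i
      simp only [moved, Set.mem_ofPred_eq, Perm.mul_apply, Set.mem_insert_iff]
      rcases swap_succ_cases x i with hi | hi | hi
      · rw [hi.2, hi.1, hx.2]; simp
      · rw [hi.2, hi.1, hx.1]; simp
      · rw [hi.2.2]; simp [hi.1, hi.2.1]
    rw [ncard_inversions_mul_swap hf h, hm, Set.ncard_insert_of_notMem _ (hf.insert _),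
      Set.ncard_insert_of_notMem _ hf]
    · omega
    · simp [moved, hx.2]
    · simp [moved, hx.1]
  · have hm : moved (swap x (x + 1) * u * swap x (x + 1)) = swap x (x + 1) '' moved u := by
      ext i
      simp only [moved, Set.mem_ofPred_eq, Perm.mul_apply, Set.mem_image]
      constructor
      · intro hi
        refine ⟨swap x (x + 1) i, ?_, by simp⟩
        intro hc
        apply hi
        rw [hc]; simp
      · rintro ⟨j, hj, rfl⟩
        simpa using hj
    rw [hm, Set.ncard_image_of_injective _ (swap x (x + 1)).injective,
      ncard_inversions_mul_swap (moved_swap_mul_finite hf x), ncard_inversions_swap_mul hf]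
    · omega
    · rwa [inv_of_involutive hu]
    · simp only [Perm.mul_apply]
      rw [swap_succ_lt_iff]
      · exact h
      · exact hx
      · omega

theorem fourLength_act_le {u : Perm ℤ} (hu : Function.Involutive u) (hf : (moved u).Finite)
    (a : List ℤ) : fourLength (act u a) ≤ fourLength u + 4 * a.length := by
  induction a generalizing u with
  | nil => simp [act]
  | cons x a ih =>
    have := ih (invStep_involutive hu x) (moved_invStep_finite hf x)
    simp only [act, List.foldl_cons, List.length_cons] at this ⊢
    by_cases h : u x < u (x + 1)
    · rw [fourLength_invStep hu hf h] at this; omega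
    · have e : invStep u x = u := by unfold invStep; rw [if_neg h]
      rw [e] at this ⊢; omega

theorem fourLength_act_eq {u : Perm ℤ} (hu : Function.Involutive u) (hf : (moved u).Finite)
    {a : List ℤ} (h : Ascending u a) : fourLength (act u a) = fourLength u + 4 * a.length := by
  induction a generalizing u with
  | nil => simp [act]
  | cons x a ih =>
    have := ih (invStep_involutive hu x) (moved_invStep_finite hf x) h.2
    simp only [act, List.foldl_cons, List.length_cons] at this ⊢
    rw [this, fourLength_invStep hu hf h.1]; ring

/-- An ascending word attains the lower bound on the length given by `fourLength`, while a
non-ascending word can be shortened. -/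
theorem isInvWord_iff {z : Perm ℤ} {a : List ℤ} :
    IsInvWord z a ↔ Ascending 1 a ∧ act 1 a = z := by
  have hf : (moved (1 : Perm ℤ)).Finite := by simp [moved]
  unfold IsInvWord
  simp only [invProd_eq_act]
  constructor
  · rintro ⟨h1, h2⟩
    refine ⟨?_, h1⟩
    by_contra hc
    obtain ⟨b, hb, hab⟩ := exists_shorter hc
    exact absurd (h2 b (hab.trans h1)) (by omega)
  · rintro ⟨h1, h2⟩
    refine ⟨h2, fun b hb => ?_⟩
    have e1 := fourLength_act_eq one_involutive hf h1
    have e2 := fourLength_act_le one_involutive hf b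
    rw [h2] at e1
    rw [hb] at e2
    omega

theorem isPrimedInvWord_iff {z : Perm ℤ} {w : List PLetter} :
    IsPrimedInvWord z w ↔ Leads 1 w z := by
  unfold IsPrimedInvWord
  rw [isInvWord_iff, leads_iff, and_assoc]
  refine and_congr_right fun _ => and_congr_right fun _ => ?_
  refine forall_congr' fun k => forall_congr' fun hk => imp_congr_right fun _ => ?_
  unfold IsCommutation FixedPair
  have e : (unprime w)[k]'(by simpa [unprime] using hk) = w[k].val := by simp [unprime]
  constructor
  · rintro ⟨h, h1, h2⟩
    rw [e, invProd_eq_act] at h1 h2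
    rw [add_comm] at h2
    exact ⟨h1, h2⟩
  · rintro ⟨h1, h2⟩
    refine ⟨by simpa [unprime] using hk, ?_⟩
    rw [e, invProd_eq_act, add_comm 1]
    exact ⟨h1, h2⟩

end QPlus

/-! ### Equivalence of primed words and commutation of distant letters -/

namespace QPlus

open Equiv

theorem invStep_of_fixed {u : Perm ℤ} {x : ℤ} (h : FixedPair u x) :
    invStep u x = u * swap x (x + 1) := by
  unfold invStep
  rw [if_pos (by rw [h.1, h.2]; omega), if_pos h]

theorem invStep_of_not_fixed {u : Perm ℤ} {x : ℤ} (ha : u x < u (x + 1)) (h : ¬ FixedPair u x) :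
    invStep u x = swap x (x + 1) * u * swap x (x + 1) := by
  unfold invStep
  rw [if_pos ha, if_neg h]

/-- Two primed words are equivalent if they lead from each involution to the same involution, or
both are not allowed. -/
def WordEqv (v w : List PLetter) : Prop :=
  ∀ u z : Perm ℤ, Function.Involutive u → (Leads u v z ↔ Leads u w z)

theorem WordEqv.refl (v : List PLetter) : WordEqv v v := fun _ _ _ => Iff.rfl

theorem WordEqv.symm {v w : List PLetter} (h : WordEqv v w) : WordEqv w v :=
  fun u z hu => (h u z hu).symm

theorem WordEqv.trans {v w t : List PLetter} (h : WordEqv v w) (h' : WordEqv w t) : WordEqv v t :=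
  fun u z hu => (h u z hu).trans (h' u z hu)

theorem WordEqv.append_left {v w : List PLetter} (h : WordEqv v w) (a : List PLetter) :
    WordEqv (a ++ v) (a ++ w) := by
  intro u z hu
  rw [leads_append, leads_append]
  exact exists_congr fun t => and_congr_right fun ht => h t z (ht.involutive hu)

theorem WordEqv.append_right {v w : List PLetter} (h : WordEqv v w) (a : List PLetter) :
    WordEqv (v ++ a) (w ++ a) := by
  intro u z hu
  rw [leads_append, leads_append]
  exact exists_congr fun t => and_congr_left fun _ => h u t hu

theorem WordEqv.cons {v w : List PLetter} (h : WordEqv v w) (l : PLetter) :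
    WordEqv (l :: v) (l :: w) := h.append_left [l]

/-- The disjoint transpositions commute, and acting by one letter does not change whether the other
one is a commutation. The four cases record which of the two letters are commutations of `u`. -/
theorem leads_pair_of_far {u z : Perm ℤ} (hu : Function.Involutive u) {a b : PLetter}
    (h : a.val + 2 ≤ b.val ∨ b.val + 2 ≤ a.val) (H : Leads u [a, b] z) : Leads u [b, a] z := by
  obtain ⟨x, p⟩ := a
  obtain ⟨y, q⟩ := b
  simp only [Leads] at h H ⊢
  obtain ⟨h1, h2, h3, h4, rfl⟩ := H
  have sx : ∀ j, j ≠ x → j ≠ x + 1 → swap x (x + 1) j = j := fun j => swap_apply_of_ne_of_ne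
  have sy : ∀ j, j ≠ y → j ≠ y + 1 → swap y (y + 1) j = j := fun j => swap_apply_of_ne_of_ne
  have hc : swap x (x + 1) * swap y (y + 1) = swap y (y + 1) * swap x (x + 1) := by
    ext j
    simp only [Perm.mul_apply]
    have c1 := swap_succ_cases x j
    have c2 := swap_succ_cases y j
    have c3 := swap_succ_cases x (swap y (y + 1) j)
    have c4 := swap_succ_cases y (swap x (x + 1) j)
    omega
  have fpx : FixedPair (invStep u y) x ↔ FixedPair u x := by
    unfold invStep
    split_ifs
    · unfold FixedPair
      simp only [Perm.mul_apply]
      rw [sy x (by omega) (by omega), sy (x + 1) (by omega) (by omega)]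
    · unfold FixedPair
      simp only [Perm.mul_apply]
      rw [sy x (by omega) (by omega), sy (x + 1) (by omega) (by omega)]
      have c1 := swap_succ_cases y (u x)
      have c2 := swap_succ_cases y (u (x + 1))
      omega
    · rfl
  have fpy : FixedPair (invStep u x) y ↔ FixedPair u y := by
    unfold invStep
    split_ifs
    · unfold FixedPair
      simp only [Perm.mul_apply]
      rw [sx y (by omega) (by omega), sx (y + 1) (by omega) (by omega)]
    · unfold FixedPair
      simp only [Perm.mul_apply]
      rw [sx y (by omega) (by omega), sx (y + 1) (by omega) (by omega)]
      have c1 := swap_succ_cases x (u y)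
      have c2 := swap_succ_cases x (u (y + 1))
      omega
  have i1 : u y = x → u x = y := fun e => by rw [← e, hu]
  have i2 : u (y + 1) = x + 1 → u (x + 1) = y + 1 := fun e => by rw [← e, hu]
  have i3 : u x = y → u y = x := fun e => by rw [← e, hu]
  have i4 : u (x + 1) = y + 1 → u (y + 1) = x + 1 := fun e => by rw [← e, hu]
  have i5 : u y = x + 1 → u (x + 1) = y := fun e => by rw [← e, hu]
  have i6 : u (y + 1) = x → u x = y + 1 := fun e => by rw [← e, hu]
  have i7 : u (x + 1) = y → u y = x + 1 := fun e => by rw [← e, hu]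
  have i8 : u x = y + 1 → u (y + 1) = x := fun e => by rw [← e, hu]
  by_cases fx : FixedPair u x
  · have ey : u y < u (y + 1) := by
      rw [invStep_of_fixed fx] at h3
      simp only [Perm.mul_apply] at h3
      rwa [sx y (by omega) (by omega), sx (y + 1) (by omega) (by omega)] at h3
    by_cases fy : FixedPair u y
    · have e1 := invStep_of_fixed (fpx.2 fx)
      have e2 := invStep_of_fixed (fpy.2 fy)
      rw [invStep_of_fixed fy] at e1
      rw [invStep_of_fixed fx] at e2
      refine ⟨ey, fun _ => fy, ?_, fun _ => fpx.2 fx, ?_⟩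
      · rw [(fpx.2 fx).1, (fpx.2 fx).2]; omega
      · rw [invStep_of_fixed fx, invStep_of_fixed fy, e1, e2, mul_assoc, mul_assoc, hc]
    · have e1 := invStep_of_fixed (fpx.2 fx)
      have e2 := invStep_of_not_fixed h3 (mt fpy.1 fy)
      rw [invStep_of_not_fixed ey fy] at e1
      rw [invStep_of_fixed fx] at e2
      refine ⟨ey, fun k => absurd (fpy.1 (h4 k)) fy, ?_, fun _ => fpx.2 fx, ?_⟩
      · rw [(fpx.2 fx).1, (fpx.2 fx).2]; omega
      · rw [invStep_of_fixed fx, invStep_of_not_fixed ey fy, e1, e2]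
        simp only [mul_assoc, hc]
  · have h3' := h3
    rw [invStep_of_not_fixed h1 fx] at h3
    simp only [Perm.mul_apply] at h3
    rw [sx y (by omega) (by omega), sx (y + 1) (by omega) (by omega)] at h3
    have ne : u y ≠ u (y + 1) := fun e => by have := u.injective e; omega
    have ey : u y < u (y + 1) := by
      have c1 := swap_succ_cases x (u y)
      have c2 := swap_succ_cases x (u (y + 1))
      omega
    by_cases fy : FixedPair u y
    · have h3x : invStep u y x < invStep u y (x + 1) := by
        rw [invStep_of_fixed fy]
        simp only [Perm.mul_apply]
        rwa [sy x (by omega) (by omega), sy (x + 1) (by omega) (by omega)]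
      have e1 := invStep_of_not_fixed h3x (mt fpx.1 fx)
      have e2 := invStep_of_fixed (fpy.2 fy)
      rw [invStep_of_fixed fy] at e1
      rw [invStep_of_not_fixed h1 fx] at e2
      refine ⟨ey, fun _ => fy, h3x, fun k => absurd (h2 k) fx, ?_⟩
      rw [invStep_of_fixed fy, invStep_of_not_fixed h1 fx, e1, e2]
      simp only [mul_assoc, hc]
    · have h3x : invStep u y x < invStep u y (x + 1) := by
        rw [invStep_of_not_fixed ey fy]
        simp only [Perm.mul_apply]
        rw [sy x (by omega) (by omega), sy (x + 1) (by omega) (by omega)]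
        -- The comparison could only be reversed if `u x = y` and `u (x + 1) = y + 1`. Then `u` maps
        -- `y`, `y + 1` back to `x`, `x + 1`, and after the letter `x` the letter `y` would have
        -- been a descent.
        rw [swap_succ_lt_iff]
        · exact h1
        · rintro ⟨g1, g2⟩
          have g3 := i3 g1
          have g4 := i4 g2
          rw [g3, g4] at h3
          simp at h3
        · omega
      have e1 := invStep_of_not_fixed h3x (mt fpx.1 fx)
      have e2 := invStep_of_not_fixed h3' (mt fpy.1 fy)
      rw [invStep_of_not_fixed ey fy] at e1
      rw [invStep_of_not_fixed h1 fx] at e2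
      refine ⟨ey, fun k => absurd (fpy.1 (h4 k)) fy, h3x, fun k => absurd (h2 k) fx, ?_⟩
      rw [invStep_of_not_fixed h1 fx, invStep_of_not_fixed ey fy, e1, e2]
      simp only [mul_assoc, hc]
      rw [← mul_assoc, hc, mul_assoc]

theorem wordEqv_pair {a b : PLetter} (h : a.val + 2 ≤ b.val ∨ b.val + 2 ≤ a.val) :
    WordEqv [a, b] [b, a] :=
  fun _ _ hu => ⟨leads_pair_of_far hu h, leads_pair_of_far hu h.symm⟩

theorem wordEqv_cons_append {a : PLetter} {w : List PLetter}
    (h : ∀ b ∈ w, a.val + 2 ≤ b.val ∨ b.val + 2 ≤ a.val) :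
    WordEqv (a :: w) (w ++ [a]) := by
  induction w with
  | nil => exact WordEqv.refl _
  | cons b w ih =>
    have h1 : WordEqv (a :: b :: w) (b :: a :: w) :=
      (wordEqv_pair (h b (by simp))).append_right w
    exact h1.trans ((ih fun c hc => h c (by simp [hc])).cons b)

theorem wordEqv_append_comm {v w : List PLetter}
    (h : ∀ a ∈ v, ∀ b ∈ w, a.val + 2 ≤ b.val ∨ b.val + 2 ≤ a.val) :
    WordEqv (v ++ w) (w ++ v) := by
  induction v with
  | nil => simpa using WordEqv.refl w
  | cons a v ih =>
    have h1 : WordEqv (a :: v ++ w) (a :: (w ++ v)) :=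
      (ih fun c hc => h c (by simp [hc])).cons a
    have h2 : WordEqv (a :: w ++ v) (w ++ [a] ++ v) :=
      (wordEqv_cons_append (h a (by simp))).append_right v
    simpa using h1.trans h2

/-! ### Braid relations -/

theorem swap_braid (x : ℤ) :
    swap (x + 1) (x + 1 + 1) * (swap x (x + 1) * swap (x + 1) (x + 1 + 1)) =
      swap x (x + 1) * (swap (x + 1) (x + 1 + 1) * swap x (x + 1)) := by
  ext j
  simp only [Perm.mul_apply]
  simp only [swap_succ_apply]
  split_ifs <;> omega

/-- The conditions under which the two braid words at `x`, `x + 1` are allowed. -/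
def BraidAllowed (u : Perm ℤ) (x : ℤ) (p r q : Bool) : Prop :=
  u x < u (x + 1) ∧ u (x + 1) < u (x + 1 + 1) ∧ ¬ (FixedPair u x ∧ FixedPair u (x + 1)) ∧
    r = false ∧ (p = true → FixedPair u x) ∧ (q = true → FixedPair u (x + 1))

/-- The result of the two braid words at `x`, `x + 1`. -/
def braidStep (u : Perm ℤ) (x : ℤ) : Perm ℤ :=
  if FixedPair u x then
    swap x (x + 1) * (swap (x + 1) (x + 1 + 1) * (u * (swap x (x + 1) *
      (swap (x + 1) (x + 1 + 1) * swap x (x + 1)))))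
  else if FixedPair u (x + 1) then
    swap (x + 1) (x + 1 + 1) * (swap x (x + 1) * (u * (swap x (x + 1) *
      (swap (x + 1) (x + 1 + 1) * swap x (x + 1)))))
  else
    swap x (x + 1) * (swap (x + 1) (x + 1 + 1) * (swap x (x + 1) * (u * (swap x (x + 1) *
      (swap (x + 1) (x + 1 + 1) * swap x (x + 1))))))

theorem involutive_apply_iff {u : Perm ℤ} (hu : Function.Involutive u) (i j : ℤ) :
    u i = j ↔ u j = i := by
  rw [eq_comm, ← hu.eq_iff, eq_comm]

/-- The conditions are symmetric: ascents of `u` at `x` and `x + 1`, and not all of `x`, `x + 1`, `x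
+ 2` fixed. The middle letter is never a commutation. The third letter is one exactly if `x + 1`, `x
+ 2` are fixed by `u`, because the first two letters transport that pair to `x`, `x + 1`. -/
theorem leads_braid_low {u z : Perm ℤ} (hu : Function.Involutive u) {x : ℤ} {p r q : Bool} :
    Leads u [⟨x, p⟩, ⟨x + 1, r⟩, ⟨x, q⟩] z ↔ BraidAllowed u x p r q ∧ braidStep u x = z := by
  have n1 : u x ≠ u (x + 1) := fun e => by have := u.injective e; omega
  have n2 : u x ≠ u (x + 1 + 1) := fun e => by have := u.injective e; omega
  have n3 : u (x + 1) ≠ u (x + 1 + 1) := fun e => by have := u.injective e; omega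
  have i1 := involutive_apply_iff hu x (x + 1)
  have i2 := involutive_apply_iff hu x (x + 1 + 1)
  have i3 := involutive_apply_iff hu (x + 1) (x + 1 + 1)
  have g1 : swap (x + 1) (x + 1 + 1) x = x := swap_apply_of_ne_of_ne (by omega) (by omega)
  have g2 : swap x (x + 1) (x + 1 + 1) = x + 1 + 1 :=
    swap_apply_of_ne_of_ne (by omega) (by omega)
  simp only [Leads, BraidAllowed]
  by_cases ha : u x < u (x + 1)
  swap
  · exact ⟨fun h => absurd h.1 ha, fun h => absurd h.1.1 ha⟩
  by_cases f1 : FixedPair u x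
  · have e1 := invStep_of_fixed f1
    have nf2 : ¬ FixedPair (invStep u x) (x + 1) := by
      rw [e1]
      unfold FixedPair
      rintro ⟨h, -⟩
      simp only [Perm.mul_apply, swap_apply_right, f1.1] at h
      omega
    have a2 : invStep u x (x + 1) < invStep u x (x + 1 + 1) ↔ u (x + 1) < u (x + 1 + 1) := by
      rw [e1]
      simp only [Perm.mul_apply, swap_apply_right, g2]
      have := f1.1
      have := f1.2
      omega
    rw [a2]
    by_cases hb : u (x + 1) < u (x + 1 + 1)
    swap
    · exact ⟨fun h => absurd h.2.2.1 hb, fun h => absurd h.1.2.1 hb⟩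
    have e2 := invStep_of_not_fixed (a2.2 hb) nf2
    obtain ⟨v, hv⟩ : ∃ v, v = invStep (invStep u x) (x + 1) := ⟨_, rfl⟩
    rw [← hv] at e2 ⊢
    have vx : v x = x + 1 + 1 := by
      rw [e2, e1]
      simp only [Perm.mul_apply, g1, swap_apply_left, f1.2]
    have vx1 : v (x + 1) = if u (x + 1 + 1) = x + 1 + 1 then x + 1 else u (x + 1 + 1) := by
      rw [e2, e1]
      simp only [Perm.mul_apply, g2, swap_apply_left]
      rw [swap_succ_apply]
      have := f1.1
      have := f1.2
      split_ifs <;> omega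
    have nf3 : ¬ FixedPair v x := by
      rintro ⟨h, -⟩
      omega
    -- Here `v x = x + 2`. If `x + 2` is fixed by `u` then `v (x + 1) = x + 1` is smaller; otherwise
    -- `v (x + 1) = u (x + 2)` exceeds `x + 2`.
    have a3 : v x < v (x + 1) ↔ ¬ FixedPair u (x + 1) := by
      rw [vx, vx1]
      unfold FixedPair
      have := f1.1
      have := f1.2
      split_ifs <;> omega
    rw [a3]
    by_cases f2 : FixedPair u (x + 1)
    · exact ⟨fun h => absurd f2 h.2.2.2.2.1, fun h => absurd ⟨f1, f2⟩ h.1.2.2.1⟩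
    have e3 := invStep_of_not_fixed (a3.2 f2) nf3
    have ez : invStep v x = braidStep u x := by
      rw [e3, e2, e1]
      unfold braidStep
      rw [if_pos f1]
      simp only [mul_assoc]
    rw [ez]
    exact ⟨fun ⟨h1, h2, h3, h4, h5, h6, h7⟩ => ⟨⟨h1, h3, fun h => h5 h.2,
        Bool.eq_false_iff.2 fun h => nf2 (h4 h), h2, fun h => absurd (h6 h) nf3⟩, h7⟩,
      fun ⟨⟨h1, h2, h3, h4, h5, h6⟩, h7⟩ => ⟨h1, h5, h2, fun h => by simp [h4] at h, f2,
        fun h => absurd (h6 h) f2, h7⟩⟩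
  · have e1 := invStep_of_not_fixed ha f1
    have f1' : ¬ (u x = x ∧ u (x + 1) = x + 1) := f1
    by_cases hb : u (x + 1) < u (x + 1 + 1)
    · have a2 : invStep u x (x + 1) < invStep u x (x + 1 + 1) := by
        rw [e1]
        simp only [Perm.mul_apply, swap_apply_right, swap_succ_apply x (x + 1 + 1)]
        rw [if_neg (by omega), if_neg (by omega), swap_succ_lt_iff] <;> omega
      have nf2 : ¬ FixedPair (invStep u x) (x + 1) := by
        rw [e1]
        unfold FixedPair
        simp only [Perm.mul_apply, swap_apply_right, swap_succ_apply x (x + 1 + 1)]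
        rw [if_neg (by omega), if_neg (by omega)]
        have c1 := swap_succ_cases x (u x)
        have c2 := swap_succ_cases x (u (x + 1 + 1))
        omega
      have e2 := invStep_of_not_fixed a2 nf2
      obtain ⟨v, hv⟩ : ∃ v, v = invStep (invStep u x) (x + 1) := ⟨_, rfl⟩
      rw [← hv] at e2 ⊢
      have vx : v x = swap (x + 1) (x + 1 + 1) (swap x (x + 1) (u (x + 1))) := by
        rw [e2, e1]
        simp only [Perm.mul_apply]
        rw [swap_succ_apply (x + 1) x, if_neg (by omega), if_neg (by omega), swap_apply_left]
      have vx1 : v (x + 1) = swap (x + 1) (x + 1 + 1) (swap x (x + 1) (u (x + 1 + 1))) := by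
        rw [e2, e1]
        simp only [Perm.mul_apply]
        rw [swap_apply_left, swap_succ_apply x (x + 1 + 1), if_neg (by omega), if_neg (by omega)]
      have a3 : v x < v (x + 1) := by
        rw [vx, vx1, swap_succ_lt_iff]
        · rw [swap_succ_lt_iff] <;> omega
        · have c1 := swap_succ_cases x (u (x + 1))
          have c2 := swap_succ_cases x (u (x + 1 + 1))
          omega
        · have c1 := swap_succ_cases x (u (x + 1))
          have c2 := swap_succ_cases x (u (x + 1 + 1))
          omega
      have f3 : FixedPair v x ↔ FixedPair u (x + 1) := by
        unfold FixedPair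
        rw [vx, vx1]
        simp only [swap_succ_apply]
        split_ifs <;> omega
      have ez : invStep v x = braidStep u x := by
        unfold braidStep
        rw [if_neg f1]
        by_cases f2 : FixedPair u (x + 1)
        · rw [if_pos f2, invStep_of_fixed (f3.2 f2), e2, e1]
          simp only [mul_assoc]
        · rw [if_neg f2, invStep_of_not_fixed a3 (mt f3.1 f2), e2, e1]
          simp only [mul_assoc]
      rw [ez, f3]
      exact ⟨fun ⟨h1, h2, h3, h4, h5, h6, h7⟩ => ⟨⟨h1, hb, fun h => f1 h.1,
          Bool.eq_false_iff.2 fun h => nf2 (h4 h), h2, h6⟩, h7⟩,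
        fun ⟨⟨h1, h2, h3, h4, h5, h6⟩, h7⟩ => ⟨h1, h5, a2, fun h => by simp [h4] at h, a3, h6, h7⟩⟩
    -- For the middle letter to be an ascent one needs `u x < u (x + 2)`. With a descent of `u` at
    -- `x + 1` the third letter then meets a descent.
    · refine ⟨fun h => ?_, fun h => absurd h.1.2.1 hb⟩
      obtain ⟨-, -, h2, -, h3, -⟩ := h
      exfalso
      by_cases nf2 : FixedPair (invStep u x) (x + 1)
      · rw [invStep_of_fixed nf2, e1] at h3
        rw [e1] at nf2
        obtain ⟨k1, k2⟩ := nf2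
        simp only [Perm.mul_apply, swap_apply_right, swap_apply_left, g1, g2] at h3 k1 k2
        have c1 := swap_succ_cases x (u x)
        have c2 := swap_succ_cases x (u (x + 1 + 1))
        have c3 := swap_succ_cases x (u (x + 1))
        omega
      · rw [invStep_of_not_fixed h2 nf2, e1] at h3
        rw [e1] at h2
        simp only [Perm.mul_apply, swap_apply_right, swap_apply_left, g1, g2] at h2 h3
        have c1 := swap_succ_cases x (u x)
        have c2 := swap_succ_cases x (u (x + 1 + 1))
        have c3 := swap_succ_cases x (u (x + 1))
        have hAC : u x < u (x + 1 + 1) := by clear h3; omega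
        have hCB : u (x + 1 + 1) < u (x + 1) := by omega
        have h4 : swap x (x + 1) (u (x + 1 + 1)) < swap x (x + 1) (u (x + 1)) := by
          rw [swap_succ_lt_iff] <;> omega
        have c4 := swap_succ_cases (x + 1) (swap x (x + 1) (u (x + 1)))
        have c5 := swap_succ_cases (x + 1) (swap x (x + 1) (u (x + 1 + 1)))
        omega

/-- The mirror image of `leads_braid_low`, with the same conditions and the same result. Here the
last letter inherits the pair `x`, `x + 1` of `u`, so the mark `p` now stands at the end. -/
theorem leads_braid_high {u z : Perm ℤ} (hu : Function.Involutive u) {x : ℤ} {p r q : Bool} :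
    Leads u [⟨x + 1, q⟩, ⟨x, r⟩, ⟨x + 1, p⟩] z ↔ BraidAllowed u x p r q ∧ braidStep u x = z := by
  have n1 : u x ≠ u (x + 1) := fun e => by have := u.injective e; omega
  have n2 : u x ≠ u (x + 1 + 1) := fun e => by have := u.injective e; omega
  have n3 : u (x + 1) ≠ u (x + 1 + 1) := fun e => by have := u.injective e; omega
  have i1 := involutive_apply_iff hu x (x + 1)
  have i2 := involutive_apply_iff hu x (x + 1 + 1)
  have i3 := involutive_apply_iff hu (x + 1) (x + 1 + 1)
  have g1 : swap (x + 1) (x + 1 + 1) x = x := swap_apply_of_ne_of_ne (by omega) (by omega)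
  have g2 : swap x (x + 1) (x + 1 + 1) = x + 1 + 1 :=
    swap_apply_of_ne_of_ne (by omega) (by omega)
  simp only [Leads, BraidAllowed]
  by_cases hb : u (x + 1) < u (x + 1 + 1)
  swap
  · exact ⟨fun h => absurd h.1 hb, fun h => absurd h.1.2.1 hb⟩
  by_cases f1 : FixedPair u (x + 1)
  · have e1 := invStep_of_fixed f1
    have nf2 : ¬ FixedPair (invStep u (x + 1)) x := by
      rw [e1]
      unfold FixedPair
      rintro ⟨-, h⟩
      simp only [Perm.mul_apply, swap_apply_left, f1.2] at h
      omega
    have a2 : invStep u (x + 1) x < invStep u (x + 1) (x + 1) ↔ u x < u (x + 1) := by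
      rw [e1]
      simp only [Perm.mul_apply, swap_apply_left, g1]
      have := f1.1
      have := f1.2
      omega
    rw [a2]
    by_cases ha : u x < u (x + 1)
    swap
    · exact ⟨fun h => absurd h.2.2.1 ha, fun h => absurd h.1.1 ha⟩
    have e2 := invStep_of_not_fixed (a2.2 ha) nf2
    obtain ⟨v, hv⟩ : ∃ v, v = invStep (invStep u (x + 1)) x := ⟨_, rfl⟩
    rw [← hv] at e2 ⊢
    have vx : v (x + 1 + 1) = x := by
      rw [e2, e1]
      simp only [Perm.mul_apply, g2, swap_apply_right, f1.1]
    have vx1 : v (x + 1) = if u x = x then x + 1 else u x := by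
      rw [e2, e1]
      simp only [Perm.mul_apply, g1, swap_apply_right]
      rw [swap_succ_apply]
      have := f1.1
      have := f1.2
      split_ifs <;> omega
    have nf3 : ¬ FixedPair v (x + 1) := by
      rintro ⟨-, h⟩
      omega
    have a3 : v (x + 1) < v (x + 1 + 1) ↔ ¬ FixedPair u x := by
      rw [vx, vx1]
      unfold FixedPair
      have := f1.1
      have := f1.2
      split_ifs <;> omega
    rw [a3]
    by_cases f2 : FixedPair u x
    · exact ⟨fun h => absurd f2 h.2.2.2.2.1, fun h => absurd ⟨f2, f1⟩ h.1.2.2.1⟩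
    have e3 := invStep_of_not_fixed (a3.2 f2) nf3
    have ez : invStep v (x + 1) = braidStep u x := by
      rw [e3, e2, e1]
      unfold braidStep
      rw [if_neg f2, if_pos f1]
      simp only [mul_assoc, swap_braid]
    rw [ez]
    exact ⟨fun ⟨h1, h2, h3, h4, h5, h6, h7⟩ => ⟨⟨h3, h1, fun h => h5 h.1,
        Bool.eq_false_iff.2 fun h => nf2 (h4 h), fun h => absurd (h6 h) nf3, h2⟩, h7⟩,
      fun ⟨⟨h1, h2, h3, h4, h5, h6⟩, h7⟩ => ⟨h2, h6, h1, fun h => by simp [h4] at h, f2,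
        fun h => absurd (h5 h) f2, h7⟩⟩
  · have e1 := invStep_of_not_fixed hb f1
    have f1' : ¬ (u (x + 1) = x + 1 ∧ u (x + 1 + 1) = x + 1 + 1) := f1
    by_cases ha : u x < u (x + 1)
    · have a2 : invStep u (x + 1) x < invStep u (x + 1) (x + 1) := by
        rw [e1]
        simp only [Perm.mul_apply, swap_apply_left, swap_succ_apply (x + 1) x]
        rw [if_neg (by omega), if_neg (by omega), swap_succ_lt_iff] <;> omega
      have nf2 : ¬ FixedPair (invStep u (x + 1)) x := by
        rw [e1]
        unfold FixedPair
        simp only [Perm.mul_apply, swap_apply_left, swap_succ_apply (x + 1) x]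
        rw [if_neg (by omega), if_neg (by omega)]
        have c1 := swap_succ_cases (x + 1) (u x)
        have c2 := swap_succ_cases (x + 1) (u (x + 1 + 1))
        omega
      have e2 := invStep_of_not_fixed a2 nf2
      obtain ⟨v, hv⟩ : ∃ v, v = invStep (invStep u (x + 1)) x := ⟨_, rfl⟩
      rw [← hv] at e2 ⊢
      have vx : v (x + 1) = swap x (x + 1) (swap (x + 1) (x + 1 + 1) (u x)) := by
        rw [e2, e1]
        simp only [Perm.mul_apply]
        rw [swap_apply_right, swap_succ_apply (x + 1) x, if_neg (by omega), if_neg (by omega)]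
      have vx1 : v (x + 1 + 1) = swap x (x + 1) (swap (x + 1) (x + 1 + 1) (u (x + 1))) := by
        rw [e2, e1]
        simp only [Perm.mul_apply]
        rw [swap_succ_apply x (x + 1 + 1), if_neg (by omega), if_neg (by omega),
          swap_apply_right]
      have a3 : v (x + 1) < v (x + 1 + 1) := by
        rw [vx, vx1, swap_succ_lt_iff]
        · rw [swap_succ_lt_iff] <;> omega
        · have c1 := swap_succ_cases (x + 1) (u x)
          have c2 := swap_succ_cases (x + 1) (u (x + 1))
          omega
        · have c1 := swap_succ_cases (x + 1) (u x)
          have c2 := swap_succ_cases (x + 1) (u (x + 1))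
          omega
      have f3 : FixedPair v (x + 1) ↔ FixedPair u x := by
        unfold FixedPair
        rw [vx, vx1]
        simp only [swap_succ_apply]
        split_ifs <;> omega
      have ez : invStep v (x + 1) = braidStep u x := by
        unfold braidStep
        by_cases f2 : FixedPair u x
        · rw [if_pos f2, invStep_of_fixed (f3.2 f2), e2, e1]
          simp only [mul_assoc, swap_braid]
        · rw [if_neg f2, if_neg f1, invStep_of_not_fixed a3 (mt f3.1 f2), e2, e1]
          simp only [mul_assoc, swap_braid]
          have := congrArg (· * (u * (swap x (x + 1) * (swap (x + 1) (x + 1 + 1) * swap x (x + 1)))))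
            (swap_braid x)
          simpa only [mul_assoc] using this
      rw [ez, f3]
      exact ⟨fun ⟨h1, h2, h3, h4, h5, h6, h7⟩ => ⟨⟨ha, h1, fun h => f1 h.2,
          Bool.eq_false_iff.2 fun h => nf2 (h4 h), h6, h2⟩, h7⟩,
        fun ⟨⟨h1, h2, h3, h4, h5, h6⟩, h7⟩ => ⟨h2, h6, a2, fun h => by simp [h4] at h, a3, h5, h7⟩⟩
    · refine ⟨fun h => ?_, fun h => absurd h.1.1 ha⟩
      obtain ⟨-, -, h2, -, h3, -⟩ := h
      exfalso
      by_cases nf2 : FixedPair (invStep u (x + 1)) x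
      · rw [invStep_of_fixed nf2, e1] at h3
        rw [e1] at nf2
        obtain ⟨k1, k2⟩ := nf2
        simp only [Perm.mul_apply, swap_apply_right, swap_apply_left, g1, g2] at h3 k1 k2
        have c1 := swap_succ_cases (x + 1) (u x)
        have c2 := swap_succ_cases (x + 1) (u (x + 1 + 1))
        have c3 := swap_succ_cases (x + 1) (u (x + 1))
        omega
      · rw [invStep_of_not_fixed h2 nf2, e1] at h3
        rw [e1] at h2
        simp only [Perm.mul_apply, swap_apply_right, swap_apply_left, g1, g2] at h2 h3
        have c1 := swap_succ_cases (x + 1) (u x)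
        have c2 := swap_succ_cases (x + 1) (u (x + 1 + 1))
        have c3 := swap_succ_cases (x + 1) (u (x + 1))
        have hAC : u x < u (x + 1 + 1) := by clear h3; omega
        have hCB : u (x + 1) < u x := by omega
        have h4 : swap (x + 1) (x + 1 + 1) (u (x + 1)) < swap (x + 1) (x + 1 + 1) (u x) := by
          rw [swap_succ_lt_iff] <;> omega
        have c4 := swap_succ_cases x (swap (x + 1) (x + 1 + 1) (u (x + 1)))
        have c5 := swap_succ_cases x (swap (x + 1) (x + 1 + 1) (u x))
        omega

end QPlus

namespace QPlus

open Equiv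

theorem wordEqv_braid (x : ℤ) (p r q : Bool) :
    WordEqv [⟨x, p⟩, ⟨x + 1, r⟩, ⟨x, q⟩] [⟨x + 1, q⟩, ⟨x, r⟩, ⟨x + 1, p⟩] :=
  fun _ _ hu => (leads_braid_low hu).trans (leads_braid_high hu).symm

/-- Two primed outer letters would require `x`, `x + 1`, `x + 2` all to be fixed, which the braid
conditions exclude. -/
theorem leads_braid_primes {u z : Perm ℤ} (hu : Function.Involutive u) {x : ℤ} {p r q : Bool}
    {w : List PLetter} (h : Leads u ([⟨x, p⟩, ⟨x + 1, r⟩, ⟨x, q⟩] ++ w) z) :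
    r = false ∧ (p = true → q = false) := by
  obtain ⟨t, h1, -⟩ := leads_append.1 h
  obtain ⟨⟨-, -, h3, h4, h5, h6⟩, -⟩ := (leads_braid_low hu).1 h1
  exact ⟨h4, fun hp => Bool.eq_false_iff.2 fun hq => h3 ⟨h5 hp, h6 hq⟩⟩

theorem invStep_descent {u : Perm ℤ} {x : ℤ} (hu : Function.Involutive u) (h : u x < u (x + 1)) :
    ¬ (invStep u x x < invStep u x (x + 1)) := by
  by_cases hf : FixedPair u x
  · rw [invStep_of_fixed hf]
    simp only [Perm.mul_apply, swap_apply_left, swap_apply_right]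
    omega
  · rw [invStep_of_not_fixed h hf]
    simp only [Perm.mul_apply, swap_apply_left, swap_apply_right]
    rw [swap_succ_lt_iff]
    · omega
    · have := involutive_apply_iff hu x (x + 1)
      omega
    · rintro ⟨h1, h2⟩
      exact hf ⟨h2, h1⟩

theorem not_leads_repeat {u z : Perm ℤ} (hu : Function.Involutive u) {x : ℤ} {p q : Bool}
    {w : List PLetter} : ¬ Leads u (⟨x, p⟩ :: ⟨x, q⟩ :: w) z :=
  fun h => invStep_descent hu h.1 h.2.2.1

/-! ### Blocks of consecutive letters -/

/-- The word `x, x + 1, …, x + k - 1` with primes prescribed by `p`. -/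
def block (x : ℤ) : ℕ → (ℤ → Bool) → List PLetter
  | 0, _ => []
  | k + 1, p => ⟨x, p x⟩ :: block (x + 1) k p

theorem mem_block {x : ℤ} {k : ℕ} {p : ℤ → Bool} {l : PLetter} :
    l ∈ block x k p ↔ x ≤ l.val ∧ l.val < x + k ∧ l.primed = p l.val := by
  induction k generalizing x with
  | zero => simp [block]; omega
  | succ k ih =>
    simp only [block, List.mem_cons, ih, PLetter.ext_iff]
    push_cast
    constructor
    · rintro (⟨h1, h2⟩ | ⟨h1, h2, h3⟩)
      · exact ⟨by omega, by omega, by rw [h1, h2]⟩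
      · exact ⟨by omega, by omega, h3⟩
    · rintro ⟨h1, h2, h3⟩
      by_cases h : l.val = x
      · left; exact ⟨h, by rw [h3, h]⟩
      · right; exact ⟨by omega, by omega, h3⟩

theorem block_congr {x : ℤ} {k : ℕ} {p q : ℤ → Bool}
    (h : ∀ m, x ≤ m → m < x + k → p m = q m) : block x k p = block x k q := by
  induction k generalizing x with
  | zero => rfl
  | succ k ih =>
    push_cast at h
    simp only [block]
    rw [h x (by omega) (by omega), ih fun m h1 h2 => h m (by omega) (by omega)]

theorem block_succ_last (x : ℤ) (k : ℕ) (p : ℤ → Bool) :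
    block x (k + 1) p = block x k p ++ [⟨x + k, p (x + k)⟩] := by
  induction k generalizing x with
  | zero => simp [block]
  | succ k ih =>
    have := ih (x + 1)
    simp only [block, List.cons_append, List.cons.injEq, true_and] at this ⊢
    rw [this]
    push_cast
    rw [add_assoc x 1 (k : ℤ), add_comm 1 (k : ℤ)]

theorem block_sorted (x : ℤ) (k : ℕ) (p : ℤ → Bool) :
    (block x k p).Pairwise (fun a b => a.val < b.val) := by
  induction k generalizing x with
  | zero => simp [block]
  | succ k ih =>
    simp only [block, List.pairwise_cons]
    refine ⟨fun l hl => ?_, ih _⟩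
    have := (mem_block.1 hl).1
    change x < l.val
    omega

/-- The initial `x` of the second block commutes with the letters from `x + 2` on, which exposes a
braid at the front. -/
theorem wordEqv_blocks_head (x : ℤ) (k : ℕ) (p q : ℤ → Bool) :
    WordEqv (block x (k + 2) p ++ block x (k + 1) q)
      ([⟨x, p x⟩, ⟨x + 1, p (x + 1)⟩, ⟨x, q x⟩] ++
        (block (x + 1 + 1) k p ++ block (x + 1) k q)) := by
  have h : WordEqv (block (x + 1 + 1) k p ++ [⟨x, q x⟩]) (⟨x, q x⟩ :: block (x + 1 + 1) k p) := by
    refine (wordEqv_cons_append fun b hb => ?_).symm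
    have := (mem_block.1 hb).1
    simp only
    omega
  have h2 := (h.append_right (block (x + 1) k q)).append_left [⟨x, p x⟩, ⟨x + 1, p (x + 1)⟩]
  simpa [block] using h2

/-- After the braid move its last letter `x + 1`, with the mark `p x`, is the head of a block
starting at `x + 1`. The update of `p` records this, so that the same configuration reappears with
`k` lowered by one. -/
theorem wordEqv_blocks_braid (x : ℤ) (k : ℕ) (p q : ℤ → Bool) :
    WordEqv (block x (k + 2) p ++ block x (k + 1) q)
      ([⟨x + 1, q x⟩, ⟨x, p (x + 1)⟩] ++
        (block (x + 1) (k + 1) (Function.update p (x + 1) (p x)) ++ block (x + 1) k q)) := by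
  refine (wordEqv_blocks_head x k p q).trans ?_
  have h := (wordEqv_braid x (p x) (p (x + 1)) (q x)).append_right
    (block (x + 1 + 1) k p ++ block (x + 1) k q)
  have e : block (x + 1 + 1) k (Function.update p (x + 1) (p x)) = block (x + 1 + 1) k p :=
    block_congr fun m h1 _ => Function.update_of_ne (by omega) _ _
  simpa [block, e] using h

/-- Repeated braid moves carry the first letter with its mark through both blocks and out at the end
as `x + k`. Each braid sends the mark of `m` in the second block to `m + 1` in the first, and the
mark of `m + 1` in the first block to `m` in the second. This is the word identity behind `e_i` and
`f_i`. -/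
theorem wordEqv_blocks (x : ℤ) (k : ℕ) (p q : ℤ → Bool) :
    WordEqv (block x (k + 1) p ++ block x k q)
      (block (x + 1) k (fun m => q (m - 1)) ++
        (block x k (fun m => p (m + 1)) ++ [⟨x + k, p x⟩])) := by
  induction k generalizing x p with
  | zero => simpa [block] using WordEqv.refl _
  | succ k ih =>
    refine (wordEqv_blocks_braid x k p q).trans ?_
    have h1 := (ih (x + 1) (Function.update p (x + 1) (p x))).append_left
      [⟨x + 1, q x⟩, ⟨x, p (x + 1)⟩]
    refine h1.trans ?_
    have e : block (x + 1) k (fun m => Function.update p (x + 1) (p x) (m + 1)) =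
        block (x + 1) k (fun m => p (m + 1)) :=
      block_congr fun m h1 _ => Function.update_of_ne (by omega) _ _
    have h2 : WordEqv (⟨x, p (x + 1)⟩ :: block (x + 1 + 1) k (fun m => q (m - 1)))
        (block (x + 1 + 1) k (fun m => q (m - 1)) ++ [⟨x, p (x + 1)⟩]) := by
      refine wordEqv_cons_append fun b hb => ?_
      have := (mem_block.1 hb).1
      simp only
      omega
    have h3 := (h2.append_right (block (x + 1) k (fun m => p (m + 1)) ++
      [⟨x + 1 + k, p x⟩])).cons ⟨x + 1, q x⟩
    rw [e]
    have e2 : x + 1 + (k : ℤ) = x + ((k + 1 : ℕ) : ℤ) := by push_cast; ring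
    rw [e2] at h3 ⊢
    simpa [block] using h3

/-- Each `x + j` with `0 < j` is the middle letter of one of the successive braids, hence unprimed.
The mark of `x` is an outer mark of every one of these braids, so it excludes all marks of the
second block. -/
theorem leads_blocks_primes {u z : Perm ℤ} (hu : Function.Involutive u) {x : ℤ} {k : ℕ}
    {p q : ℤ → Bool} (h : Leads u (block x (k + 1) p ++ block x k q) z) :
    (∀ m, x < m → m ≤ x + k → p m = false) ∧
      (p x = true → ∀ m, x ≤ m → m < x + k → q m = false) := by
  induction k generalizing x p u with
  | zero => exact ⟨fun m h1 h2 => by simp at h2; omega, fun _ m h1 h2 => by simp at h2; omega⟩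
  | succ k ih =>
    have h1 := leads_braid_primes hu ((wordEqv_blocks_head x k p q u z hu).1 h)
    obtain ⟨t, h2, h3⟩ := leads_append.1 ((wordEqv_blocks_braid x k p q u z hu).1 h)
    obtain ⟨h4, h5⟩ := ih (h2.involutive hu) h3
    simp only [Function.update_self] at h5
    push_cast
    constructor
    · intro m m1 m2
      by_cases hm : m = x + 1
      · rw [hm]; exact h1.1
      · have := h4 m (by omega) (by omega)
        rwa [Function.update_of_ne hm] at this
    · intro hp m m1 m2
      by_cases hm : m = x
      · rw [hm]; exact h1.2 hp
      · exact h5 hp m (by omega) (by omega)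

/-- Carrying the first `x` through as in `wordEqv_blocks` puts it directly before the final `x + k`,
and a repeated letter meets a descent. -/
theorem not_leads_blocks {u z : Perm ℤ} (hu : Function.Involutive u) {x : ℤ} {k : ℕ}
    {p q : ℤ → Bool} : ¬ Leads u (block x (k + 1) p ++ block x (k + 1) q) z := by
  intro h
  rw [block_succ_last x k q] at h
  have e := (wordEqv_blocks x k p q).append_right [⟨x + k, q (x + k)⟩]
  have h2 := (e u z hu).1 (by simpa using h)
  rw [← List.append_assoc, List.append_assoc, leads_append] at h2
  obtain ⟨t, h3, h4⟩ := h2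
  exact not_leads_repeat (h3.involutive hu) h4

/-- Letters whose simple transpositions commute and are distinct. -/
def Far (a b : PLetter) : Prop := a.val + 2 ≤ b.val ∨ b.val + 2 ≤ a.val

/-- Brings the central parts of two adjacent rows together: `U` is the upper end of the first row,
`L` the lower end of the second. -/
theorem wordEqv_gather {A B U L : List PLetter} (hUL : ∀ a ∈ U, ∀ b ∈ L, Far a b)
    (hAL : ∀ a ∈ A, ∀ b ∈ L, Far a b) (hUB : ∀ a ∈ U, ∀ b ∈ B, Far a b) :
    WordEqv (A ++ U ++ (L ++ B)) (L ++ (A ++ B) ++ U) := by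
  have h1 := ((wordEqv_append_comm hUL).append_left A).append_right B
  have h2 := (wordEqv_append_comm hAL).append_right (U ++ B)
  have h3 := (wordEqv_append_comm hUB).append_left (L ++ A)
  have h := (WordEqv.trans (by simpa using h1) (by simpa using h2) :
    WordEqv (A ++ U ++ (L ++ B)) (L ++ (A ++ (U ++ B))))
  exact h.trans (by simpa using h3)

theorem wordEqv_rows {A B A' B' U L : List PLetter} (M N : List PLetter)
    (h : WordEqv (A ++ B) (A' ++ B')) (hUL : ∀ a ∈ U, ∀ b ∈ L, Far a b)
    (hAL : ∀ a ∈ A, ∀ b ∈ L, Far a b) (hUB : ∀ a ∈ U, ∀ b ∈ B, Far a b)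
    (hAL' : ∀ a ∈ A', ∀ b ∈ L, Far a b) (hUB' : ∀ a ∈ U, ∀ b ∈ B', Far a b) :
    WordEqv (M ++ A ++ U ++ (L ++ B ++ N)) (M ++ A' ++ U ++ (L ++ B' ++ N)) := by
  have h1 := ((wordEqv_gather hUL hAL hUB).trans (((h.append_left L).append_right U).trans
    (wordEqv_gather hUL hAL' hUB').symm))
  simpa using (h1.append_left M).append_right N

end QPlus

/-! ### Rows as sets of integers, and the pairing -/

namespace QPlus

/-- The underlying integers of the word increase strictly. -/
def ValSorted (v : List PLetter) : Prop := v.Pairwise (fun a b => a.val < b.val)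

/-- The set of integers underlying a word. -/
def vals (v : List PLetter) : Finset ℤ := (unprime v).toFinset

theorem mem_vals {v : List PLetter} {m : ℤ} : m ∈ vals v ↔ ∃ a ∈ v, a.val = m := by
  simp [vals, unprime]

theorem val_mem_vals {v : List PLetter} {a : PLetter} (h : a ∈ v) : a.val ∈ vals v :=
  mem_vals.2 ⟨a, h, rfl⟩

theorem ValSorted.eq_of_val_eq {v : List PLetter} (hv : ValSorted v) {a b : PLetter} (ha : a ∈ v)
    (hb : b ∈ v) (h : a.val = b.val) : a = b := by
  induction v with
  | nil => simp at ha
  | cons c v ih =>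
    obtain ⟨h1, h2⟩ := List.pairwise_cons.1 hv
    rcases List.mem_cons.1 ha with rfl | ha' <;> rcases List.mem_cons.1 hb with rfl | hb'
    · rfl
    · have := h1 b hb'; omega
    · have := h1 a ha'; omega
    · exact ih h2 ha' hb'

/-! ### The pairing -/

theorem pairing_mem {v w : List PLetter} {p : PLetter × PLetter} (h : p ∈ pairing v w) :
    p.1 ∈ v ∧ p.2 ∈ w ∧ p.2.val < p.1.val := by
  induction w with
  | nil => simp [pairing] at h
  | cons y w ih =>
    rw [pairing] at h
    split at h
    · obtain ⟨h1, h2, h3⟩ := ih h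
      exact ⟨h1, by simp [h2], h3⟩
    · rename_i x hx
      rcases List.mem_cons.1 h with rfl | h
      · have h1 := List.find?_some hx
        have h2 := List.mem_of_find?_eq_some hx
        simp only [decide_eq_true_eq] at h1
        exact ⟨h2, by simp, h1.1⟩
      · obtain ⟨h1, h2, h3⟩ := ih h
        exact ⟨h1, by simp [h2], h3⟩

/-- A letter of `v` is only chosen while it is still free, and each letter of `w` is processed once
because `w` has no repetitions. -/
theorem pairing_injective {v w : List PLetter} (hw : ValSorted w) {p q : PLetter × PLetter}
    (hp : p ∈ pairing v w) (hq : q ∈ pairing v w) (h : p.1 = q.1 ∨ p.2 = q.2) : p = q := by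
  induction w with
  | nil => simp [pairing] at hp
  | cons y w ih =>
    have hw' := List.pairwise_cons.1 hw
    rw [pairing] at hp hq
    split at hp
    · rename_i hx
      rw [hx] at hq
      exact ih hw'.2 hp hq
    · rename_i x hx
      rw [hx] at hq
      have h1 := List.find?_some hx
      simp only [decide_eq_true_eq] at h1
      have key : ∀ r ∈ pairing v w, r.1 ≠ x ∧ r.2 ≠ y := fun r hr =>
        ⟨h1.2 r hr, fun e => by
          have := hw'.1 r.2 (pairing_mem hr).2.1
          rw [e] at this; omega⟩
      rcases List.mem_cons.1 hp with rfl | hp <;> rcases List.mem_cons.1 hq with rfl | hq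
      · rfl
      · exact absurd h (by have := key q hq; simp only; tauto)
      · exact absurd h (by have := key p hp; simp only; tauto)
      · exact ih hw'.2 hp hq

/-- The letters of the first word that are available to `y` but not used for it are used for
larger letters of the second word. -/
theorem pairing_greedy {v w : List PLetter} (hv : ValSorted v) (hw : ValSorted w) {y c : PLetter}
    (hy : y ∈ w) (hc : c ∈ v) (hyc : y.val < c.val)
    (h : ∀ p ∈ pairing v w, p.2 = y → c.val < p.1.val) :
    ∃ b, (c, b) ∈ pairing v w ∧ y.val < b.val := by
  induction w with
  | nil => simp at hy
  | cons y0 w ih =>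
    have hw' := List.pairwise_cons.1 hw
    have hsub : ∀ p ∈ pairing v w, p ∈ pairing v (y0 :: w) := by
      intro p hp
      rw [pairing]
      split
      · exact hp
      · exact List.mem_cons_of_mem _ hp
    rcases List.mem_cons.1 hy with rfl | hy
    -- If `c` were still free when `y` is treated, the search would find `c` or a smaller letter of
    -- `v`. Hence `c` was already used by a letter treated earlier, that is, by a larger letter of
    -- the second word.
    · have key : ∃ p ∈ pairing v w, p.1 = c := by
        by_contra hno
        push Not at hno
        rw [pairing] at h
        split at h
        · rename_i hx
          rw [List.find?_eq_none] at hx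
          exact hx c hc (by simpa using ⟨hyc, fun a b hab => hno (a, b) hab⟩)
        · rename_i x hx
          have h1 := h (x, y) (by simp) rfl
          rw [List.find?_eq_some_iff_append] at hx
          obtain ⟨-, as, bs, e, hx⟩ := hx
          rw [e] at hc
          have hs : (as ++ x :: bs).Pairwise (fun a b => a.val < b.val) := e ▸ hv
          rw [List.pairwise_append] at hs
          rcases List.mem_append.1 hc with hc | hc
          · have := hx c hc
            simp only [Bool.not_eq_true', decide_eq_false_iff_not, not_and] at this
            exact this hyc hno
          · rcases List.mem_cons.1 hc with rfl | hc
            · simp only at h1; omega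
            · have := (List.pairwise_cons.1 hs.2.1).1 c hc
              simp only at h1; omega
      obtain ⟨p, hp, rfl⟩ := key
      exact ⟨p.2, hsub p hp, hw'.1 _ (pairing_mem hp).2.1⟩
    · obtain ⟨b, hb, hb'⟩ := ih hw'.2 hy fun p hp => h p (hsub p hp)
      exact ⟨b, hsub _ hb, hb'⟩

/-! ### Heights -/

/-- The number of elements of `V` that are at most `t` minus the number of elements of `W` that are
smaller than `t`. -/
def height (V W : Finset ℤ) (t : ℤ) : ℤ :=
  ((V.filter (· ≤ t)).card : ℤ) - ((W.filter (· < t)).card : ℤ)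

theorem height_sub (V W : Finset ℤ) {a b : ℤ} (h : a ≤ b) :
    height V W b - height V W a =
      ((V.filter fun m => a < m ∧ m ≤ b).card : ℤ) - ((W.filter fun m => a ≤ m ∧ m < b).card : ℤ) := by
  have h1 : V.filter (· ≤ b) = V.filter (· ≤ a) ∪ V.filter fun m => a < m ∧ m ≤ b := by
    ext m; simp only [Finset.mem_filter, Finset.mem_union]; grind
  have h2 : W.filter (· < b) = W.filter (· < a) ∪ W.filter fun m => a ≤ m ∧ m < b := by
    ext m; simp only [Finset.mem_filter, Finset.mem_union]; grind
  unfold height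
  rw [h1, h2, Finset.card_union_of_disjoint, Finset.card_union_of_disjoint]
  · push_cast; ring
  · rw [Finset.disjoint_filter]; intros; omega
  · rw [Finset.disjoint_filter]; intros; omega

theorem height_succ (V W : Finset ℤ) (t : ℤ) :
    height V W (t + 1) =
      height V W t + (if t + 1 ∈ V then 1 else 0) - (if t ∈ W then 1 else 0) := by
  have h := height_sub V W (show t ≤ t + 1 by omega)
  have h1 : (V.filter fun m => t < m ∧ m ≤ t + 1) = if t + 1 ∈ V then {t + 1} else ∅ := by
    ext m
    simp only [Finset.mem_filter]
    split_ifs with hm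
    · rw [Finset.mem_singleton]
      constructor
      · intro h; omega
      · rintro rfl; exact ⟨hm, by omega⟩
    · simp only [Finset.notMem_empty, iff_false]
      rintro ⟨h1, h2, h3⟩
      exact hm ((show m = t + 1 by omega) ▸ h1)
  have h2 : (W.filter fun m => t ≤ m ∧ m < t + 1) = if t ∈ W then {t} else ∅ := by
    ext m
    simp only [Finset.mem_filter]
    split_ifs with hm
    · rw [Finset.mem_singleton]
      constructor
      · intro h; omega
      · rintro rfl; exact ⟨hm, by omega⟩
    · simp only [Finset.notMem_empty, iff_false]
      rintro ⟨h1, h2, h3⟩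
      exact hm ((show m = t by omega) ▸ h1)
  rw [h1, h2] at h
  split_ifs at h ⊢ <;> simp at h <;> omega

/-- If `x` is free, greediness pairs every letter of `w` in `[t, x)` with a letter of `v` in `(t,
x)`. So `v` has strictly more letters in `(t, x]` than `w` has in `[t, x)`, and the height has
risen. Conversely, if `x` is paired with `q`, every letter of `v` in `(q, x]` is paired inside `[q,
x)`, so the height at `q` is at least that at `x`. -/
theorem unpaired_fst_iff {v w : List PLetter} (hv : ValSorted v) (hw : ValSorted w) {x : PLetter}
    (hx : x ∈ v) : (∀ p ∈ pairing v w, p.1 ≠ x) ↔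
      ∀ t < x.val, height (vals v) (vals w) t < height (vals v) (vals w) x.val := by
  constructor
  · intro h t ht
    have e := height_sub (vals v) (vals w) ht.le
    have hlt : ((vals w).filter fun m => t ≤ m ∧ m < x.val).card <
        ((vals v).filter fun m => t < m ∧ m ≤ x.val).card := by
      have h1 : ((vals w).filter fun m => t ≤ m ∧ m < x.val).card ≤
          ((vals v).filter fun m => t < m ∧ m < x.val).card := by
        apply Finset.card_le_card_of_forall_subsingleton
          (fun b a => ∃ p ∈ pairing v w, p.1.val = a ∧ p.2.val = b)
        · intro m hm
          simp only [Finset.mem_filter, mem_vals] at hm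
          obtain ⟨⟨y, hy, rfl⟩, hm1, hm2⟩ := hm
          have : ∃ p ∈ pairing v w, p.2 = y ∧ p.1.val ≤ x.val := by
            by_contra hno
            push Not at hno
            obtain ⟨b, hb, -⟩ := pairing_greedy hv hw hy hx hm2 hno
            exact h _ hb rfl
          obtain ⟨p, hp, rfl, hp2⟩ := this
          have hp' := pairing_mem hp
          refine ⟨p.1.val, ?_, p, hp, rfl, rfl⟩
          simp only [Finset.mem_filter]
          refine ⟨val_mem_vals hp'.1, by omega, lt_of_le_of_ne hp2 fun e => ?_⟩
          exact h p hp (hv.eq_of_val_eq hp'.1 hx e)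
        · rintro a - b1 ⟨-, p, hp, e1, e2⟩ b2 ⟨-, q, hq, e3, e4⟩
          have := pairing_injective hw hp hq
            (Or.inl (hv.eq_of_val_eq (pairing_mem hp).1 (pairing_mem hq).1 (e1.trans e3.symm)))
          rw [← e2, ← e4, this]
      refine lt_of_le_of_lt h1 (Finset.card_lt_card ⟨fun m hm => ?_, fun hsub => ?_⟩)
      · simp only [Finset.mem_filter] at hm ⊢
        exact ⟨hm.1, hm.2.1, hm.2.2.le⟩
      · have : x.val ∈ (vals v).filter fun m => t < m ∧ m < x.val := by
          apply hsub
          simp only [Finset.mem_filter]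
          exact ⟨val_mem_vals hx, ht, le_rfl⟩
        simp at this
    omega
  · rintro h ⟨a, q⟩ hp rfl
    have hp' := pairing_mem hp
    simp only at hp' h
    have h1 := h q.val hp'.2.2
    have e := height_sub (vals v) (vals w) hp'.2.2.le
    have hle : ((vals v).filter fun m => q.val < m ∧ m ≤ a.val).card ≤
        ((vals w).filter fun m => q.val ≤ m ∧ m < a.val).card := by
      apply Finset.card_le_card_of_forall_subsingleton
        (fun c b => ∃ p ∈ pairing v w, p.1.val = c ∧ p.2.val = b)
      · intro m hm
        simp only [Finset.mem_filter, mem_vals] at hm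
        obtain ⟨⟨c, hc, rfl⟩, hm1, hm2⟩ := hm
        have : ∃ b, (c, b) ∈ pairing v w ∧ q.val ≤ b.val := by
          by_cases hca : c = a
          · exact ⟨q, hca ▸ hp, le_rfl⟩
          · obtain ⟨b, hb, hb'⟩ := pairing_greedy hv hw hp'.2.1 hc hm1 fun p hp2 e2 => by
              have := pairing_injective hw hp2 hp (Or.inr e2)
              rw [this]
              exact lt_of_le_of_ne hm2 fun e => hca (hv.eq_of_val_eq hc hp'.1 e)
            exact ⟨b, hb, hb'.le⟩
        obtain ⟨b, hb, hb'⟩ := this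
        have hb2 := pairing_mem hb
        refine ⟨b.val, ?_, _, hb, rfl, rfl⟩
        simp only [Finset.mem_filter]
        exact ⟨val_mem_vals hb2.2.1, hb', lt_of_lt_of_le hb2.2.2 hm2⟩
      · rintro a - b1 ⟨-, p, hp, e1, e2⟩ b2 ⟨-, q, hq, e3, e4⟩
        have := pairing_injective hw hp hq
          (Or.inr (hw.eq_of_val_eq (pairing_mem hp).2.1 (pairing_mem hq).2.1 (e2.trans e4.symm)))
        rw [← e1, ← e3, this]
    omega

/-- If `y` is free, every larger letter of `v` up to `t` is used by a letter of `w` strictly above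
`y`, so the height has dropped at `t`. If `y` is paired with `a`, the letters of `w` in `[y, a)`
have their partners in `(y, a]`, and the height at `a` is no smaller. -/
theorem unpaired_snd_iff {v w : List PLetter} (hv : ValSorted v) (hw : ValSorted w) {y : PLetter}
    (hy : y ∈ w) : (∀ p ∈ pairing v w, p.2 ≠ y) ↔
      ∀ t, y.val < t → height (vals v) (vals w) t < height (vals v) (vals w) y.val := by
  constructor
  · intro h t ht
    have e := height_sub (vals v) (vals w) ht.le
    have hlt : ((vals v).filter fun m => y.val < m ∧ m ≤ t).card <
        ((vals w).filter fun m => y.val ≤ m ∧ m < t).card := by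
      have h1 : ((vals v).filter fun m => y.val < m ∧ m ≤ t).card ≤
          ((vals w).filter fun m => y.val < m ∧ m < t).card := by
        apply Finset.card_le_card_of_forall_subsingleton
          (fun c b => ∃ p ∈ pairing v w, p.1.val = c ∧ p.2.val = b)
        · intro m hm
          simp only [Finset.mem_filter, mem_vals] at hm
          obtain ⟨⟨c, hc, rfl⟩, hm1, hm2⟩ := hm
          obtain ⟨b, hb, hb'⟩ := pairing_greedy hv hw hy hc hm1 fun p hp e => absurd e (h p hp)
          have hb2 := pairing_mem hb
          refine ⟨b.val, ?_, _, hb, rfl, rfl⟩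
          simp only [Finset.mem_filter]
          exact ⟨val_mem_vals hb2.2.1, hb', lt_of_lt_of_le hb2.2.2 hm2⟩
        · rintro a - b1 ⟨-, p, hp, e1, e2⟩ b2 ⟨-, q, hq, e3, e4⟩
          have := pairing_injective hw hp hq
            (Or.inr (hw.eq_of_val_eq (pairing_mem hp).2.1 (pairing_mem hq).2.1 (e2.trans e4.symm)))
          rw [← e1, ← e3, this]
      refine lt_of_le_of_lt h1 (Finset.card_lt_card ⟨fun m hm => ?_, fun hsub => ?_⟩)
      · simp only [Finset.mem_filter] at hm ⊢
        exact ⟨hm.1, hm.2.1.le, hm.2.2⟩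
      · have : y.val ∈ (vals w).filter fun m => y.val < m ∧ m < t := by
          apply hsub
          simp only [Finset.mem_filter]
          exact ⟨val_mem_vals hy, le_rfl, ht⟩
        simp at this
    omega
  · rintro h ⟨a, q⟩ hp rfl
    have hp' := pairing_mem hp
    simp only at hp' h
    have h1 := h a.val hp'.2.2
    have e := height_sub (vals v) (vals w) hp'.2.2.le
    have hle : ((vals w).filter fun m => q.val ≤ m ∧ m < a.val).card ≤
        ((vals v).filter fun m => q.val < m ∧ m ≤ a.val).card := by
      apply Finset.card_le_card_of_forall_subsingleton
        (fun b c => ∃ p ∈ pairing v w, p.1.val = c ∧ p.2.val = b)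
      · intro m hm
        simp only [Finset.mem_filter, mem_vals] at hm
        obtain ⟨⟨b, hb, rfl⟩, hm1, hm2⟩ := hm
        have : ∃ c, (c, b) ∈ pairing v w ∧ c.val ≤ a.val := by
          by_contra hno
          push Not at hno
          obtain ⟨b', hb', hlt⟩ := pairing_greedy hv hw hb hp'.1 hm2 fun p hp2 e2 =>
            hno p.1 (by rw [← e2]; exact hp2)
          have := pairing_injective hw hb' hp (Or.inl rfl)
          simp only [Prod.mk.injEq, true_and] at this
          rw [this] at hlt
          omega
        obtain ⟨c, hc, hc'⟩ := this
        have hc2 := pairing_mem hc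
        refine ⟨c.val, ?_, _, hc, rfl, rfl⟩
        simp only [Finset.mem_filter]
        exact ⟨val_mem_vals hc2.1, lt_of_le_of_lt hm1 hc2.2.2, hc'⟩
      · rintro a - b1 ⟨-, p, hp, e1, e2⟩ b2 ⟨-, q, hq, e3, e4⟩
        have := pairing_injective hw hp hq
          (Or.inl (hv.eq_of_val_eq (pairing_mem hp).1 (pairing_mem hq).1 (e1.trans e3.symm)))
        rw [← e2, ← e4, this]
    omega

end QPlus

namespace QPlus

/-! ### Records of the height function -/

/-- `m` is a strict maximum of the height among the integers up to `m`. -/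
def LeftRecord (V W : Finset ℤ) (m : ℤ) : Prop := ∀ t < m, height V W t < height V W m

/-- `m` is a strict maximum of the height among the integers from `m` on. -/
def RightRecord (V W : Finset ℤ) (m : ℤ) : Prop := ∀ t, m < t → height V W t < height V W m

/-- The first place with a greater height would be a later record. It would belong to `V`, since the
height can only rise on entering an element of `V`. -/
theorem LeftRecord.height_le {V W : Finset ℤ} {x : ℤ} (hx : LeftRecord V W x)
    (hmax : ∀ m ∈ V, LeftRecord V W m → m ≤ x) (t : ℤ) : height V W t ≤ height V W x := by
  by_contra! hc
  obtain ⟨s, ⟨hs1, hs2⟩, hs⟩ := Int.exists_least_of_bdd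
    (P := fun s => x < s ∧ height V W x < height V W s) ⟨x, fun s h => h.1.le⟩
    ⟨t, by
      by_contra! h
      rcases eq_or_lt_of_le h with h' | h'
      · rw [h'] at hc; omega
      · exact absurd (hx t h') (by omega), hc⟩
  have hrec : LeftRecord V W s := by
    intro r hr
    by_cases hrx : r ≤ x
    · rcases eq_or_lt_of_le hrx with rfl | h
      · exact hs2
      · exact (hx r h).trans hs2
    · by_contra! h
      have := hs r ⟨by omega, by omega⟩
      omega
  have h1 := height_succ V W (s - 1)
  have h2 := hrec (s - 1) (by omega)
  rw [sub_add_cancel] at h1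
  have hsV : s ∈ V := by
    by_contra h
    rw [if_neg h] at h1
    split_ifs at h1 <;> omega
  have := hmax s hsV hrec
  omega

/-- The last place with a greater height would be an earlier right record, and it would belong to
`W` because the height drops immediately after it. -/
theorem RightRecord.height_le {V W : Finset ℤ} {y : ℤ} (hy : RightRecord V W y)
    (hmin : ∀ m ∈ W, RightRecord V W m → y ≤ m) (t : ℤ) : height V W t ≤ height V W y := by
  by_contra! hc
  obtain ⟨s, ⟨hs1, hs2⟩, hs⟩ := Int.exists_greatest_of_bdd
    (P := fun s => s < y ∧ height V W y < height V W s) ⟨y, fun s h => h.1.le⟩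
    ⟨t, by
      by_contra! h
      rcases eq_or_lt_of_le h with h' | h'
      · rw [h'] at hc; omega
      · exact absurd (hy t h') (by omega), hc⟩
  have hrec : RightRecord V W s := by
    intro r hr
    by_cases hrx : y ≤ r
    · rcases eq_or_lt_of_le hrx with rfl | h
      · exact hs2
      · exact (hy r h).trans hs2
    · by_contra! h
      have := hs r ⟨by omega, by omega⟩
      omega
  have h1 := height_succ V W s
  have h2 := hrec (s + 1) (by omega)
  have hsW : s ∈ W := by
    by_contra h
    rw [if_neg h] at h1
    split_ifs at h1 <;> omega
  have := hmin s hsW hrec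
  omega

/-- No interval of integers is contained in both sets, bounded by a gap of `W` on the left and by a
gap of `V` on the right. -/
def Unrepeated (V W : Finset ℤ) : Prop :=
  ∀ (a : ℤ) (k : ℕ), (∀ m, a ≤ m → m ≤ a + k → m ∈ V ∧ m ∈ W) → a - 1 ∈ W ∨ a + k + 1 ∈ V

/-- The configuration of the two rows near a letter `x` that is moved to `x + k`. -/
structure Run (V W : Finset ℤ) (x : ℤ) (k : ℕ) : Prop where
  left : ∀ m, x ≤ m → m ≤ x + k → m ∈ V
  right : ∀ m, x ≤ m → m < x + k → m ∈ W
  gap : x + k ∉ W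
  gap_left : x - 1 ∉ W
  gap_right : x + k + 1 ∉ V

/-- A record needs a strict rise into `x`, so `x - 1 ∉ W`. The height is constant along the block,
so `x + k + 1 ∈ V` would lift it above its maximum, as `x + k ∉ W`. -/
theorem run_of_leftRecord {V W : Finset ℤ} {x : ℤ} {k : ℕ} (hR : Unrepeated V W) (hxV : x ∈ V)
    (hx : LeftRecord V W x) (hmax : ∀ m ∈ V, LeftRecord V W m → m ≤ x)
    (hW : ∀ m, x ≤ m → m < x + k → m ∈ W) (hk : x + k ∉ W) : Run V W x k := by
  have hle := hx.height_le hmax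
  have h0 : x - 1 ∉ W := by
    intro h
    have h1 := height_succ V W (x - 1)
    have h2 := hx (x - 1) (by omega)
    rw [sub_add_cancel, if_pos hxV, if_pos h] at h1
    omega
  -- While `x, …, x + j` lie in both sets, `x - 1 ∉ W` leaves only the alternative `x + j + 1 ∈ V`
  -- in `Unrepeated`.
  have hV : ∀ j : ℕ, j ≤ k → ∀ m, x ≤ m → m ≤ x + j → m ∈ V := by
    intro j
    induction j with
    | zero => intro _ m h1 h2; rw [show m = x by simp at h2; omega]; exact hxV
    | succ j ih =>
      intro hj m h1 h2
      have ih' := ih (by omega)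
      by_cases hm : m ≤ x + j
      · exact ih' m h1 hm
      · have := hR x j fun m h1 h2 => ⟨ih' m h1 h2, hW m h1 (by omega)⟩
        rw [show m = x + j + 1 by push_cast at h2; omega]
        exact this.resolve_left h0
  have hconst : ∀ j : ℕ, j ≤ k → height V W (x + j) = height V W x := by
    intro j
    induction j with
    | zero => simp
    | succ j ih =>
      intro hj
      have h1 := height_succ V W (x + j)
      rw [if_pos (hV (j + 1) hj _ (by omega) (by push_cast; omega)),
        if_pos (hW _ (by omega) (by omega)), ih (by omega)] at h1
      push_cast
      rw [← add_assoc, h1]; ring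
  refine ⟨hV k le_rfl, hW, hk, h0, fun h => ?_⟩
  have h1 := height_succ V W (x + k)
  rw [if_pos h, if_neg hk, hconst k le_rfl] at h1
  have := hle (x + k + 1)
  omega

/-- Here `Unrepeated` is used towards the left: since `x + k + 1 ∉ V`, each common interval ending
at `x + k` extends by one element of `W` on its left. -/
theorem unrepeated_run_right {V W : Finset ℤ} {x : ℤ} {k : ℕ} (hR : Unrepeated V W)
    (hy : x + k ∈ W) (hgap : x + k + 1 ∉ V) (hV : ∀ m, x < m → m ≤ x + k → m ∈ V) :
    ∀ m, x ≤ m → m ≤ x + k → m ∈ W := by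
  have : ∀ j : ℕ, j ≤ k → ∀ m, x + k - j ≤ m → m ≤ x + k → m ∈ W := by
    intro j
    induction j with
    | zero => intro _ m h1 h2; rw [show m = x + k by simp at h1; omega]; exact hy
    | succ j ih =>
      intro hj m h1 h2
      have ih' := ih (by omega)
      by_cases hm : x + k - j ≤ m
      · exact ih' m hm h2
      · have := hR (x + k - j) j fun m h1 h2 => ⟨hV m (by omega) (by omega), ih' m h1 (by omega)⟩
        rw [show x + k - j + j + 1 = x + (k : ℤ) + 1 by ring] at this
        rw [show m = x + k - j - 1 by push_cast at h1; omega]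
        exact this.resolve_right hgap
  intro m h1 h2
  exact this k le_rfl m (by omega) h2

theorem run_of_rightRecord {V W : Finset ℤ} {x : ℤ} {k : ℕ} (hR : Unrepeated V W)
    (hyW : x + k ∈ W) (hy : RightRecord V W (x + k))
    (hmin : ∀ m ∈ W, RightRecord V W m → x + k ≤ m)
    (hV : ∀ m, x < m → m ≤ x + k → m ∈ V) (hk : x ∉ V) :
    (∀ m, x ≤ m → m ≤ x + k → m ∈ W) ∧ x - 1 ∉ W ∧ x + k + 1 ∉ V := by
  have hle := hy.height_le hmin
  have h0 : x + k + 1 ∉ V := by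
    intro h
    have h1 := height_succ V W (x + k)
    have h2 := hy (x + k + 1) (by omega)
    rw [if_pos hyW, if_pos h] at h1
    omega
  have hW := unrepeated_run_right hR hyW h0 hV
  have hconst : ∀ j : ℕ, j ≤ k → height V W (x + j) = height V W x := by
    intro j
    induction j with
    | zero => simp
    | succ j ih =>
      intro hj
      have h1 := height_succ V W (x + j)
      rw [if_pos (hV _ (by omega) (by omega)),
        if_pos (hW _ (by omega) (by omega)), ih (by omega)] at h1
      push_cast
      rw [← add_assoc, h1]; ring
  refine ⟨hW, fun h => ?_, h0⟩
  have h1 := height_succ V W (x - 1)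
  rw [sub_add_cancel, if_pos h, if_neg hk] at h1
  have h2 := hle (x - 1)
  have h3 := hconst k le_rfl
  omega

theorem height_erase_insert {V W : Finset ℤ} {x y : ℤ} (hx : x ∈ V) (hy : y ∉ W) (t : ℤ) :
    height (V.erase x) (insert y W) t =
      height V W t - (if x ≤ t then 1 else 0) - (if y < t then 1 else 0) := by
  unfold height
  have h1 : (((V.erase x).filter (· ≤ t)).card : ℤ) =
      ((V.filter (· ≤ t)).card : ℤ) - (if x ≤ t then 1 else 0) := by
    rw [Finset.filter_erase]
    split_ifs with h
    · have : x ∈ V.filter (· ≤ t) := by simp [hx, h]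
      rw [Finset.card_erase_of_mem this, Nat.cast_sub (Finset.card_pos.2 ⟨x, this⟩)]
      simp
    · rw [Finset.erase_eq_of_notMem (by simp [h])]; simp
  have h2 : (((insert y W).filter (· < t)).card : ℤ) =
      ((W.filter (· < t)).card : ℤ) + (if y < t then 1 else 0) := by
    rw [Finset.filter_insert]
    split_ifs with h
    · rw [Finset.card_insert_of_notMem (by simp [hy])]; simp
    · simp
  rw [h1, h2]; ring

/-- `x` is the first place where the height is maximal. -/
def FirstTop (V W : Finset ℤ) (x : ℤ) : Prop :=
  LeftRecord V W x ∧ ∀ t, height V W t ≤ height V W x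

/-- `y` is the last place where the height is maximal. -/
def LastTop (V W : Finset ℤ) (y : ℤ) : Prop :=
  RightRecord V W y ∧ ∀ t, height V W t ≤ height V W y

namespace Run

variable {V W : Finset ℤ} {x : ℤ} {k : ℕ}

theorem height_eq (h : Run V W x k) {t : ℤ} (h1 : x ≤ t) (h2 : t ≤ x + k) :
    height V W t = height V W x := by
  have : ∀ j : ℕ, j ≤ k → height V W (x + j) = height V W x := by
    intro j
    induction j with
    | zero => simp
    | succ j ih =>
      intro hj
      have h1 := height_succ V W (x + j)
      rw [if_pos (h.left _ (by omega) (by omega)),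
        if_pos (h.right _ (by omega) (by omega)), ih (by omega)] at h1
      push_cast
      rw [← add_assoc, h1]; ring
  have := this (t - x).toNat (by omega)
  rwa [show x + ((t - x).toNat : ℤ) = t by omega] at this

theorem height_pred (h : Run V W x k) : height V W (x - 1) = height V W x - 1 := by
  have h1 := height_succ V W (x - 1)
  rw [sub_add_cancel, if_pos (h.left x le_rfl (by omega)), if_neg h.gap_left] at h1
  omega

theorem height_slide (h : Run V W x k) (t : ℤ) :
    height (V.erase x) (insert (x + k) W) t =
      height V W t - (if x ≤ t then 1 else 0) - (if x + k < t then 1 else 0) :=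
  height_erase_insert (h.left x le_rfl (by omega)) h.gap t

/-- The move lowers the height by 0 before `x`, by 1 on `[x, x + k]` and by 2 after `x + k`. The
maximum therefore drops by one. If its first place was `x`, its last place is now `x + k`, and
conversely. -/
theorem firstTop_iff (h : Run V W x k) :
    FirstTop V W x ↔ LastTop (V.erase x) (insert (x + k) W) (x + k) := by
  have hs := h.height_slide
  have hc := h.height_eq (t := x + k) (by omega) le_rfl
  have hy := hs (x + k)
  rw [if_pos (by omega), if_neg (by omega)] at hy
  constructor
  · rintro ⟨h1, h2⟩
    refine ⟨fun t ht => ?_, fun t => ?_⟩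
    · have := h2 t
      have e := hs t
      rw [if_pos (by omega), if_pos ht] at e
      omega
    · have := h2 t
      have e := hs t
      by_cases ht : x ≤ t
      · rw [if_pos ht] at e
        split_ifs at e <;> omega
      · have := h1 t (by omega)
        rw [if_neg ht, if_neg (by omega)] at e
        omega
  · rintro ⟨h1, h2⟩
    refine ⟨fun t ht => ?_, fun t => ?_⟩
    · have := h2 t
      have e := hs t
      rw [if_neg (by omega), if_neg (by omega)] at e
      omega
    · have e := hs t
      by_cases ht : x + k < t
      · have := h1 t ht
        rw [if_pos (by omega), if_pos ht] at e
        omega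
      · have := h2 t
        rw [if_neg ht] at e
        split_ifs at e <;> omega

/-- Before `x` nothing changes. After `x` there are no left records at all: not before the move,
since the maximum is attained at `x`, and not after it, since the height at `x - 1` already equals
the new maximum. -/
theorem leftRecord_slide (h : Run V W x k) (ht : FirstTop V W x) {m : ℤ} (hmx : m ≠ x) :
    LeftRecord (V.erase x) (insert (x + k) W) m ↔ LeftRecord V W m := by
  have hs := h.height_slide
  by_cases hm : m < x
  · refine forall_congr' fun t => imp_congr_right fun htm => ?_
    rw [hs, hs, if_neg (by omega), if_neg (by omega), if_neg (by omega), if_neg (by omega)]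
    omega
  · constructor
    · intro h1
      exfalso
      have h2 := h1 (x - 1) (by omega)
      have h3 := h.height_pred
      rw [hs, hs, if_neg (by omega), if_neg (by omega), if_pos (by omega)] at h2
      have := ht.2 m
      split_ifs at h2 <;> omega
    · intro h1
      have := h1 x (by omega)
      have := ht.2 m
      omega

/-- After `x + k` the height changes by a constant. Before it there is no right record on either
side, because the maximum is attained at `x + k` both before and after the move. -/
theorem rightRecord_slide (h : Run V W x k) (ht : FirstTop V W x) {m : ℤ} (hmx : m ≠ x + k) :
    RightRecord (V.erase x) (insert (x + k) W) m ↔ RightRecord V W m := by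
  have hs := h.height_slide
  by_cases hm : x + k < m
  · refine forall_congr' fun t => imp_congr_right fun htm => ?_
    rw [hs, hs, if_pos (by omega), if_pos (by omega), if_pos (by omega), if_pos (by omega)]
    omega
  · have hl := (h.firstTop_iff.1 ht).2 m
    have hc := h.height_eq (t := x + k) (by omega) le_rfl
    constructor
    · intro h1
      have := h1 (x + k) (by omega)
      omega
    · intro h1
      have := h1 (x + k) (by omega)
      have := ht.2 m
      omega

end Run

end QPlus

namespace QPlus

open Equiv

/-! ### Sorted words -/

theorem ValSorted.nodup {v : List PLetter} (hv : ValSorted v) : v.Nodup :=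
  hv.imp fun {a b} h e => by rw [e] at h; exact lt_irrefl _ h

theorem ValSorted.ext {v w : List PLetter} (hv : ValSorted v) (hw : ValSorted w)
    (h : ∀ l, l ∈ v ↔ l ∈ w) : v = w :=
  List.Perm.eq_of_pairwise (le := fun a b : PLetter => a.val < b.val)
    (fun _ _ _ _ h1 h2 => absurd (h1.trans h2) (lt_irrefl _)) hv hw
    ((List.perm_ext_iff_of_nodup hv.nodup hw.nodup).2 h)

theorem valSorted_append {v w : List PLetter} (hv : ValSorted v) (hw : ValSorted w)
    (h : ∀ a ∈ v, ∀ b ∈ w, a.val < b.val) : ValSorted (v ++ w) :=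
  List.pairwise_append.2 ⟨hv, hw, h⟩

theorem ValSorted.filter {v : List PLetter} (hv : ValSorted v) (P : PLetter → Bool) :
    ValSorted (v.filter P) := List.Pairwise.filter P hv

theorem PLetter.lt_iff_twice {a b : PLetter} : a < b ↔ a.twice < b.twice := Iff.rfl

theorem PLetter.lt_of_val_lt {a b : PLetter} (h : a.val < b.val) : a < b := by
  rw [PLetter.lt_iff_twice]
  unfold PLetter.twice
  split_ifs <;> omega

theorem PLetter.val_le_of_lt {a b : PLetter} (h : a < b) : a.val ≤ b.val := by
  rw [PLetter.lt_iff_twice] at h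
  unfold PLetter.twice at h
  split_ifs at h <;> omega

theorem ValSorted.sorted {v : List PLetter} (hv : ValSorted v) : v.Pairwise (· < ·) :=
  hv.imp PLetter.lt_of_val_lt

/-- A strictly increasing word might contain `x'` directly followed by `x`, but in an ascending word
no integer is immediately repeated. -/
theorem valSorted_of_leads {u z : Perm ℤ} (hu : Function.Involutive u) {v : List PLetter}
    (hv : v.Pairwise (· < ·)) (h : Leads u v z) : ValSorted v := by
  induction v generalizing u with
  | nil => exact List.Pairwise.nil
  | cons a v ih =>
    obtain ⟨h1, h2⟩ := List.pairwise_cons.1 hv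
    have hs := ih (invStep_involutive hu _) h2 h.2.2
    refine List.pairwise_cons.2 ⟨?_, hs⟩
    cases v with
    | nil => simp
    | cons c v =>
      have hac : a.val < c.val := by
        refine lt_of_le_of_ne (PLetter.val_le_of_lt (h1 c (by simp))) fun e => ?_
        obtain ⟨x, p⟩ := a
        obtain ⟨y, q⟩ := c
        simp only at e
        subst e
        exact not_leads_repeat hu h
      intro b hb
      rcases List.mem_cons.1 hb with rfl | hb
      · exact hac
      · exact hac.trans ((List.pairwise_cons.1 hs).1 b hb)

theorem vals_append (v w : List PLetter) : vals (v ++ w) = vals v ∪ vals w := by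
  ext m; simp [vals, unprime]

theorem mem_vals_block {x : ℤ} {k : ℕ} {p : ℤ → Bool} {m : ℤ} :
    m ∈ vals (block x k p) ↔ x ≤ m ∧ m < x + k := by
  simp only [mem_vals, mem_block]
  constructor
  · rintro ⟨a, ⟨h1, h2, -⟩, rfl⟩; exact ⟨h1, h2⟩
  · rintro ⟨h1, h2⟩; exact ⟨⟨m, p m⟩, ⟨h1, h2, rfl⟩, rfl⟩

/-- The prime marks of a word, as a function. -/
def marks (v : List PLetter) (m : ℤ) : Bool := decide ((⟨m, true⟩ : PLetter) ∈ v)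

theorem ValSorted.primed_eq_marks {v : List PLetter} (hv : ValSorted v) {a : PLetter}
    (ha : a ∈ v) : a.primed = marks v a.val := by
  unfold marks
  rcases h : a.primed with _ | _
  · symm
    rw [decide_eq_false_iff_not]
    intro hc
    have := hv.eq_of_val_eq ha hc rfl
    rw [this] at h
    simp at h
  · symm
    rw [decide_eq_true_iff]
    have : a = ⟨a.val, true⟩ := by ext <;> simp [h]
    rwa [← this]

theorem ValSorted.decompose {v : List PLetter} (hv : ValSorted v) {a : ℤ} {k : ℕ}
    (h : ∀ m, a ≤ m → m < a + k → m ∈ vals v) :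
    v = v.filter (fun l => decide (l.val < a)) ++ block a k (marks v) ++
      v.filter (fun l => decide (a + k ≤ l.val)) := by
  apply hv.ext
  · refine valSorted_append (valSorted_append (hv.filter _) (block_sorted _ _ _) ?_) (hv.filter _) ?_
    · intro l hl l' hl'
      simp only [List.mem_filter, decide_eq_true_eq] at hl
      have := (mem_block.1 hl').1
      omega
    · intro l hl l' hl'
      simp only [List.mem_append, List.mem_filter, decide_eq_true_eq, mem_block] at hl hl'
      omega
  · intro l
    simp only [List.mem_append, List.mem_filter, decide_eq_true_eq, mem_block]
    constructor
    · intro hl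
      have := hv.primed_eq_marks hl
      by_cases h1 : l.val < a
      · exact Or.inl (Or.inl ⟨hl, h1⟩)
      · by_cases h2 : a + k ≤ l.val
        · exact Or.inr ⟨hl, h2⟩
        · exact Or.inl (Or.inr ⟨by omega, by omega, this⟩)
    · rintro ((⟨h1, -⟩ | ⟨h1, h2, h3⟩) | ⟨h1, -⟩)
      · exact h1
      · obtain ⟨b, hb, hb'⟩ := mem_vals.1 (h l.val h1 h2)
        have : l = b := by
          apply PLetter.ext hb'.symm
          rw [h3, hv.primed_eq_marks hb, hb']
        rwa [this]
      · exact h1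

/-- The gap of `V` on the right and the gap of `W` on the left make all other letters between the
two copies of the interval commute away, leaving two equal adjacent blocks, which is impossible. -/
theorem unrepeated_of_leads {u z : Perm ℤ} (hu : Function.Involutive u) {v w : List PLetter}
    (hv : ValSorted v) (hw : ValSorted w) (h : Leads u (v ++ w) z) :
    Unrepeated (vals v) (vals w) := by
  intro a k hk
  by_contra! hc
  have e1 := hv.decompose (a := a) (k := k + 1)
    fun m h1 h2 => (hk m h1 (by push_cast at h2; omega)).1
  have e2 := hw.decompose (a := a) (k := k + 1)
    fun m h1 h2 => (hk m h1 (by push_cast at h2; omega)).2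
  have hU : ∀ b ∈ v.filter (fun l => decide (a + (k + 1 : ℕ) ≤ l.val)), a + k + 2 ≤ b.val := by
    intro b hb
    simp only [List.mem_filter, decide_eq_true_eq] at hb
    have : b.val ≠ a + k + 1 := fun e => hc.2 (e ▸ val_mem_vals hb.1)
    push_cast at hb
    omega
  have hM : ∀ b ∈ w.filter (fun l => decide (l.val < a)), b.val + 2 ≤ a := by
    intro b hb
    simp only [List.mem_filter, decide_eq_true_eq] at hb
    have : b.val ≠ a - 1 := fun e => hc.1 (e ▸ val_mem_vals hb.1)
    omega
  rw [e1, e2] at h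
  generalize v.filter (fun l => decide (a + (k + 1 : ℕ) ≤ l.val)) = U at h hU
  generalize w.filter (fun l => decide (l.val < a)) = M at h hM
  generalize v.filter (fun l => decide (l.val < a)) = L at h
  generalize w.filter (fun l => decide (a + (k + 1 : ℕ) ≤ l.val)) = N at h
  have hg := wordEqv_gather (A := block a (k + 1) (marks v)) (B := block a (k + 1) (marks w))
    (U := U) (L := M)
    (fun b hb c hc => Or.inr (by have := hU b hb; have := hM c hc; omega))
    (fun b hb c hc => Or.inr (by have := (mem_block.1 hb).1; have := hM c hc; omega))
    (fun b hb c hc => Or.inr (by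
      have := hU b hb; have := (mem_block.1 hc).2.1; push_cast at this; omega))
  have hg' := (hg.append_left L).append_right N
  have h' := (hg' u z hu).1 (by simpa using h)
  rw [show L ++ (M ++ (block a (k + 1) (marks v) ++ block a (k + 1) (marks w)) ++ U) ++ N =
    (L ++ M) ++ ((block a (k + 1) (marks v) ++ block a (k + 1) (marks w)) ++ (U ++ N)) by simp,
    leads_append] at h'
  obtain ⟨t, h1, h2⟩ := h'
  obtain ⟨s, h3, -⟩ := leads_append.1 h2
  exact not_leads_blocks (h1.involutive hu) h3

/-! ### Slides -/

/-- The data of two rows `v`, `w` that contain `x, …, x + k` and `x, …, x + k - 1`, respectively, so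
that the letter `x` of the first row may be moved to the letter `x + k` of the second. -/
structure Slide where
  x : ℤ
  k : ℕ
  p : ℤ → Bool
  q : ℤ → Bool
  L : List PLetter
  U : List PLetter
  M : List PLetter
  N : List PLetter
  hL : ∀ l ∈ L, l.val < x
  hU : ∀ l ∈ U, x + k + 2 ≤ l.val
  hM : ∀ l ∈ M, l.val + 2 ≤ x
  hN : ∀ l ∈ N, x + k < l.val
  sL : ValSorted L
  sU : ValSorted U
  sM : ValSorted M
  sN : ValSorted N

theorem valSorted_rows {L B U : List PLetter} {a b : ℤ} (sL : ValSorted L) (sB : ValSorted B)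
    (sU : ValSorted U) (hL : ∀ l ∈ L, l.val < a) (hB : ∀ l ∈ B, a ≤ l.val ∧ l.val ≤ b)
    (hU : ∀ l ∈ U, b < l.val) (hab : a ≤ b + 1) : ValSorted (L ++ B ++ U) := by
  refine valSorted_append (valSorted_append sL sB ?_) sU ?_
  · intro l hl l' hl'
    exact (hL l hl).trans_le (hB l' hl').1
  · intro l hl l' hl'
    have := hU l' hl'
    rcases List.mem_append.1 hl with hl | hl
    · have := hL l hl; omega
    · have := (hB l hl).2; omega

namespace Slide

variable (s : Slide)

def v : List PLetter := s.L ++ block s.x (s.k + 1) s.p ++ s.U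

def w : List PLetter := s.M ++ block s.x s.k s.q ++ s.N

/-- The first row after the move. -/
def v' : List PLetter := s.L ++ block (s.x + 1) s.k (fun m => s.q (m - 1)) ++ s.U

/-- The second row after the move. -/
def w' : List PLetter := s.M ++ (block s.x s.k (fun m => s.p (m + 1)) ++ [⟨s.x + s.k, s.p s.x⟩]) ++ s.N

theorem sorted_v : ValSorted s.v := by
  rw [v]
  refine valSorted_rows (a := s.x) (b := s.x + s.k) s.sL (block_sorted _ _ _) s.sU s.hL
    (fun l hl => ?_) (fun l hl => ?_) (by omega)
  · have := mem_block.1 hl; push_cast at this; omega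
  · have := s.hU l hl; omega

theorem sorted_w : ValSorted s.w := by
  rw [w]
  refine valSorted_rows (a := s.x) (b := s.x + s.k) s.sM (block_sorted _ _ _) s.sN
    (fun l hl => ?_) (fun l hl => ?_) s.hN (by omega)
  · have := s.hM l hl; omega
  · have := mem_block.1 hl; omega

theorem sorted_v' : ValSorted s.v' := by
  rw [v']
  refine valSorted_rows (a := s.x) (b := s.x + s.k) s.sL (block_sorted _ _ _) s.sU s.hL
    (fun l hl => ?_) (fun l hl => ?_) (by omega)
  · have := mem_block.1 hl; omega
  · have := s.hU l hl; omega

theorem sorted_w' : ValSorted s.w' := by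
  rw [w']
  refine valSorted_rows (a := s.x) (b := s.x + s.k) s.sM ?_ s.sN
    (fun l hl => ?_) (fun l hl => ?_) s.hN (by omega)
  · refine valSorted_append (block_sorted _ _ _) (List.pairwise_singleton _ _) ?_
    intro l hl l' hl'
    have := mem_block.1 hl
    rw [List.mem_singleton.1 hl']
    change _ < s.x + s.k
    omega
  · have := s.hM l hl; omega
  · rcases List.mem_append.1 hl with hl | hl
    · have := mem_block.1 hl; omega
    · rw [List.mem_singleton.1 hl]
      change _ ≤ s.x + s.k ∧ s.x + s.k ≤ _
      omega

theorem leads_iff {u z : Perm ℤ} (hu : Function.Involutive u) :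
    Leads u (s.v ++ s.w) z ↔ Leads u (s.v' ++ s.w') z := by
  unfold v w v' w'
  refine wordEqv_rows s.L s.N (wordEqv_blocks s.x s.k s.p s.q) ?_ ?_ ?_ ?_ ?_ u z hu
  · intro a ha b hb
    have := s.hU a ha
    have := s.hM b hb
    exact Or.inr (by omega)
  · intro a ha b hb
    have := mem_block.1 ha
    have := s.hM b hb
    exact Or.inr (by omega)
  · intro a ha b hb
    have := s.hU a ha
    have := mem_block.1 hb
    exact Or.inr (by omega)
  · intro a ha b hb
    have := mem_block.1 ha
    have := s.hM b hb
    exact Or.inr (by omega)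
  · intro a ha b hb
    have := s.hU a ha
    refine Or.inr ?_
    rcases List.mem_append.1 hb with hb | hb
    · have := mem_block.1 hb
      omega
    · rw [List.mem_singleton.1 hb]
      change s.x + s.k + 2 ≤ _
      omega

/-- Gathering the two rows makes the blocks adjacent, so `leads_blocks_primes` applies to them. -/
theorem primes {u z : Perm ℤ} (hu : Function.Involutive u) (h : Leads u (s.v ++ s.w) z) :
    (∀ m, s.x < m → m ≤ s.x + s.k → s.p m = false) ∧
      (s.p s.x = true → ∀ m, s.x ≤ m → m < s.x + s.k → s.q m = false) := by
  unfold v w at h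
  have hg := wordEqv_gather (A := block s.x (s.k + 1) s.p) (B := block s.x s.k s.q)
    (U := s.U) (L := s.M)
    (fun b hb c hc => Or.inr (by have := s.hU b hb; have := s.hM c hc; omega))
    (fun b hb c hc => Or.inr (by have := (mem_block.1 hb).1; have := s.hM c hc; omega))
    (fun b hb c hc => Or.inr (by have := s.hU b hb; have := (mem_block.1 hc).2.1; omega))
  have hg' := (hg.append_left s.L).append_right s.N
  have h' := (hg' u z hu).1 (by simpa using h)
  rw [show s.L ++ (s.M ++ (block s.x (s.k + 1) s.p ++ block s.x s.k s.q) ++ s.U) ++ s.N =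
    (s.L ++ s.M) ++ ((block s.x (s.k + 1) s.p ++ block s.x s.k s.q) ++ (s.U ++ s.N)) by simp,
    leads_append] at h'
  obtain ⟨t, h1, h2⟩ := h'
  obtain ⟨r, h3, -⟩ := leads_append.1 h2
  exact leads_blocks_primes (h1.involutive hu) h3

theorem bounds (m : ℤ) : (m ∈ vals s.L → m < s.x) ∧ (m ∈ vals s.U → s.x + s.k + 2 ≤ m) ∧
    (m ∈ vals s.M → m + 2 ≤ s.x) ∧ (m ∈ vals s.N → s.x + s.k < m) := by
  simp only [mem_vals]
  refine ⟨?_, ?_, ?_, ?_⟩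
  · rintro ⟨a, ha, rfl⟩; exact s.hL a ha
  · rintro ⟨a, ha, rfl⟩; exact s.hU a ha
  · rintro ⟨a, ha, rfl⟩; exact s.hM a ha
  · rintro ⟨a, ha, rfl⟩; exact s.hN a ha

theorem mem_v (m : ℤ) :
    m ∈ vals s.v ↔ m ∈ vals s.L ∨ (s.x ≤ m ∧ m ≤ s.x + s.k) ∨ m ∈ vals s.U := by
  rw [v, vals_append, vals_append, Finset.mem_union, Finset.mem_union, mem_vals_block, or_assoc]
  push_cast
  rw [← add_assoc, Int.lt_add_one_iff]

theorem mem_w (m : ℤ) :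
    m ∈ vals s.w ↔ m ∈ vals s.M ∨ (s.x ≤ m ∧ m < s.x + s.k) ∨ m ∈ vals s.N := by
  rw [w, vals_append, vals_append, Finset.mem_union, Finset.mem_union, mem_vals_block, or_assoc]

theorem vals_v' : vals s.v' = (vals s.v).erase s.x := by
  ext m
  rw [Finset.mem_erase, s.mem_v, v', vals_append, vals_append, Finset.mem_union,
    Finset.mem_union, mem_vals_block]
  have := s.bounds m
  grind

theorem vals_w' : vals s.w' = insert (s.x + s.k) (vals s.w) := by
  ext m
  have h1 : m ∈ vals [(⟨s.x + s.k, s.p s.x⟩ : PLetter)] ↔ m = s.x + s.k := by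
    simp [vals, unprime]
  rw [Finset.mem_insert, s.mem_w, w', vals_append, vals_append, vals_append, Finset.mem_union,
    Finset.mem_union, Finset.mem_union, mem_vals_block, h1]
  tauto

theorem run : Run (vals s.v) (vals s.w) s.x s.k := by
  refine ⟨fun m h1 h2 => ?_, fun m h1 h2 => ?_, ?_, ?_, ?_⟩
  · rw [s.mem_v]; exact Or.inr (Or.inl ⟨h1, h2⟩)
  · rw [s.mem_w]; exact Or.inr (Or.inl ⟨h1, h2⟩)
  · rw [s.mem_w]
    have := s.bounds (s.x + s.k)
    rintro (h | h | h)
    · have := this.2.2.1 h; omega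
    · omega
    · have := this.2.2.2 h; omega
  · rw [s.mem_w]
    have := s.bounds (s.x - 1)
    rintro (h | h | h)
    · have := this.2.2.1 h; omega
    · omega
    · have := this.2.2.2 h; omega
  · rw [s.mem_v]
    have := s.bounds (s.x + s.k + 1)
    rintro (h | h | h)
    · have := this.1 h; omega
    · omega
    · have := this.2.1 h; omega

end Slide

end QPlus

namespace QPlus

open Equiv

/-! ### Unpaired letters and records -/

open Classical in
/-- The elements of `V` that are left records of the height. -/
noncomputable def leftRecords (V W : Finset ℤ) : Finset ℤ := V.filter (LeftRecord V W)

open Classical in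
/-- The elements of `W` that are right records of the height. -/
noncomputable def rightRecords (V W : Finset ℤ) : Finset ℤ := W.filter (RightRecord V W)

theorem mem_leftRecords {V W : Finset ℤ} {m : ℤ} :
    m ∈ leftRecords V W ↔ m ∈ V ∧ LeftRecord V W m := by simp [leftRecords]

theorem mem_rightRecords {V W : Finset ℤ} {m : ℤ} :
    m ∈ rightRecords V W ↔ m ∈ W ∧ RightRecord V W m := by simp [rightRecords]

theorem mem_unpairedFst {v w : List PLetter} (hv : ValSorted v) (hw : ValSorted w) {a : PLetter} :
    a ∈ unpairedFst v w ↔ a ∈ v ∧ LeftRecord (vals v) (vals w) a.val := by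
  unfold unpairedFst
  rw [List.mem_filter, decide_eq_true_iff]
  exact and_congr_right fun h => unpaired_fst_iff hv hw h

theorem mem_unpairedSnd {v w : List PLetter} (hv : ValSorted v) (hw : ValSorted w) {a : PLetter} :
    a ∈ unpairedSnd v w ↔ a ∈ w ∧ RightRecord (vals v) (vals w) a.val := by
  unfold unpairedSnd
  rw [List.mem_filter, decide_eq_true_iff]
  exact and_congr_right fun h => unpaired_snd_iff hv hw h

theorem ValSorted.length_eq_card {v : List PLetter} (hv : ValSorted v) :
    v.length = (vals v).card := by
  unfold vals
  rw [List.toFinset_card_of_nodup]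
  · simp [unprime]
  · unfold unprime
    rw [List.Nodup, List.pairwise_map]
    exact hv.imp fun h => h.ne

theorem length_unpairedFst {v w : List PLetter} (hv : ValSorted v) (hw : ValSorted w) :
    (unpairedFst v w).length = (leftRecords (vals v) (vals w)).card := by
  rw [ValSorted.length_eq_card (v := unpairedFst v w) (hv.filter _)]
  congr 1
  ext m
  rw [mem_vals, mem_leftRecords, mem_vals]
  constructor
  · rintro ⟨a, ha, rfl⟩
    obtain ⟨h1, h2⟩ := (mem_unpairedFst hv hw).1 ha
    exact ⟨⟨a, h1, rfl⟩, h2⟩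
  · rintro ⟨⟨a, h1, rfl⟩, h2⟩
    exact ⟨a, (mem_unpairedFst hv hw).2 ⟨h1, h2⟩, rfl⟩

theorem length_unpairedSnd {v w : List PLetter} (hv : ValSorted v) (hw : ValSorted w) :
    (unpairedSnd v w).length = (rightRecords (vals v) (vals w)).card := by
  rw [ValSorted.length_eq_card (v := unpairedSnd v w) (hw.filter _)]
  congr 1
  ext m
  rw [mem_vals, mem_rightRecords, mem_vals]
  constructor
  · rintro ⟨a, ha, rfl⟩
    obtain ⟨h1, h2⟩ := (mem_unpairedSnd hv hw).1 ha
    exact ⟨⟨a, h1, rfl⟩, h2⟩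
  · rintro ⟨⟨a, h1, rfl⟩, h2⟩
    exact ⟨a, (mem_unpairedSnd hv hw).2 ⟨h1, h2⟩, rfl⟩

theorem ValSorted.getLast?_eq_some_iff {v : List PLetter} (hv : ValSorted v) {a : PLetter} :
    v.getLast? = some a ↔ a ∈ v ∧ ∀ b ∈ v, b.val ≤ a.val := by
  rw [List.getLast?_eq_some_iff]
  constructor
  · rintro ⟨ys, rfl⟩
    refine ⟨by simp, fun b hb => ?_⟩
    rcases List.mem_append.1 hb with hb | hb
    · exact ((List.pairwise_append.1 hv).2.2 b hb a (by simp)).le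
    · rw [List.mem_singleton.1 hb]
  · rintro ⟨h1, h2⟩
    obtain ⟨ys, zs, rfl⟩ := List.append_of_mem h1
    refine ⟨ys, ?_⟩
    cases zs with
    | nil => rfl
    | cons b zs =>
      have h3 := h2 b (by simp)
      have h4 := (List.pairwise_cons.1 (List.pairwise_append.1 hv).2.1).1 b (by simp)
      omega

theorem ValSorted.head?_eq_some_iff {v : List PLetter} (hv : ValSorted v) {a : PLetter} :
    v.head? = some a ↔ a ∈ v ∧ ∀ b ∈ v, a.val ≤ b.val := by
  cases v with
  | nil => simp
  | cons c v =>
    have h := (List.pairwise_cons.1 hv).1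
    simp only [List.head?_cons, Option.some.injEq]
    constructor
    · rintro rfl
      refine ⟨by simp, fun b hb => ?_⟩
      rcases List.mem_cons.1 hb with rfl | hb
      · exact le_rfl
      · exact (h b hb).le
    · rintro ⟨h1, h2⟩
      rcases List.mem_cons.1 h1 with rfl | h1
      · rfl
      · have := h2 c (by simp)
        have := h a h1
        omega

/-- The largest left record in the row is the first place where the maximum is attained, by
`LeftRecord.height_le`. -/
theorem getLast?_unpairedFst {v w : List PLetter} (hv : ValSorted v) (hw : ValSorted w)
    {a : PLetter} : (unpairedFst v w).getLast? = some a ↔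
      a ∈ v ∧ FirstTop (vals v) (vals w) a.val := by
  rw [ValSorted.getLast?_eq_some_iff (v := unpairedFst v w) (hv.filter _), mem_unpairedFst hv hw,
    and_assoc]
  refine and_congr_right fun ha => and_congr_right fun hl => ?_
  constructor
  · intro h t
    refine LeftRecord.height_le hl (fun m hm hr => ?_) t
    obtain ⟨b, hb, rfl⟩ := mem_vals.1 hm
    exact h b ((mem_unpairedFst hv hw).2 ⟨hb, hr⟩)
  · intro h b hb
    by_contra! hc
    have h1 := ((mem_unpairedFst hv hw).1 hb).2 a.val hc
    have h2 := h b.val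
    omega

theorem head?_unpairedSnd {v w : List PLetter} (hv : ValSorted v) (hw : ValSorted w)
    {a : PLetter} : (unpairedSnd v w).head? = some a ↔
      a ∈ w ∧ LastTop (vals v) (vals w) a.val := by
  rw [ValSorted.head?_eq_some_iff (v := unpairedSnd v w) (hw.filter _), mem_unpairedSnd hv hw,
    and_assoc]
  refine and_congr_right fun ha => and_congr_right fun hl => ?_
  constructor
  · intro h t
    refine RightRecord.height_le hl (fun m hm hr => ?_) t
    obtain ⟨b, hb, rfl⟩ := mem_vals.1 hm
    exact h b ((mem_unpairedSnd hv hw).2 ⟨hb, hr⟩)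
  · intro h b hb
    by_contra! hc
    have h1 := ((mem_unpairedSnd hv hw).1 hb).2 a.val hc
    have h2 := h b.val
    omega

/-! ### The operators on two rows -/

/-- The operator `f_i` on the two rows that it changes. -/
def pairF (v w : List PLetter) : Option (List PLetter × List PLetter) :=
  match (unpairedFst v w).getLast? with
  | none => none
  | some x =>
    let y := gapAbove (unprime w) x.val
    if x.primed = true then some (v.erase x, addLetter ⟨y, x.primed⟩ w)
    else some (shiftPrimesLeft x.val y (v.erase x) (addLetter ⟨y, x.primed⟩ w))

/-- The operator `e_i` on the two rows that it changes. -/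
def pairE (v w : List PLetter) : Option (List PLetter × List PLetter) :=
  match (unpairedSnd v w).head? with
  | none => none
  | some y =>
    let x := gapBelow (unprime v) y.val
    if y.primed = true then some (addLetter ⟨x, y.primed⟩ v, w.erase y)
    else some (shiftPrimesRight x y.val (addLetter ⟨x, y.primed⟩ v) (w.erase y))

theorem incrF_eq {n : ℕ} (i : Fin (n - 1)) (a : Fin n → List PLetter) :
    incrF i a = (pairF (a (low i)) (a (high i))).map
      fun p => setTwo a (low i) (high i) p.1 p.2 := by
  unfold incrF pairF
  cases (unpairedFst (a (low i)) (a (high i))).getLast? with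
  | none => rfl
  | some x =>
    simp only
    split_ifs <;> rfl

theorem incrE_eq {n : ℕ} (i : Fin (n - 1)) (a : Fin n → List PLetter) :
    incrE i a = (pairE (a (low i)) (a (high i))).map
      fun p => setTwo a (low i) (high i) p.1 p.2 := by
  unfold incrE pairE
  cases (unpairedSnd (a (low i)) (a (high i))).head? with
  | none => rfl
  | some x =>
    simp only
    split_ifs <;> rfl

theorem gapAbove_eq {L : List ℤ} {x : ℤ} {k : ℕ} (h : ∀ m, x ≤ m → m < x + k → m ∈ L)
    (hk : x + k ∉ L) : gapAbove L x = x + k := by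
  unfold gapAbove
  have : Nat.find (exists_gapAbove L x) = k := by
    rw [Nat.find_eq_iff]
    exact ⟨hk, fun m hm => not_not.2 (h _ (by omega) (by omega))⟩
  rw [this]

theorem gapBelow_eq {L : List ℤ} {y : ℤ} {k : ℕ} (h : ∀ m, y - k < m → m ≤ y → m ∈ L)
    (hk : y - k ∉ L) : gapBelow L y = y - k := by
  unfold gapBelow
  have : Nat.find (exists_gapBelow L y) = k := by
    rw [Nat.find_eq_iff]
    exact ⟨hk, fun m hm => not_not.2 (h _ (by omega) (by omega))⟩
  rw [this]

theorem addLetter_eq {A B : List PLetter} {l : PLetter} (h : ValSorted (A ++ l :: B)) :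
    addLetter l (A ++ B) = A ++ l :: B := by
  have h2 : ValSorted (A ++ B) :=
    List.Pairwise.sublist (List.Sublist.append_left (List.sublist_cons_self l B) A) h
  refine List.Perm.eq_of_pairwise' (r := (· ≤ ·)) ?_ ?_ ?_
  · exact List.Pairwise.orderedInsert l _ (h2.imp fun h => (PLetter.lt_of_val_lt h).le)
  · exact h.imp fun h => (PLetter.lt_of_val_lt h).le
  · exact (List.perm_orderedInsert _ _ _).trans List.perm_middle.symm

theorem erase_middle {A B : List PLetter} {l : PLetter} (h : ValSorted (A ++ l :: B)) :
    (A ++ l :: B).erase l = A ++ B := by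
  have : l ∉ A := fun hl => by
    have := (List.pairwise_append.1 h).2.2 l hl l (by simp)
    omega
  rw [List.erase_append_right _ this, List.erase_cons_head]

theorem map_eq_self {L : List PLetter} {f : PLetter → PLetter} (h : ∀ l ∈ L, f l = l) :
    L.map f = L := by
  simpa using List.map_congr_left (g := id) h

theorem map_block {x : ℤ} {k : ℕ} {p q : ℤ → Bool} {f : PLetter → PLetter}
    (h : ∀ m, x ≤ m → m < x + k → f ⟨m, p m⟩ = ⟨m, q m⟩) :
    (block x k p).map f = block x k q := by
  induction k generalizing x with
  | zero => rfl
  | succ k ih =>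
    push_cast at h
    simp only [block, List.map_cons]
    rw [h x le_rfl (by omega), ih fun m h1 h2 => h m (by omega) (by omega)]

theorem mem_unprime {w : List PLetter} {m : ℤ} : m ∈ unprime w ↔ m ∈ vals w := by
  simp [vals]

namespace Slide

variable (s : Slide)

/-- The primes of the rows of a slide that come from a primed involution word. -/
def PrimesOK : Prop :=
  (∀ m, s.x < m → m ≤ s.x + s.k → s.p m = false) ∧
    (s.p s.x = true → ∀ m, s.x ≤ m → m < s.x + s.k → s.q m = false)

theorem v_eq : s.v = s.L ++ ⟨s.x, s.p s.x⟩ :: (block (s.x + 1) s.k s.p ++ s.U) := by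
  simp [v, block]

theorem w'_eq : s.w' = (s.M ++ block s.x s.k (fun m => s.p (m + 1))) ++
    ⟨s.x + s.k, s.p s.x⟩ :: s.N := by
  simp [w']

theorem erase_v : s.v.erase ⟨s.x, s.p s.x⟩ = s.L ++ block (s.x + 1) s.k s.p ++ s.U := by
  have h := s.sorted_v
  rw [v_eq] at h ⊢
  rw [erase_middle h, List.append_assoc]

theorem erase_w' : s.w'.erase ⟨s.x + s.k, s.p s.x⟩ =
    s.M ++ block s.x s.k (fun m => s.p (m + 1)) ++ s.N := by
  have h := s.sorted_w'
  rw [w'_eq] at h ⊢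
  rw [erase_middle h]

theorem add_w : addLetter ⟨s.x + s.k, s.p s.x⟩ s.w =
    s.M ++ block s.x s.k s.q ++ ⟨s.x + s.k, s.p s.x⟩ :: s.N := by
  refine addLetter_eq ?_
  rw [show s.M ++ block s.x s.k s.q ++ ⟨s.x + s.k, s.p s.x⟩ :: s.N =
    s.M ++ (block s.x s.k s.q ++ [⟨s.x + s.k, s.p s.x⟩]) ++ s.N by simp]
  refine valSorted_rows (a := s.x) (b := s.x + s.k) s.sM ?_ s.sN
    (fun l hl => ?_) (fun l hl => ?_) s.hN (by omega)
  · refine valSorted_append (block_sorted _ _ _) (List.pairwise_singleton _ _) ?_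
    intro l hl l' hl'
    have := mem_block.1 hl
    rw [List.mem_singleton.1 hl']
    change _ < s.x + s.k
    omega
  · have := s.hM l hl; omega
  · rcases List.mem_append.1 hl with hl | hl
    · have := mem_block.1 hl; omega
    · rw [List.mem_singleton.1 hl]
      change _ ≤ s.x + s.k ∧ s.x + s.k ≤ _
      omega

theorem add_v' : addLetter ⟨s.x, s.p s.x⟩ s.v' =
    s.L ++ ⟨s.x, s.p s.x⟩ :: (block (s.x + 1) s.k (fun m => s.q (m - 1)) ++ s.U) := by
  rw [v', List.append_assoc]
  refine addLetter_eq ?_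
  rw [show s.L ++ ⟨s.x, s.p s.x⟩ :: (block (s.x + 1) s.k (fun m => s.q (m - 1)) ++ s.U) =
    s.L ++ (⟨s.x, s.p s.x⟩ :: block (s.x + 1) s.k (fun m => s.q (m - 1))) ++ s.U by simp]
  refine valSorted_rows (a := s.x) (b := s.x + s.k) s.sL ?_ s.sU s.hL
    (fun l hl => ?_) (fun l hl => ?_) (by omega)
  · refine List.pairwise_cons.2 ⟨fun l hl => ?_, block_sorted _ _ _⟩
    have := mem_block.1 hl
    change s.x < _
    omega
  · rcases List.mem_cons.1 hl with rfl | hl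
    · change s.x ≤ s.x ∧ s.x ≤ _
      omega
    · have := mem_block.1 hl; omega
  · have := s.hU l hl; omega

theorem gapAbove_w : gapAbove (unprime s.w) s.x = s.x + s.k := by
  apply gapAbove_eq
  · intro m h1 h2
    exact mem_unprime.2 (s.run.right m h1 h2)
  · exact fun h => s.run.gap (mem_unprime.1 h)

theorem gapBelow_v' : gapBelow (unprime s.v') (s.x + s.k) = s.x := by
  have e : s.x = s.x + s.k - (s.k : ℤ) := by ring
  conv_rhs => rw [e]
  apply gapBelow_eq
  · intro m h1 h2
    rw [mem_unprime, vals_v', Finset.mem_erase]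
    exact ⟨by omega, s.run.left m (by omega) h2⟩
  · rw [mem_unprime, vals_v', ← e]
    simp

/-- The block left in the first row is unprimed, so every mark `q m` of the second block is moved to
`m + 1` in the first row. The range condition, together with the absence of a mark on the inserted
letter, leaves all letters outside the two blocks alone. -/
theorem shiftPrimesLeft_eq (h : s.PrimesOK) (hp : s.p s.x = false) :
    shiftPrimesLeft s.x (s.x + s.k) (s.L ++ block (s.x + 1) s.k s.p ++ s.U)
      (s.M ++ block s.x s.k s.q ++ ⟨s.x + s.k, s.p s.x⟩ :: s.N) = (s.v', s.w') := by
  unfold shiftPrimesLeft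
  rw [Prod.mk.injEq]
  constructor
  · rw [List.map_append, List.map_append, v']
    congr 1
    · congr 1
      · refine map_eq_self fun l hl => if_neg ?_
        have := s.hL l hl
        omega
      · refine map_block fun m h1 h2 => ?_
        have hm : (⟨m - 1, true⟩ : PLetter) ∈
            s.M ++ block s.x s.k s.q ++ ⟨s.x + s.k, s.p s.x⟩ :: s.N ↔ s.q (m - 1) = true := by
          rw [List.mem_append, List.mem_append, List.mem_cons, mem_block]
          constructor
          · rintro ((h | h) | h | h)
            · have := s.hM _ h; simp only at this; omega
            · exact h.2.2.symm
            · have := congrArg PLetter.val h; simp only at this; omega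
            · have := s.hN _ h; simp only at this; omega
          · intro h
            exact Or.inl (Or.inr ⟨by simp only; omega, by simp only; omega, h.symm⟩)
        simp only [hm, h.1 m (by omega) (by omega)]
        split_ifs with hc
        · rw [hc.2.2.2]
        · rw [PLetter.mk.injEq]
          refine ⟨rfl, ?_⟩
          symm
          rw [Bool.eq_false_iff]
          exact fun hq => hc ⟨trivial, by omega, by omega, hq⟩
    · refine map_eq_self fun l hl => if_neg ?_
      have := s.hU l hl
      omega
  · rw [List.map_append, List.map_append, List.map_cons, w'_eq]
    congr 1
    · congr 1
      · refine map_eq_self fun l hl => if_neg ?_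
        have := s.hM l hl
        omega
      · refine map_block fun m h1 h2 => ?_
        have hm : (⟨m + 1, false⟩ : PLetter) ∈ s.L ++ block (s.x + 1) s.k s.p ++ s.U := by
          rw [List.mem_append, List.mem_append, mem_block]
          refine Or.inl (Or.inr ⟨by simp only; omega, by simp only; omega, ?_⟩)
          exact (h.1 (m + 1) (by omega) (by omega)).symm
        simp only [hm, h.1 (m + 1) (by omega) (by omega), and_true]
        split_ifs with hc
        · rfl
        · rw [PLetter.mk.injEq]
          refine ⟨rfl, ?_⟩
          rw [Bool.eq_false_iff]
          exact fun hq => hc ⟨hq, by omega, by omega⟩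
    · congr 1
      · rw [if_neg]
        rintro ⟨h1, -⟩
        simp [hp] at h1
      · refine map_eq_self fun l hl => if_neg ?_
        have := s.hN l hl
        omega

theorem shiftPrimesRight_eq (h : s.PrimesOK) (hp : s.p s.x = false) :
    shiftPrimesRight s.x (s.x + s.k)
      (s.L ++ ⟨s.x, s.p s.x⟩ :: (block (s.x + 1) s.k (fun m => s.q (m - 1)) ++ s.U))
      (s.M ++ block s.x s.k (fun m => s.p (m + 1)) ++ s.N) = (s.v, s.w) := by
  unfold shiftPrimesRight
  rw [Prod.mk.injEq]
  constructor
  · rw [List.map_append, List.map_cons, List.map_append, v_eq]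
    congr 1
    · refine map_eq_self fun l hl => if_neg ?_
      have := s.hL l hl
      omega
    · congr 1
      · rw [if_neg]
        rintro ⟨h1, -⟩
        simp [hp] at h1
      · congr 1
        · refine map_block fun m h1 h2 => ?_
          have hm : (⟨m - 1, false⟩ : PLetter) ∈
              s.M ++ block s.x s.k (fun m => s.p (m + 1)) ++ s.N := by
            rw [List.mem_append, List.mem_append, mem_block]
            refine Or.inl (Or.inr ⟨by simp only; omega, by simp only; omega, ?_⟩)
            exact (h.1 (m - 1 + 1) (by omega) (by omega)).symm
          simp only [hm, h.1 m (by omega) (by omega), and_true]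
          split_ifs with hc
          · rfl
          · rw [PLetter.mk.injEq]
            refine ⟨rfl, ?_⟩
            rw [Bool.eq_false_iff]
            exact fun hq => hc ⟨hq, by omega, by omega⟩
        · refine map_eq_self fun l hl => if_neg ?_
          have := s.hU l hl
          omega
  · rw [List.map_append, List.map_append, w]
    congr 1
    · congr 1
      · refine map_eq_self fun l hl => if_neg ?_
        have := s.hM l hl
        omega
      · refine map_block fun m h1 h2 => ?_
        have hm : (⟨m + 1, true⟩ : PLetter) ∈ s.L ++ ⟨s.x, s.p s.x⟩ ::
            (block (s.x + 1) s.k (fun m => s.q (m - 1)) ++ s.U) ↔ s.q m = true := by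
          rw [List.mem_append, List.mem_cons, List.mem_append, mem_block]
          simp only [add_sub_cancel_right]
          constructor
          · rintro (h | h | h | h)
            · have := s.hL _ h; simp only at this; omega
            · have := congrArg PLetter.val h; simp only at this; omega
            · exact h.2.2.symm
            · have := s.hU _ h; simp only at this; omega
          · intro h
            exact Or.inr (Or.inr (Or.inl ⟨by omega, by omega, h.symm⟩))
        simp only [hm, h.1 (m + 1) (by omega) (by omega)]
        split_ifs with hc
        · rw [hc.2.2.2]
        · rw [PLetter.mk.injEq]
          refine ⟨rfl, ?_⟩
          symm
          rw [Bool.eq_false_iff]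
          exact fun hq => hc ⟨trivial, by omega, by omega, hq⟩
    · refine map_eq_self fun l hl => if_neg ?_
      have := s.hN l hl
      omega

/-- If the moved letter is primed, all other marks in the two blocks vanish, so the shift of marks
is invisible. If it is not primed, the shift is the one performed by `shiftPrimesLeft`. -/
theorem pairF_eq (h : s.PrimesOK) (ht : FirstTop (vals s.v) (vals s.w) s.x) :
    pairF s.v s.w = some (s.v', s.w') := by
  have hl : (unpairedFst s.v s.w).getLast? = some ⟨s.x, s.p s.x⟩ := by
    rw [getLast?_unpairedFst s.sorted_v s.sorted_w]
    exact ⟨by rw [v_eq]; simp, ht⟩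
  unfold pairF
  rw [hl]
  simp only [gapAbove_w, erase_v, add_w]
  split_ifs with hp
  · congr 1
    rw [Prod.mk.injEq, v', w'_eq]
    constructor
    · rw [block_congr fun m h1 h2 => ?_]
      rw [h.1 m (by omega) (by omega), h.2 hp (m - 1) (by omega) (by omega)]
    · rw [block_congr fun m h1 h2 => ?_]
      rw [h.1 (m + 1) (by omega) (by omega), h.2 hp m (by omega) (by omega)]
  · rw [shiftPrimesLeft_eq s h (by simpa using hp)]

theorem pairE_eq (h : s.PrimesOK) (ht : FirstTop (vals s.v) (vals s.w) s.x) :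
    pairE s.v' s.w' = some (s.v, s.w) := by
  have hl : (unpairedSnd s.v' s.w').head? = some ⟨s.x + s.k, s.p s.x⟩ := by
    rw [head?_unpairedSnd s.sorted_v' s.sorted_w']
    refine ⟨by rw [w'_eq]; simp, ?_⟩
    rw [vals_v', vals_w']
    exact s.run.firstTop_iff.1 ht
  unfold pairE
  rw [hl]
  simp only [gapBelow_v', erase_w', add_v']
  split_ifs with hp
  · congr 1
    rw [Prod.mk.injEq, v_eq, w]
    constructor
    · rw [block_congr fun m h1 h2 => ?_]
      rw [h.1 m (by omega) (by omega), h.2 hp (m - 1) (by omega) (by omega)]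
    · rw [block_congr fun m h1 h2 => ?_]
      rw [h.1 (m + 1) (by omega) (by omega), h.2 hp m (by omega) (by omega)]
  · rw [shiftPrimesRight_eq s h (by simpa using hp)]

theorem length_unpairedFst_slide (ht : FirstTop (vals s.v) (vals s.w) s.x) :
    (unpairedFst s.v s.w).length = (unpairedFst s.v' s.w').length + 1 := by
  rw [length_unpairedFst s.sorted_v s.sorted_w, length_unpairedFst s.sorted_v' s.sorted_w',
    vals_v', vals_w']
  have hx : s.x ∈ leftRecords (vals s.v) (vals s.w) :=
    mem_leftRecords.2 ⟨s.run.left _ le_rfl (by omega), ht.1⟩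
  have e : leftRecords ((vals s.v).erase s.x) (insert (s.x + s.k) (vals s.w)) =
      (leftRecords (vals s.v) (vals s.w)).erase s.x := by
    ext m
    rw [mem_leftRecords, Finset.mem_erase, Finset.mem_erase, mem_leftRecords, and_assoc]
    exact and_congr_right fun hm => and_congr_right fun _ => s.run.leftRecord_slide ht hm
  rw [e, Finset.card_erase_add_one hx]

theorem length_unpairedSnd_slide (ht : FirstTop (vals s.v) (vals s.w) s.x) :
    (unpairedSnd s.v' s.w').length = (unpairedSnd s.v s.w).length + 1 := by
  rw [length_unpairedSnd s.sorted_v s.sorted_w, length_unpairedSnd s.sorted_v' s.sorted_w',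
    vals_v', vals_w']
  have hx : s.x + s.k ∉ rightRecords (vals s.v) (vals s.w) :=
    fun h => s.run.gap (mem_rightRecords.1 h).1
  have e : rightRecords ((vals s.v).erase s.x) (insert (s.x + s.k) (vals s.w)) =
      insert (s.x + s.k : ℤ) (rightRecords (vals s.v) (vals s.w)) := by
    ext m
    rw [mem_rightRecords, Finset.mem_insert, Finset.mem_insert, mem_rightRecords]
    by_cases hm : m = s.x + s.k
    · simp only [hm, true_or, true_and, iff_true]
      exact (s.run.firstTop_iff.1 ht).1
    · simp only [hm, false_or]
      exact and_congr_right fun _ => s.run.rightRecord_slide ht hm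
  rw [e, Finset.card_insert_of_notMem hx]

end Slide

/-! ### Admissible pairs of rows -/

/-- Two rows that occur next to each other in an increasing factorization of some word. -/
def RowPair (v w : List PLetter) : Prop :=
  ValSorted v ∧ ValSorted w ∧ ∃ u z : Perm ℤ, Function.Involutive u ∧ Leads u (v ++ w) z

theorem exists_gapAbove_run (W : List PLetter) (x : ℤ) :
    ∃ k : ℕ, (∀ m, x ≤ m → m < x + k → m ∈ vals W) ∧ x + k ∉ vals W := by
  refine ⟨Nat.find (exists_gapAbove (unprime W) x), fun m h1 h2 => ?_, fun h => ?_⟩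
  · have := Nat.find_min (exists_gapAbove (unprime W) x) (m := (m - x).toNat) (by omega)
    rw [not_not, mem_unprime] at this
    rwa [show x + ((m - x).toNat : ℤ) = m by omega] at this
  · exact Nat.find_spec (exists_gapAbove (unprime W) x) (mem_unprime.2 h)

theorem exists_gapBelow_run (V : List PLetter) (y : ℤ) :
    ∃ k : ℕ, (∀ m, y - k < m → m ≤ y → m ∈ vals V) ∧ y - k ∉ vals V := by
  refine ⟨Nat.find (exists_gapBelow (unprime V) y), fun m h1 h2 => ?_, fun h => ?_⟩
  · have := Nat.find_min (exists_gapBelow (unprime V) y) (m := (y - m).toNat) (by omega)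
    rw [not_not, mem_unprime] at this
    rwa [show y - ((y - m).toNat : ℤ) = m by omega] at this
  · exact Nat.find_spec (exists_gapBelow (unprime V) y) (mem_unprime.2 h)

/-- The run of `W` starting at `a` determines `k`; the absence of repeated blocks and the maximality
of the height supply the required gaps. -/
theorem exists_slide_of_firstTop {v w : List PLetter} (h : RowPair v w) {a : PLetter} (ha : a ∈ v)
    (ht : FirstTop (vals v) (vals w) a.val) :
    ∃ s : Slide, s.v = v ∧ s.w = w ∧ s.x = a.val := by
  obtain ⟨hv, hw, u, z, hu, hl⟩ := h
  have hR := unrepeated_of_leads hu hv hw hl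
  obtain ⟨k, hk1, hk2⟩ := exists_gapAbove_run w a.val
  have hrun := run_of_leftRecord hR (val_mem_vals ha) ht.1 (fun m hm hr => by
    by_contra! hc
    have := hr a.val hc
    have := ht.2 m
    omega) hk1 hk2
  have e1 := hv.decompose (a := a.val) (k := k + 1)
    fun m h1 h2 => hrun.left m h1 (by push_cast at h2; omega)
  have e2 := hw.decompose (a := a.val) (k := k) hk1
  refine ⟨⟨a.val, k, marks v, marks w, _, _, _, _, ?_, ?_, ?_, ?_, hv.filter _, hv.filter _,
    hw.filter _, hw.filter _⟩, e1.symm, e2.symm, rfl⟩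
  · intro l hl
    simpa using (List.mem_filter.1 hl).2
  · intro l hl
    obtain ⟨h1, h2⟩ := List.mem_filter.1 hl
    simp only [decide_eq_true_eq] at h2
    have : l.val ≠ a.val + k + 1 := fun e => hrun.gap_right (e ▸ val_mem_vals h1)
    push_cast at h2
    omega
  · intro l hl
    obtain ⟨h1, h2⟩ := List.mem_filter.1 hl
    simp only [decide_eq_true_eq] at h2
    have : l.val ≠ a.val - 1 := fun e => hrun.gap_left (e ▸ val_mem_vals h1)
    omega
  · intro l hl
    obtain ⟨h1, h2⟩ := List.mem_filter.1 hl
    simp only [decide_eq_true_eq] at h2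
    have : l.val ≠ a.val + k := fun e => hrun.gap (e ▸ val_mem_vals h1)
    omega

theorem exists_slide_of_lastTop {v w : List PLetter} (h : RowPair v w) {b : PLetter} (hb : b ∈ w)
    (ht : LastTop (vals v) (vals w) b.val) :
    ∃ s : Slide, s.v' = v ∧ s.w' = w ∧ s.x + s.k = b.val := by
  obtain ⟨hv, hw, u, z, hu, hl⟩ := h
  have hR := unrepeated_of_leads hu hv hw hl
  obtain ⟨k, hk1, hk2⟩ := exists_gapBelow_run v b.val
  obtain ⟨x, hx⟩ : ∃ x, x = b.val - k := ⟨_, rfl⟩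
  have hbx : b.val = x + k := by omega
  rw [← hx] at hk1 hk2
  have hrun := run_of_rightRecord (x := x) (k := k) hR (hbx ▸ val_mem_vals hb) (hbx ▸ ht.1)
    (fun m hm hr => by
      by_contra! hc
      have := hr b.val (by omega)
      have := ht.2 m
      omega) (fun m h1 h2 => hk1 m h1 (by omega)) hk2
  obtain ⟨hrW, hrM, hrU⟩ := hrun
  have e1 := hv.decompose (a := x + 1) (k := k) fun m h1 h2 => hk1 m (by omega) (by omega)
  have e2 := hw.decompose (a := x) (k := k + 1) fun m h1 h2 =>
    hrW m h1 (by push_cast at h2; omega)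
  -- The marks before the move are recovered by undoing the shift: the letter `x` receives the mark
  -- of `b`, and the marks of each row are read off from the other row.
  refine ⟨⟨x, k, fun m => if m = x then b.primed else marks w (m - 1), fun m => marks v (m + 1),
    _, _, _, _, ?_, ?_, ?_, ?_, hv.filter (fun l => decide (l.val < x + 1)),
    hv.filter (fun l => decide (x + 1 + k ≤ l.val)), hw.filter (fun l => decide (l.val < x)),
    hw.filter (fun l => decide (x + (k + 1 : ℕ) ≤ l.val))⟩, ?_, ?_, hbx.symm⟩
  · intro l hl
    obtain ⟨h1, h2⟩ := List.mem_filter.1 hl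
    simp only [decide_eq_true_eq] at h2
    have : l.val ≠ x := fun e => hk2 (e ▸ val_mem_vals h1)
    omega
  · intro l hl
    obtain ⟨h1, h2⟩ := List.mem_filter.1 hl
    simp only [decide_eq_true_eq] at h2
    have : l.val ≠ x + k + 1 := fun e => hrU (e ▸ val_mem_vals h1)
    omega
  · intro l hl
    obtain ⟨h1, h2⟩ := List.mem_filter.1 hl
    simp only [decide_eq_true_eq] at h2
    have : l.val ≠ x - 1 := fun e => hrM (e ▸ val_mem_vals h1)
    omega
  · intro l hl
    obtain ⟨h1, h2⟩ := List.mem_filter.1 hl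
    simp only [decide_eq_true_eq] at h2
    push_cast at h2
    omega
  · unfold Slide.v'
    simp only [sub_add_cancel]
    exact e1.symm
  · unfold Slide.w'
    simp only [if_true]
    conv_rhs => rw [e2, block_succ_last]
    congr 2
    congr 1
    · refine block_congr fun m h1 h2 => ?_
      rw [if_neg (by omega), add_sub_cancel_right]
    · rw [hw.primed_eq_marks hb, hbx]

theorem Slide.primesOK (s : Slide) (h : RowPair s.v s.w) : s.PrimesOK := by
  obtain ⟨-, -, u, z, hu, hl⟩ := h
  exact s.primes hu hl

theorem Slide.rowPair_iff (s : Slide) : RowPair s.v s.w ↔ RowPair s.v' s.w' := by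
  constructor
  · rintro ⟨-, -, u, z, hu, hl⟩
    exact ⟨s.sorted_v', s.sorted_w', u, z, hu, (s.leads_iff hu).1 hl⟩
  · rintro ⟨-, -, u, z, hu, hl⟩
    exact ⟨s.sorted_v, s.sorted_w, u, z, hu, (s.leads_iff hu).2 hl⟩

theorem exists_slide_of_pairF {v w a b : List PLetter} (h : RowPair v w)
    (hf : pairF v w = some (a, b)) :
    ∃ s : Slide, s.v = v ∧ s.w = w ∧ s.v' = a ∧ s.w' = b ∧
      FirstTop (vals s.v) (vals s.w) s.x := by
  have : ∃ x, (unpairedFst v w).getLast? = some x := by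
    cases hg : (unpairedFst v w).getLast? with
    | none => unfold pairF at hf; rw [hg] at hf; simp at hf
    | some x => exact ⟨x, rfl⟩
  obtain ⟨x, hx⟩ := this
  obtain ⟨h1, h2⟩ := (getLast?_unpairedFst h.1 h.2.1).1 hx
  obtain ⟨s, rfl, rfl, e⟩ := exists_slide_of_firstTop h h1 h2
  rw [← e] at h2
  have := s.pairF_eq (s.primesOK h) h2
  rw [hf] at this
  simp only [Option.some.injEq, Prod.mk.injEq] at this
  exact ⟨s, rfl, rfl, this.1.symm, this.2.symm, h2⟩

theorem exists_slide_of_pairE {v w a b : List PLetter} (h : RowPair v w)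
    (hf : pairE v w = some (a, b)) :
    ∃ s : Slide, s.v = a ∧ s.w = b ∧ s.v' = v ∧ s.w' = w ∧
      FirstTop (vals s.v) (vals s.w) s.x := by
  have : ∃ x, (unpairedSnd v w).head? = some x := by
    cases hg : (unpairedSnd v w).head? with
    | none => unfold pairE at hf; rw [hg] at hf; simp at hf
    | some x => exact ⟨x, rfl⟩
  obtain ⟨x, hx⟩ := this
  obtain ⟨h1, h2⟩ := (head?_unpairedSnd h.1 h.2.1).1 hx
  obtain ⟨s, rfl, rfl, e⟩ := exists_slide_of_lastTop h h1 h2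
  rw [← e, s.vals_v', s.vals_w', ← s.run.firstTop_iff] at h2
  have := s.pairE_eq (s.primesOK (s.rowPair_iff.2 h)) h2
  rw [hf] at this
  simp only [Option.some.injEq, Prod.mk.injEq] at this
  exact ⟨s, this.1.symm, this.2.symm, rfl, rfl, h2⟩

theorem pairE_of_pairF {v w a b : List PLetter} (h : RowPair v w)
    (hf : pairF v w = some (a, b)) : pairE a b = some (v, w) := by
  obtain ⟨s, rfl, rfl, rfl, rfl, ht⟩ := exists_slide_of_pairF h hf
  exact s.pairE_eq (s.primesOK h) ht

theorem pairF_of_pairE {v w a b : List PLetter} (h : RowPair v w)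
    (hf : pairE v w = some (a, b)) : pairF a b = some (v, w) := by
  obtain ⟨s, rfl, rfl, rfl, rfl, ht⟩ := exists_slide_of_pairE h hf
  exact s.pairF_eq (s.primesOK (s.rowPair_iff.2 h)) ht

theorem pairF_eq_none_iff {v w : List PLetter} :
    pairF v w = none ↔ (unpairedFst v w).length = 0 := by
  rw [List.length_eq_zero_iff, ← List.getLast?_eq_none_iff]
  unfold pairF
  cases (unpairedFst v w).getLast? with
  | none => simp
  | some x => simp only [reduceCtorEq, iff_false]; split_ifs <;> simp

theorem pairE_eq_none_iff {v w : List PLetter} :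
    pairE v w = none ↔ (unpairedSnd v w).length = 0 := by
  rw [List.length_eq_zero_iff, ← List.head?_eq_none_iff]
  unfold pairE
  cases (unpairedSnd v w).head? with
  | none => simp
  | some x => simp only [reduceCtorEq, iff_false]; split_ifs <;> simp

/-- The numbers of unpaired letters of the two rows differ by as much as their lengths. -/
theorem length_unpaired_sub {v w : List PLetter} (hv : ValSorted v) (hw : ValSorted w) :
    ((unpairedFst v w).length : ℤ) - (unpairedSnd v w).length = v.length - w.length := by
  have h1 : (v.filter fun x => !decide (∀ p ∈ pairing v w, p.1 ≠ x)).length =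
      (w.filter fun y => !decide (∀ p ∈ pairing v w, p.2 ≠ y)).length := by
    have n1 : (v.filter fun x => !decide (∀ p ∈ pairing v w, p.1 ≠ x)).Nodup := hv.nodup.filter _
    have n2 : (w.filter fun y => !decide (∀ p ∈ pairing v w, p.2 ≠ y)).Nodup := hw.nodup.filter _
    rw [← List.toFinset_card_of_nodup n1, ← List.toFinset_card_of_nodup n2]
    apply le_antisymm
    · apply Finset.card_le_card_of_forall_subsingleton (fun a b => (a, b) ∈ pairing v w)
      · intro a ha
        simp only [List.mem_toFinset, List.mem_filter, Bool.not_eq_true', decide_eq_false_iff_not] at ha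
        push Not at ha
        obtain ⟨-, p, hp, rfl⟩ := ha
        refine ⟨p.2, ?_, hp⟩
        simp only [List.mem_toFinset, List.mem_filter, Bool.not_eq_true', decide_eq_false_iff_not]
        push Not
        exact ⟨(pairing_mem hp).2.1, p, hp, rfl⟩
      · rintro b - a ⟨-, h1⟩ a' ⟨-, h2⟩
        exact congrArg Prod.fst (pairing_injective hw h1 h2 (Or.inr rfl))
    · apply Finset.card_le_card_of_forall_subsingleton (fun b a => (a, b) ∈ pairing v w)
      · intro b hb
        simp only [List.mem_toFinset, List.mem_filter, Bool.not_eq_true', decide_eq_false_iff_not] at hb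
        push Not at hb
        obtain ⟨-, p, hp, rfl⟩ := hb
        refine ⟨p.1, ?_, hp⟩
        simp only [List.mem_toFinset, List.mem_filter, Bool.not_eq_true', decide_eq_false_iff_not]
        push Not
        exact ⟨(pairing_mem hp).1, p, hp, rfl⟩
      · rintro b - a ⟨-, h1⟩ a' ⟨-, h2⟩
        exact congrArg Prod.snd (pairing_injective hw h1 h2 (Or.inl rfl))
  have e1 := List.length_eq_length_filter_add (l := v)
    fun x => decide (∀ p ∈ pairing v w, p.1 ≠ x)
  have e2 := List.length_eq_length_filter_add (l := w)
    fun y => decide (∀ p ∈ pairing v w, p.2 ≠ y)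
  unfold unpairedFst unpairedSnd
  omega

end QPlus

namespace QPlus

open Equiv

/-! ### The queer operators on the first two rows -/

/-- The operator `f` of the queer index on the two rows that it changes. -/
def pairFBar (v w : List PLetter) : Option (List PLetter × List PLetter) :=
  match v with
  | [] => none
  | x :: u =>
    if ∀ y ∈ w, x < y then
      match u with
      | [] => some ([], x :: w)
      | y :: t => some (⟨y.val, x.primed⟩ :: t, ⟨x.val, y.primed⟩ :: w)
    else none

/-- The operator `e` of the queer index on the two rows that it changes. -/
def pairEBar (v w : List PLetter) : Option (List PLetter × List PLetter) :=
  match w with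
  | [] => none
  | y :: u =>
    if ∀ x ∈ v, y < x then
      match v with
      | [] => some ([y], u)
      | x :: t => some (⟨y.val, x.primed⟩ :: ⟨x.val, y.primed⟩ :: t, u)
    else none

/-- Reversing two different marks is the same as exchanging them. This removes the case distinction
on primes from the queer operators. -/
theorem PLetter.toggle_of_ne {x y : PLetter} (h : ¬ x.primed = y.primed) :
    x.toggle = ⟨x.val, y.primed⟩ := by
  unfold PLetter.toggle
  cases hx : x.primed <;> cases hy : y.primed <;> simp_all

theorem incrFBar_eq {n : ℕ} (h : 2 ≤ n) (a : Fin n → List PLetter) :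
    incrFBar h a = (pairFBar (a (fstIdx (by omega))) (a (sndIdx h))).map
      fun p => setTwo a (fstIdx (by omega)) (sndIdx h) p.1 p.2 := by
  unfold incrFBar pairFBar
  simp only
  rcases a (fstIdx (by omega)) with _ | ⟨x, _ | ⟨y, t⟩⟩
  · rfl
  · simp only
    split_ifs <;> rfl
  · simp only
    split_ifs with h1 h2
    · obtain ⟨m, p⟩ := x
      obtain ⟨k, q⟩ := y
      simp only at h2
      subst h2
      rfl
    · rw [PLetter.toggle_of_ne h2, PLetter.toggle_of_ne (Ne.symm h2)]
      rfl
    · rfl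

theorem incrEBar_eq {n : ℕ} (h : 2 ≤ n) (a : Fin n → List PLetter) :
    incrEBar h a = (pairEBar (a (fstIdx (by omega))) (a (sndIdx h))).map
      fun p => setTwo a (fstIdx (by omega)) (sndIdx h) p.1 p.2 := by
  unfold incrEBar pairEBar
  simp only
  rcases a (sndIdx h) with _ | ⟨y, u⟩
  · rfl
  · rcases a (fstIdx (by omega)) with _ | ⟨x, t⟩
    · simp only
      split_ifs <;> rfl
    · simp only
      split_ifs with h1 h2
      · obtain ⟨m, p⟩ := x
        obtain ⟨k, q⟩ := y
        simp only at h2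
        subst h2
        rfl
      · rw [PLetter.toggle_of_ne h2, PLetter.toggle_of_ne (Ne.symm h2)]
        rfl
      · rfl

theorem fixedPair_one (x : ℤ) : FixedPair 1 x := ⟨rfl, rfl⟩

theorem invStep_one (x : ℤ) : invStep 1 x = swap x (x + 1) := by
  rw [invStep_of_fixed (fixedPair_one x), one_mul]

/-- From the identity the first letter is always a commutation. If `y = x + 1`, both orders give
`s_x s_y s_x` and the second letter is not a commutation, so its mark is absent. If `y` is farther
away, both letters are commutations and carry arbitrary marks. -/
theorem leads_one_exchange {x y : ℤ} (h : x < y) (p q : Bool) (w : List PLetter) (z : Perm ℤ) :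
    Leads 1 (⟨x, p⟩ :: ⟨y, q⟩ :: w) z ↔ Leads 1 (⟨y, p⟩ :: ⟨x, q⟩ :: w) z := by
  simp only [Leads, fixedPair_one, implies_true, true_and, Perm.one_apply, invStep_one]
  rcases eq_or_lt_of_le (show x + 1 ≤ y by omega) with rfl | hy
  · have g1 : swap (x + 1) (x + 1 + 1) x = x := swap_apply_of_ne_of_ne (by omega) (by omega)
    have g2 : swap x (x + 1) (x + 1 + 1) = x + 1 + 1 :=
      swap_apply_of_ne_of_ne (by omega) (by omega)
    have a1 : swap x (x + 1) (x + 1) < swap x (x + 1) (x + 1 + 1) := by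
      rw [swap_apply_right, g2]; omega
    have a2 : swap (x + 1) (x + 1 + 1) x < swap (x + 1) (x + 1 + 1) (x + 1) := by
      rw [swap_apply_left, g1]; omega
    have f1 : ¬ FixedPair (swap x (x + 1)) (x + 1) := by
      rintro ⟨k, -⟩; rw [swap_apply_right] at k; omega
    have f2 : ¬ FixedPair (swap (x + 1) (x + 1 + 1)) x := by
      rintro ⟨-, k⟩; rw [swap_apply_left] at k; omega
    rw [invStep_of_not_fixed a1 f1, invStep_of_not_fixed a2 f2, mul_assoc, swap_braid, mul_assoc]
    simp only [a1, a2, f1, f2]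
    simp
  · have s1 : swap x (x + 1) y = y := swap_apply_of_ne_of_ne (by omega) (by omega)
    have s2 : swap x (x + 1) (y + 1) = y + 1 := swap_apply_of_ne_of_ne (by omega) (by omega)
    have s3 : swap y (y + 1) x = x := swap_apply_of_ne_of_ne (by omega) (by omega)
    have s4 : swap y (y + 1) (x + 1) = x + 1 := swap_apply_of_ne_of_ne (by omega) (by omega)
    have hc : swap x (x + 1) * swap y (y + 1) = swap y (y + 1) * swap x (x + 1) := by
      ext j
      simp only [Perm.mul_apply, swap_succ_apply]
      split_ifs <;> omega
    rw [invStep_of_fixed (⟨s1, s2⟩ : FixedPair _ y), invStep_of_fixed (⟨s3, s4⟩ : FixedPair _ x), hc,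
      s1, s2, s3, s4]
    simp [FixedPair, s1, s2, s3, s4]

theorem leads_one_shift {x y : ℤ} (h : x < y) (p q : Bool) {t : List PLetter}
    (ht : ∀ l ∈ t, y < l.val) (w : List PLetter) (z : Perm ℤ) :
    Leads 1 (⟨x, p⟩ :: ⟨y, q⟩ :: t ++ w) z ↔ Leads 1 (⟨y, p⟩ :: t ++ ⟨x, q⟩ :: w) z := by
  have e : WordEqv (⟨x, q⟩ :: t) (t ++ [⟨x, q⟩]) :=
    wordEqv_cons_append fun b hb => Or.inl (by have := ht b hb; simp only; omega)
  have e2 := ((e.append_right w).cons ⟨y, p⟩) 1 z one_involutive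
  simp only [List.cons_append, List.append_assoc, List.nil_append] at e2 ⊢
  rw [← e2]
  exact leads_one_exchange h p q _ z

/-- Suppose both rows began with `m`. The second `m` can be moved left past every letter that is at
least `m + 2`. It then stands directly after the first `m`, or is separated from it only by the
second letter of the row. In the latter case the initial exchange again produces two adjacent
letters `m`. -/
theorem head_val_ne {x y : PLetter} {u w : List PLetter} (hv : ValSorted (x :: u)) {z : Perm ℤ}
    (h : Leads 1 (x :: u ++ y :: w) z) : x.val ≠ y.val := by
  obtain ⟨m, p⟩ := x
  obtain ⟨m', q⟩ := y
  simp only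
  rintro rfl
  obtain ⟨h1, h2⟩ := List.pairwise_cons.1 hv
  simp only at h1
  have key : ∀ t : List PLetter, (∀ l ∈ t, m + 2 ≤ l.val) →
      WordEqv (t ++ ⟨m, q⟩ :: w) (⟨m, q⟩ :: (t ++ w)) := by
    intro t ht
    have := ((wordEqv_cons_append (a := ⟨m, q⟩) (w := t) fun b hb =>
      Or.inl (ht b hb)).append_right w).symm
    simpa using this
  by_cases hu : ∀ l ∈ u, m + 2 ≤ l.val
  · exact not_leads_repeat one_involutive (((key u hu).cons _ 1 z one_involutive).1 h)
  · cases u with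
    | nil => simp at hu
    | cons c t =>
      obtain ⟨h3, -⟩ := List.pairwise_cons.1 h2
      have ht : ∀ l ∈ t, m + 2 ≤ l.val := by
        intro l hl
        have := h1 c (by simp)
        have := h3 l hl
        omega
      have hc : m < c.val := h1 c (by simp)
      have h4 := (((key t ht).cons c).cons ⟨m, p⟩ 1 z one_involutive).1 h
      obtain ⟨m', r⟩ := c
      rw [leads_one_exchange hc] at h4
      exact not_leads_repeat (invStep_involutive one_involutive _) h4.2.2

/-- Two rows at the beginning of an increasing factorization of some word. -/
def FirstRows (v w : List PLetter) : Prop :=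
  ValSorted v ∧ ValSorted w ∧ ∃ z : Perm ℤ, Leads 1 (v ++ w) z

/-- Primes cannot decide the comparison of the two heads, because these are different integers. The
definedness of the queer operators thus depends on the integer sets only. -/
theorem FirstRows.lt_iff {x y : PLetter} {u w : List PLetter}
    (h : FirstRows (x :: u) (y :: w)) : x < y ↔ x.val < y.val := by
  obtain ⟨hv, hw, z, hz⟩ := h
  have := head_val_ne hv hz
  exact ⟨fun h => lt_of_le_of_ne (PLetter.val_le_of_lt h) this, PLetter.lt_of_val_lt⟩

theorem FirstRows.gt_iff {x y : PLetter} {u w : List PLetter}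
    (h : FirstRows (x :: u) (y :: w)) : y < x ↔ y.val < x.val := by
  obtain ⟨hv, hw, z, hz⟩ := h
  have := head_val_ne hv hz
  exact ⟨fun h => lt_of_le_of_ne (PLetter.val_le_of_lt h) this.symm, PLetter.lt_of_val_lt⟩

theorem FirstRows.forall_lt_iff {x : PLetter} {u w : List PLetter} (h : FirstRows (x :: u) w) :
    (∀ y ∈ w, x < y) ↔ ∀ y ∈ w, x.val < y.val := by
  refine ⟨fun h1 y hy => ?_, fun h1 y hy => PLetter.lt_of_val_lt (h1 y hy)⟩
  cases w with
  | nil => simp at hy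
  | cons c w =>
    have h2 := h.lt_iff.1 (h1 c (by simp))
    rcases List.mem_cons.1 hy with rfl | hy
    · exact h2
    · exact h2.trans ((List.pairwise_cons.1 h.2.1).1 y hy)

theorem FirstRows.forall_gt_iff {y : PLetter} {v u : List PLetter} (h : FirstRows v (y :: u)) :
    (∀ x ∈ v, y < x) ↔ ∀ x ∈ v, y.val < x.val := by
  refine ⟨fun h1 x hx => ?_, fun h1 x hx => PLetter.lt_of_val_lt (h1 x hx)⟩
  cases v with
  | nil => simp at hx
  | cons c v =>
    have h2 := h.gt_iff.1 (h1 c (by simp))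
    rcases List.mem_cons.1 hx with rfl | hx
    · exact h2
    · exact h2.trans ((List.pairwise_cons.1 h.1).1 x hx)

/-- The queer lowering operator is defined exactly if the first row starts with the smallest
letter. -/
def StartsLow (v w : List PLetter) : Prop := ∃ m ∈ vals v, ∀ l ∈ vals w, m < l

theorem startsLow_iff {x : PLetter} {u w : List PLetter} (hv : ValSorted (x :: u)) :
    StartsLow (x :: u) w ↔ ∀ y ∈ w, x.val < y.val := by
  constructor
  · rintro ⟨m, hm, hw⟩ y hy
    obtain ⟨a, ha, rfl⟩ := mem_vals.1 hm
    have h1 := hw _ (val_mem_vals hy)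
    rcases List.mem_cons.1 ha with rfl | ha
    · exact h1
    · exact ((List.pairwise_cons.1 hv).1 a ha).trans h1
  · intro h
    refine ⟨x.val, val_mem_vals (by simp), fun l hl => ?_⟩
    obtain ⟨a, ha, rfl⟩ := mem_vals.1 hl
    exact h a ha

theorem pairFBar_ne_none_iff {v w : List PLetter} (h : FirstRows v w) :
    pairFBar v w ≠ none ↔ StartsLow v w := by
  cases v with
  | nil => simp [pairFBar, StartsLow, vals, unprime]
  | cons x u =>
    rw [startsLow_iff h.1, ← h.forall_lt_iff]
    unfold pairFBar
    by_cases hc : ∀ y ∈ w, x < y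
    · simp only [if_pos hc]
      cases u <;> exact ⟨fun _ => hc, fun _ => by simp⟩
    · simp only [if_neg hc]
      simp [hc]

theorem pairEBar_ne_none_iff {v w : List PLetter} (h : FirstRows v w) :
    pairEBar v w ≠ none ↔ StartsLow w v := by
  cases w with
  | nil => simp [pairEBar, StartsLow, vals, unprime]
  | cons y u =>
    rw [startsLow_iff h.2.1, ← h.forall_gt_iff]
    unfold pairEBar
    by_cases hc : ∀ x ∈ v, y < x
    · simp only [if_pos hc]
      cases v <;> exact ⟨fun _ => hc, fun _ => by simp⟩
    · simp only [if_neg hc]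
      simp [hc]

theorem startsLow_or {v w : List PLetter} (h : FirstRows v w) (hne : ¬ (v = [] ∧ w = [])) :
    StartsLow v w ∨ StartsLow w v := by
  cases v with
  | nil =>
    cases w with
    | nil => simp at hne
    | cons y u => right; rw [startsLow_iff h.2.1]; simp
  | cons x t =>
    cases w with
    | nil => left; rw [startsLow_iff h.1]; simp
    | cons y u =>
      obtain ⟨hv, hw, z, hz⟩ := h
      rcases lt_or_gt_of_ne (head_val_ne hv hz) with hlt | hlt
      · left
        rw [startsLow_iff hv]
        intro c hc
        rcases List.mem_cons.1 hc with rfl | hc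
        · exact hlt
        · exact hlt.trans ((List.pairwise_cons.1 hw).1 c hc)
      · right
        rw [startsLow_iff hw]
        intro c hc
        rcases List.mem_cons.1 hc with rfl | hc
        · exact hlt
        · exact hlt.trans ((List.pairwise_cons.1 hv).1 c hc)

theorem StartsLow.not_swap {v w : List PLetter} (h : StartsLow v w) : ¬ StartsLow w v := by
  rintro ⟨m, hm, h1⟩
  obtain ⟨m', hm', h2⟩ := h
  have := h1 _ hm'
  have := h2 _ hm
  omega

theorem pairFBar_spec {v w a b : List PLetter} (h : FirstRows v w)
    (hf : pairFBar v w = some (a, b)) :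
    pairEBar a b = some (v, w) ∧ ValSorted a ∧ ValSorted b ∧ StartsLow b a ∧
      v.length = a.length + 1 ∧ b.length = w.length + 1 ∧
      ∀ (r : List PLetter) (z : Perm ℤ), Leads 1 (v ++ (w ++ r)) z → Leads 1 (a ++ (b ++ r)) z := by
  have hd := (pairFBar_ne_none_iff h).1 (by rw [hf]; simp)
  cases v with
  | nil => simp [pairFBar] at hf
  | cons x u =>
    rw [startsLow_iff h.1] at hd
    unfold pairFBar at hf
    simp only [if_pos (h.forall_lt_iff.2 hd)] at hf
    obtain ⟨m, p⟩ := x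
    cases u with
    | nil =>
      simp only [Option.some.injEq, Prod.mk.injEq] at hf
      obtain ⟨rfl, rfl⟩ := hf
      have hb : ValSorted (⟨m, p⟩ :: w) := List.pairwise_cons.2 ⟨hd, h.2.1⟩
      refine ⟨by simp [pairEBar], List.Pairwise.nil, hb, (startsLow_iff hb).2 (by simp), rfl, rfl,
        fun r z hz => by simpa using hz⟩
    | cons y t =>
      obtain ⟨m', q⟩ := y
      simp only [Option.some.injEq, Prod.mk.injEq] at hf
      obtain ⟨rfl, rfl⟩ := hf
      obtain ⟨h1, h2⟩ := List.pairwise_cons.1 h.1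
      obtain ⟨h3, h4⟩ := List.pairwise_cons.1 h2
      have hlt : m < m' := h1 ⟨m', q⟩ (by simp)
      have hall : ∀ l ∈ (⟨m', p⟩ :: t : List PLetter), m < l.val := by
        intro l hl
        rcases List.mem_cons.1 hl with rfl | hl
        · exact hlt
        · exact h1 l (by simp [hl])
      have hb : ValSorted (⟨m, q⟩ :: w) := List.pairwise_cons.2 ⟨hd, h.2.1⟩
      refine ⟨?_, List.pairwise_cons.2 ⟨h3, h4⟩, hb, (startsLow_iff hb).2 hall, rfl, rfl,
        fun r z hz => ?_⟩
      · unfold pairEBar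
        simp only
        rw [if_pos fun l hl => PLetter.lt_of_val_lt (hall l hl)]
      · exact (leads_one_shift hlt p q h3 (w ++ r) z).1 hz

theorem pairEBar_spec {v w a b : List PLetter} (h : FirstRows v w)
    (hf : pairEBar v w = some (a, b)) :
    pairFBar a b = some (v, w) ∧ ValSorted a ∧ ValSorted b ∧ StartsLow a b ∧
      a.length = v.length + 1 ∧ w.length = b.length + 1 ∧
      ∀ (r : List PLetter) (z : Perm ℤ), Leads 1 (v ++ (w ++ r)) z → Leads 1 (a ++ (b ++ r)) z := by
  have hd := (pairEBar_ne_none_iff h).1 (by rw [hf]; simp)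
  cases w with
  | nil => simp [pairEBar] at hf
  | cons y u =>
    rw [startsLow_iff h.2.1] at hd
    unfold pairEBar at hf
    simp only [if_pos (h.forall_gt_iff.2 hd)] at hf
    obtain ⟨h3, h4⟩ := List.pairwise_cons.1 h.2.1
    obtain ⟨m, q⟩ := y
    cases v with
    | nil =>
      simp only [Option.some.injEq, Prod.mk.injEq] at hf
      obtain ⟨rfl, rfl⟩ := hf
      have hb : ValSorted [⟨m, q⟩] := List.pairwise_singleton _ _
      refine ⟨?_, hb, h4, (startsLow_iff hb).2 h3, rfl, rfl, fun r z hz => by simpa using hz⟩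
      unfold pairFBar
      simp only
      rw [if_pos fun l hl => PLetter.lt_of_val_lt (h3 l hl)]
    | cons x t =>
      obtain ⟨m', p⟩ := x
      simp only [Option.some.injEq, Prod.mk.injEq] at hf
      obtain ⟨rfl, rfl⟩ := hf
      obtain ⟨h1, h2⟩ := List.pairwise_cons.1 h.1
      have hlt : m < m' := hd ⟨m', p⟩ (by simp)
      have ha : ValSorted (⟨m, p⟩ :: ⟨m', q⟩ :: t) := by
        refine List.pairwise_cons.2 ⟨fun l hl => ?_, List.pairwise_cons.2 ⟨h1, h2⟩⟩
        rcases List.mem_cons.1 hl with rfl | hl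
        · exact hlt
        · exact hlt.trans (h1 l hl)
      refine ⟨?_, ha, h4, (startsLow_iff ha).2 h3, rfl, rfl, fun r z hz => ?_⟩
      · unfold pairFBar
        simp only
        rw [if_pos fun l hl => PLetter.lt_of_val_lt (a := ⟨m, p⟩) (h3 l hl)]
      · exact (leads_one_shift hlt p q h1 (u ++ r) z).2 hz

end QPlus

namespace QPlus

open Equiv

/-! ### Existence of increasing factorizations -/

/-- The set that is counted by the involution code. -/
def codeSet (u : Perm ℤ) (i : ℤ) : Set ℤ := {j | u j ≤ i ∧ i < j ∧ u j < u i}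

theorem invCode_eq (u : Perm ℤ) (i : ℤ) : invCode u i = (codeSet u i).ncard := rfl

theorem mem_codeSet {u : Perm ℤ} {i j : ℤ} :
    j ∈ codeSet u i ↔ u j ≤ i ∧ i < j ∧ u j < u i := Iff.rfl

theorem codeSet_finite {u : Perm ℤ} (hf : (moved u).Finite) (i : ℤ) : (codeSet u i).Finite :=
  hf.subset fun j hj => by
    have := mem_codeSet.1 hj
    change u j ≠ j
    omega

theorem invCode_eq_zero_iff {u : Perm ℤ} (hf : (moved u).Finite) {i : ℤ} :
    invCode u i = 0 ↔ ∀ j, ¬ (u j ≤ i ∧ i < j ∧ u j < u i) := by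
  rw [invCode_eq, Set.ncard_eq_zero (codeSet_finite hf i), Set.eq_empty_iff_forall_notMem]
  rfl

/-- One step of the sweep: a zero of the code is moved to the left, past a descent. -/
theorem exists_unstep {u : Perm ℤ} (hu : Function.Involutive u) (hf : (moved u).Finite) {a : ℤ}
    (h0 : invCode u (a + 1) = 0) (hd : u (a + 1) < u a) :
    ∃ t : Perm ℤ, Function.Involutive t ∧ (moved t).Finite ∧ t a < t (a + 1) ∧ invStep t a = u ∧
      invCode t a = 0 ∧ invCode t (a + 1) + 1 = invCode u a ∧
      ∀ i, i ≠ a → i ≠ a + 1 → invCode t i = invCode u i := by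
  rw [invCode_eq_zero_iff hf] at h0
  -- Either `a`, `a + 1` form a 2-cycle, and the step to be undone is a commutation, or it is a
  -- conjugation.
  by_cases hc : u a = a + 1
  · have hc' : u (a + 1) = a := by rw [← hc, hu]
    have ta : (u * swap a (a + 1)) a = a := by simp [hc']
    have ta1 : (u * swap a (a + 1)) (a + 1) = a + 1 := by simp [hc]
    have tj : ∀ j, j ≠ a → j ≠ a + 1 → (u * swap a (a + 1)) j = u j := fun j h1 h2 => by
      rw [Perm.mul_apply, swap_apply_of_ne_of_ne h1 h2]
    have hft := moved_mul_swap_finite hf a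
    have hinj : ∀ j, j ≠ a → j ≠ a + 1 → u j ≠ a ∧ u j ≠ a + 1 := fun j h1 h2 =>
      ⟨fun e => h2 (by rw [← hu j, e, hc]), fun e => h1 (by rw [← hu j, e, hc'])⟩
    refine ⟨u * swap a (a + 1), ?_, hft, by omega, ?_, ?_, ?_, ?_⟩
    · intro j
      by_cases h1 : j = a
      · rw [h1, ta, ta]
      · by_cases h2 : j = a + 1
        · rw [h2, ta1, ta1]
        · have := hinj j h1 h2
          rw [tj j h1 h2, tj _ this.1 this.2, hu]
    · rw [invStep_of_fixed ⟨ta, ta1⟩, mul_assoc, swap_mul_self, mul_one]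
    · rw [invCode_eq_zero_iff hft]
      rintro j ⟨h1, h2, h3⟩
      by_cases h4 : j = a + 1
      · subst h4; omega
      · rw [tj j (by omega) h4] at h1 h3
        have := hinj j (by omega) h4
        exact h0 j ⟨by omega, by omega, by omega⟩
    · have e : codeSet u a = insert (a + 1) (codeSet (u * swap a (a + 1)) (a + 1)) := by
        ext j
        rw [Set.mem_insert_iff, mem_codeSet, mem_codeSet]
        by_cases h4 : j = a + 1
        · subst h4; omega
        · by_cases h5 : j = a
          · subst h5; omega
          · rw [tj j h5 h4]
            have := hinj j h5 h4
            omega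
      rw [invCode_eq, invCode_eq, e, Set.ncard_insert_of_notMem _ (codeSet_finite hft _)]
      rw [mem_codeSet]; omega
    · intro i h1 h2
      rw [invCode_eq, invCode_eq]
      congr 1
      ext j
      rw [mem_codeSet, mem_codeSet, tj i h1 h2]
      by_cases h4 : j = a + 1
      · subst h4; omega
      · by_cases h5 : j = a
        · subst h5; omega
        · rw [tj j h5 h4]
  · obtain ⟨p, hp⟩ : ∃ p, u (a + 1) = p := ⟨_, rfl⟩
    have hp' : u p = a + 1 := by rw [← hp, hu]
    -- If `p` exceeded `a`, then `u a` would be an element counted by the code at `a + 1`, which is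
    -- zero.
    have hpa : p < a := by
      have i1 : p ≠ a := fun e => hc (by rw [e] at hp'; exact hp')
      have h1 := h0 (u a)
      rw [hu, hp] at h1
      omega
    have hne : ∀ j, j ≠ p → u j ≠ a + 1 := fun j h1 e => h1 (by rw [← hu j, e, hp])
    have hne' : ∀ j, j ≠ a + 1 → u j ≠ p := fun j h1 e => h1 (by rw [← hu j, e, hp'])
    have tj : ∀ j, (swap a (a + 1) * u * swap a (a + 1)) j =
        swap a (a + 1) (u (swap a (a + 1) j)) := fun j => rfl
    have sp : swap a (a + 1) p = p := swap_apply_of_ne_of_ne (by omega) (by omega)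
    have ta : (swap a (a + 1) * u * swap a (a + 1)) a = p := by
      rw [tj, swap_apply_left, hp, sp]
    have ta1 : (swap a (a + 1) * u * swap a (a + 1)) (a + 1) = swap a (a + 1) (u a) := by
      rw [tj, swap_apply_right]
    have hft := moved_mul_swap_finite (moved_swap_mul_finite hf a) a
    have sua := swap_succ_cases a (u a)
    have hasc : (swap a (a + 1) * u * swap a (a + 1)) a <
        (swap a (a + 1) * u * swap a (a + 1)) (a + 1) := by
      rw [ta, ta1]; omega
    have hnf : ¬ FixedPair (swap a (a + 1) * u * swap a (a + 1)) a := by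
      rintro ⟨h1, -⟩; omega
    refine ⟨swap a (a + 1) * u * swap a (a + 1), ?_, hft, hasc, ?_, ?_, ?_, ?_⟩
    · intro j
      rw [tj, tj, swap_apply_self, hu, swap_apply_self]
    · rw [invStep_of_not_fixed hasc hnf]
      simp only [mul_assoc, swap_mul_self, mul_one]
      rw [← mul_assoc, swap_mul_self, one_mul]
    · rw [invCode_eq_zero_iff hft]
      rintro j ⟨h1, h2, h3⟩
      rw [ta] at h3
      by_cases h4 : j = a + 1
      · subst h4; omega
      · rw [tj, swap_apply_of_ne_of_ne (by omega) h4] at h1 h3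
        have := swap_succ_cases a (u j)
        exact h0 j ⟨by omega, by omega, by omega⟩
    -- Moving the code entry from `a` to `a + 1` loses exactly the element `a + 1`.
    · have e : codeSet u a =
          insert (a + 1) (codeSet (swap a (a + 1) * u * swap a (a + 1)) (a + 1)) := by
        ext j
        rw [Set.mem_insert_iff, mem_codeSet, mem_codeSet, ta1]
        by_cases h4 : j = a + 1
        · subst h4; omega
        · rw [tj]
          have c1 := swap_succ_cases a j
          by_cases h5 : a + 1 < j
          · have e1 : swap a (a + 1) j = j := by omega
            rw [e1, swap_succ_lt_iff]
            · have c2 := swap_succ_cases a (u j)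
              have := hne j (by omega)
              omega
            · have := hne j (by omega)
              omega
            · have := hne j (by omega)
              omega
          · omega
      rw [invCode_eq, invCode_eq, e, Set.ncard_insert_of_notMem _ (codeSet_finite hft _)]
      rw [mem_codeSet]; omega
    · intro i h1 h2
      rw [invCode_eq, invCode_eq]
      by_cases hi : i < a
      · have e : codeSet (swap a (a + 1) * u * swap a (a + 1)) i = swap a (a + 1) '' codeSet u i := by
          have key : ∀ j, swap a (a + 1) j ∈ codeSet (swap a (a + 1) * u * swap a (a + 1)) i ↔
              j ∈ codeSet u i := by
            intro j
            have si : swap a (a + 1) i = i := swap_apply_of_ne_of_ne h1 h2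
            rw [mem_codeSet, mem_codeSet, tj, tj, si, swap_apply_self]
            have c1 := swap_succ_cases a j
            have c2 := swap_succ_cases a (u j)
            have c3 := swap_succ_cases a (u i)
            omega
          ext j
          rw [Set.mem_image]
          constructor
          · intro hj
            refine ⟨swap a (a + 1) j, (key _).1 (by rwa [swap_apply_self]), swap_apply_self _ _ _⟩
          · rintro ⟨j, hj, rfl⟩
            exact (key j).2 hj
        rw [e, Set.ncard_image_of_injective _ (swap a (a + 1)).injective]
      · congr 1
        ext j
        have si : swap a (a + 1) i = i := swap_apply_of_ne_of_ne h1 h2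
        rw [mem_codeSet, mem_codeSet, tj, tj, si]
        by_cases hj : i < j
        · have sj : swap a (a + 1) j = j := swap_apply_of_ne_of_ne (by omega) (by omega)
          rw [sj, swap_succ_lt_iff]
          · have c2 := swap_succ_cases a (u j)
            omega
          · have := hne i (by omega)
            omega
          · have := hne j (by omega)
            omega
        · omega

/-- An element counted at `a` is not `a + 1`, because of the ascent, and would therefore be counted
at `a + 1` as well. -/
theorem invCode_eq_zero_of_ascent {u : Perm ℤ} (hf : (moved u).Finite) {a : ℤ}
    (h0 : invCode u (a + 1) = 0) (hd : u a < u (a + 1)) : invCode u a = 0 := by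
  rw [invCode_eq_zero_iff hf] at h0 ⊢
  rintro j ⟨h1, h2, h3⟩
  by_cases hj : j = a + 1
  · subst hj; omega
  · exact h0 j ⟨by omega, by omega, by omega⟩

/-- An increasing word can be split off from the end of a word for `z` so that the entries of the
code that are not zero decrease. -/
theorem exists_peel {z : Perm ℤ} (hz : Function.Involutive z) (hf : (moved z).Finite) {m : ℕ}
    (hm : ∀ i, invCode z i ≤ m + 1) :
    ∃ (u : Perm ℤ) (w : List ℤ), Function.Involutive u ∧ (moved u).Finite ∧ Ascending u w ∧
      act u w = z ∧ w.Pairwise (· < ·) ∧ ∀ i, invCode u i ≤ m := by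
  obtain ⟨A, hA⟩ := hf.bddBelow
  obtain ⟨B, hB⟩ := hf.bddAbove
  -- The invariant when the sweep has reached `B - k`: the code vanishes there, is already at most
  -- `m` to the right, and is still that of `z` to the left. Letters are added at the front in
  -- decreasing order, so the word increases.
  have sweep : ∀ k : ℕ, ∃ (u : Perm ℤ) (w : List ℤ), Function.Involutive u ∧ (moved u).Finite ∧
      Ascending u w ∧ act u w = z ∧ w.Pairwise (· < ·) ∧ (∀ x ∈ w, B - k ≤ x) ∧
      invCode u (B - k) = 0 ∧ (∀ i, B - k < i → invCode u i ≤ m) ∧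
      ∀ i, i < B - k → invCode u i = invCode z i := by
    intro k
    induction k with
    | zero =>
      have hB0 : ∀ i, B ≤ i → invCode z i = 0 := by
        intro i hi
        rw [invCode_eq_zero_iff hf]
        rintro j ⟨h1, h2, h3⟩
        have := hB (show j ∈ moved z by change z j ≠ j; omega)
        omega
      refine ⟨z, [], hz, hf, trivial, rfl, List.Pairwise.nil, by simp, hB0 _ (by simp), ?_,
        fun i _ => rfl⟩
      intro i hi
      rw [hB0 i (by push_cast at hi; omega)]
      omega
    | succ k ih =>
      obtain ⟨u, w, h1, h2, h3, h4, h5, h6, h7, h8, h9⟩ := ih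
      obtain ⟨a, ha⟩ : ∃ a, a = B - k - 1 := ⟨_, rfl⟩
      have ha' : B - ((k + 1 : ℕ) : ℤ) = a := by push_cast; omega
      have hk : B - (k : ℤ) = a + 1 := by omega
      rw [ha']
      rw [hk] at h6 h7 h8 h9
      rcases lt_trichotomy (u a) (u (a + 1)) with hd | hd | hd
      · refine ⟨u, w, h1, h2, h3, h4, h5, fun x hx => by have := h6 x hx; omega,
          invCode_eq_zero_of_ascent h2 h7 hd, fun i hi => ?_, fun i hi => h9 i (by omega)⟩
        by_cases hi' : i = a + 1
        · rw [hi', h7]; omega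
        · exact h8 i (by omega)
      · exact absurd (u.injective hd) (by omega)
      · obtain ⟨t, t1, t2, t3, t4, t5, t6, t7⟩ := exists_unstep h1 h2 h7 hd
        refine ⟨t, a :: w, t1, t2, ⟨t3, by rwa [t4]⟩, ?_, ?_, ?_, t5, fun i hi => ?_,
          fun i hi => ?_⟩
        · simp only [act, List.foldl_cons]
          rw [t4]; exact h4
        · exact List.pairwise_cons.2 ⟨fun x hx => by have := h6 x hx; omega, h5⟩
        · intro x hx
          rcases List.mem_cons.1 hx with rfl | hx
          · exact le_rfl
          · have := h6 x hx; omega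
        · by_cases hi' : i = a + 1
          · have := hm a
            rw [hi']
            rw [h9 a (by omega)] at t6
            omega
          · rw [t7 i (by omega) hi']
            exact h8 i (by omega)
        · rw [t7 i (by omega) (by omega)]
          exact h9 i (by omega)
  obtain ⟨u, w, h1, h2, h3, h4, h5, h6, h7, h8, h9⟩ := sweep (B - A).toNat
  refine ⟨u, w, h1, h2, h3, h4, h5, fun i => ?_⟩
  rcases lt_trichotomy i (B - ((B - A).toNat : ℤ)) with hi | hi | hi
  · rw [h9 i hi]
    have : invCode z i = 0 := by
      rw [invCode_eq_zero_iff hf]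
      rintro j ⟨k1, k2, k3⟩
      have := hA (show z j ∈ moved z by change z (z j) ≠ z j; rw [hz]; omega)
      omega
    omega
  · rw [hi, h7]; omega
  · exact h8 i hi

/-- If `z j < j`, then `j` is counted by the code at `z j`. -/
theorem eq_one_of_invCode_eq_zero {z : Perm ℤ} (hz : Function.Involutive z) (hf : (moved z).Finite)
    (h : ∀ i, invCode z i = 0) : z = 1 := by
  have key : ∀ j, ¬ z j < j := by
    intro j hj
    refine (invCode_eq_zero_iff hf).1 (h (z j)) j ⟨le_rfl, hj, ?_⟩
    rwa [hz]
  ext j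
  rw [Perm.one_apply]
  have h1 := key j
  have h2 := key (z j)
  rw [hz] at h2
  omega

theorem ascending_append {u : Perm ℤ} {a b : List ℤ} :
    Ascending u (a ++ b) ↔ Ascending u a ∧ Ascending (act u a) b := by
  induction a generalizing u with
  | nil => simp [Ascending, act]
  | cons x a ih => simp [Ascending, ih, act, and_assoc]

theorem exists_rows {z : Perm ℤ} (hz : Function.Involutive z) (hf : (moved z).Finite) {n : ℕ}
    (hn : ∀ i, invCode z i ≤ n) :
    ∃ r : List (List ℤ), r.length = n ∧ (∀ w ∈ r, w.Pairwise (· < ·)) ∧ Ascending 1 r.flatten ∧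
      act 1 r.flatten = z := by
  induction n generalizing z with
  | zero =>
    refine ⟨[], rfl, by simp, trivial, ?_⟩
    exact (eq_one_of_invCode_eq_zero hz hf fun i => by have := hn i; omega).symm
  | succ n ih =>
    obtain ⟨u, w, h1, h2, h3, h4, h5, h6⟩ := exists_peel hz hf hn
    obtain ⟨r, r1, r2, r3, r4⟩ := ih h1 h2 h6
    refine ⟨r ++ [w], by simp [r1], ?_, ?_, ?_⟩
    · intro v hv
      rcases List.mem_append.1 hv with hv | hv
      · exact r2 v hv
      · rw [List.mem_singleton.1 hv]; exact h5
    · rw [List.flatten_append, ascending_append, r4]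
      exact ⟨r3, by simpa using h3⟩
    · rw [List.flatten_append]
      have : act 1 (r.flatten ++ [w].flatten) = act (act 1 r.flatten) w := by
        simp [act]
      rw [this, r4, h4]

/-- An entry `c` of the code makes the first `c` parts of the transposed partition nonzero. -/
theorem invCode_le {z : Perm ℤ} (hf : (moved z).Finite) (hz : Function.Involutive z) {n : ℕ}
    (hn : invShapeLength z ≤ n) (i : ℤ) : invCode z i ≤ n := by
  obtain ⟨A, hA⟩ := hf.bddBelow
  obtain ⟨B, hB⟩ := hf.bddAbove
  have hsupp : ∀ i, invCode z i ≠ 0 → i ∈ Set.Icc A B := by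
    intro i hi
    by_contra hc
    apply hi
    rw [invCode_eq_zero_iff hf]
    rintro j ⟨k1, k2, k3⟩
    have h1 := hA (show z j ∈ moved z by change z (z j) ≠ z j; rw [hz]; omega)
    have h2 := hB (show j ∈ moved z by change z j ≠ j; omega)
    exact hc ⟨by omega, by omega⟩
  have hfin : ∀ k : ℕ, {i : ℤ | k + 1 ≤ invCode z i}.Finite := fun k =>
    (Set.finite_Icc A B).subset fun i (hi : k + 1 ≤ invCode z i) => hsupp i (by omega)
  have hiff : ∀ k : ℕ, invShape z k ≠ 0 ↔ ∃ i, k + 1 ≤ invCode z i := by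
    intro k
    unfold invShape
    rw [Ne, Set.ncard_eq_zero (hfin k), ← Ne, ← Set.nonempty_iff_ne_empty]
    rfl
  -- Finiteness is needed because `Set.ncard` is 0 on infinite sets, so the cardinality comparison
  -- below would otherwise fail.
  have hbound : {k : ℕ | invShape z k ≠ 0}.Finite := by
    apply ((Set.finite_Icc A B).biUnion (t := fun i => Set.Iio (invCode z i))
      fun i _ => Set.finite_Iio _).subset
    intro k hk
    obtain ⟨i, hi⟩ := (hiff k).1 hk
    exact Set.mem_biUnion (hsupp i (by omega)) (show k < invCode z i by omega)
  have hsub : (Finset.range (invCode z i) : Set ℕ) ⊆ {k : ℕ | invShape z k ≠ 0} := by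
    intro k hk
    have : k < invCode z i := by simpa using hk
    exact (hiff k).2 ⟨i, this⟩
  have := Set.ncard_le_ncard hsub hbound
  rw [Set.ncard_coe_finset, Finset.card_range] at this
  exact this.trans hn

theorem incr_nonempty {n : ℕ} {z : Perm ℤ} (hf : (moved z).Finite) (hz : Function.Involutive z)
    (hn : invShapeLength z ≤ n) : (Incr n z).Nonempty := by
  obtain ⟨r, rfl, r2, r3, r4⟩ := exists_rows hz hf (invCode_le hf hz hn)
  refine ⟨fun i => (r.get i).map fun x => ⟨x, false⟩, fun i => ?_, ?_⟩
  · rw [List.pairwise_map]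
    exact (r2 _ (List.get_mem r i)).imp fun h => PLetter.lt_of_val_lt h
  · rw [isPrimedInvWord_iff, leads_iff]
    have e : (List.ofFn fun i => (r.get i).map fun x => (⟨x, false⟩ : PLetter)).flatten =
        r.flatten.map fun x => ⟨x, false⟩ := by
      rw [List.map_flatten]
      congr 1
      apply List.ext_get
      · simp
      · intro k h1 h2
        simp
    have e2 : unprime (r.flatten.map fun x => (⟨x, false⟩ : PLetter)) = r.flatten := by
      unfold unprime
      rw [List.map_map]
      exact List.map_id _
    rw [e, e2]
    refine ⟨r3, r4, fun k hk hp => ?_⟩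
    rw [List.getElem_map] at hp
    exact absurd hp Bool.false_ne_true

end QPlus

namespace QPlus

open Equiv

/-! ### String lengths -/

theorem iter_ne_none_iff {B : Type*} {g : B → Option B} {N : B → ℕ}
    (h0 : ∀ b, g b = none ↔ N b = 0) (h1 : ∀ b c, g b = some c → N b = N c + 1) (b : B) (k : ℕ) :
    (iter g k b ≠ none ↔ k ≤ N b) ∧ ∀ c, iter g k b = some c → N c + k = N b := by
  induction k with
  | zero =>
    refine ⟨by simp [iter], fun c hc => ?_⟩
    simp only [iter, Option.some.injEq] at hc
    rw [hc]; rfl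
  | succ k ih =>
    obtain ⟨ih1, ih2⟩ := ih
    cases hk : iter g k b with
    | none =>
      have : ¬ k ≤ N b := fun h => (ih1.2 h) hk
      refine ⟨⟨fun h => by simp [iter, hk] at h, fun h => by omega⟩, fun c hc => by
        simp [iter, hk] at hc⟩
    | some d =>
      have hd := ih2 d hk
      have e : iter g (k + 1) b = g d := by simp [iter, hk]
      rw [e]
      refine ⟨?_, fun c hc => by have := h1 d c hc; omega⟩
      rw [Ne, h0 d]
      omega

/-- A statistic that drops by one under `g` and vanishes exactly where `g` is undefined counts the
possible applications of `g`. -/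
theorem strLen_eq {B : Type*} {g : B → Option B} {N : B → ℕ}
    (h0 : ∀ b, g b = none ↔ N b = 0) (h1 : ∀ b c, g b = some c → N b = N c + 1) (b : B) :
    strLen g b = N b := by
  unfold strLen
  apply le_antisymm
  · refine iSup_le fun k => iSup_le fun hk => ?_
    exact_mod_cast ((iter_ne_none_iff h0 h1 b k).1).1 hk
  · exact le_iSup₂_of_le (N b) (((iter_ne_none_iff h0 h1 b (N b)).1).2 le_rfl) le_rfl

/-- An operator that can be applied at most once has string lengths at most one. -/
theorem strLen_eq_ite {B : Type*} {g : B → Option B} (h : ∀ b c, g b = some c → g c = none)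
    (b : B) : strLen g b = (if g b = none then 0 else 1 : ℕ) := by
  refine strLen_eq (N := fun b => if g b = none then 0 else 1) (fun b => ?_) (fun b c hc => ?_) b
  · split_ifs with hb <;> simp [hb]
  · rw [if_neg (by rw [hc]; simp), if_pos (h b c hc)]

/-! ### Operators on the rows of a factorization -/

/-- Apply an operator on pairs of rows to the rows `i` and `j`. -/
def onPair {n : ℕ} (i j : Fin n)
    (g : List PLetter → List PLetter → Option (List PLetter × List PLetter))
    (a : Fin n → List PLetter) : Option (Fin n → List PLetter) :=
  (g (a i) (a j)).map fun p => setTwo a i j p.1 p.2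

/-- Apply an operator on words to the row `i`. -/
def onRow {n : ℕ} (i : Fin n) (g : List PLetter → Option (List PLetter))
    (a : Fin n → List PLetter) : Option (Fin n → List PLetter) :=
  (g (a i)).map fun v => Function.update a i v

theorem onPair_eq_some_iff {n : ℕ} {i j : Fin n}
    {g : List PLetter → List PLetter → Option (List PLetter × List PLetter)}
    {a b : Fin n → List PLetter} :
    onPair i j g a = some b ↔ ∃ v w, g (a i) (a j) = some (v, w) ∧ b = setTwo a i j v w := by
  simp [onPair, eq_comm]

theorem onRow_eq_some_iff {n : ℕ} {i : Fin n} {g : List PLetter → Option (List PLetter)}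
    {a b : Fin n → List PLetter} :
    onRow i g a = some b ↔ ∃ v, g (a i) = some v ∧ b = Function.update a i v := by
  simp [onRow, eq_comm]

section setTwo

variable {n : ℕ} {a : Fin n → List PLetter} {i j : Fin n} {v w : List PLetter}

theorem setTwo_snd : setTwo a i j v w j = w := by simp [setTwo]

theorem setTwo_fst (hij : i ≠ j) : setTwo a i j v w i = v := by
  simp [setTwo, Function.update_of_ne hij]

theorem setTwo_other {k : Fin n} (hi : k ≠ i) (hj : k ≠ j) : setTwo a i j v w k = a k := by
  simp [setTwo, Function.update_of_ne hi, Function.update_of_ne hj]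

theorem setTwo_self : setTwo a i j (a i) (a j) = a := by
  simp [setTwo]

theorem setTwo_setTwo (hij : i ≠ j) (v' w' : List PLetter) :
    setTwo (setTwo a i j v w) i j v' w' = setTwo a i j v' w' := by
  funext k
  by_cases hj : k = j
  · rw [hj, setTwo_snd, setTwo_snd]
  · by_cases hi : k = i
    · rw [hi, setTwo_fst hij, setTwo_fst hij]
    · rw [setTwo_other hi hj, setTwo_other hi hj, setTwo_other hi hj]

end setTwo

theorem onPair_inverse {n : ℕ} {i j : Fin n} (hij : i ≠ j)
    {g h : List PLetter → List PLetter → Option (List PLetter × List PLetter)}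
    {a b : Fin n → List PLetter}
    (hgh : ∀ v w, g (a i) (a j) = some (v, w) → h v w = some (a i, a j))
    (hb : onPair i j g a = some b) : onPair i j h b = some a := by
  obtain ⟨v, w, h1, rfl⟩ := onPair_eq_some_iff.1 hb
  rw [onPair_eq_some_iff]
  refine ⟨a i, a j, ?_, ?_⟩
  · rw [setTwo_fst hij, setTwo_snd, hgh v w h1]
  · rw [setTwo_setTwo hij, setTwo_self]

theorem onPair_comm {n : ℕ} {i j k l : Fin n} (h1 : i ≠ k) (h2 : i ≠ l) (h3 : j ≠ k) (h4 : j ≠ l)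
    (g h : List PLetter → List PLetter → Option (List PLetter × List PLetter))
    (a : Fin n → List PLetter) :
    (onPair i j g a).bind (onPair k l h) = (onPair k l h a).bind (onPair i j g) := by
  have e1 : ∀ v w, onPair k l h (setTwo a i j v w) =
      (h (a k) (a l)).map fun p => setTwo (setTwo a i j v w) k l p.1 p.2 := fun v w => by
    rw [onPair, setTwo_other h1.symm h3.symm, setTwo_other h2.symm h4.symm]
  have e2 : ∀ v w, onPair i j g (setTwo a k l v w) =
      (g (a i) (a j)).map fun p => setTwo (setTwo a k l v w) i j p.1 p.2 := fun v w => by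
    rw [onPair, setTwo_other h1 h2, setTwo_other h3 h4]
  rw [onPair, onPair]
  cases hg : g (a i) (a j) with
  | none =>
    cases hh : h (a k) (a l) with
    | none => simp
    | some q => simp [e2, hg]
  | some p =>
    cases hh : h (a k) (a l) with
    | none => simp [e1, hh]
    | some q =>
      simp only [Option.map_some, Option.bind_some, e1, e2, hg, hh, Option.some.injEq]
      funext m
      simp only [setTwo, Function.update_apply]
      split_ifs <;> simp_all

theorem onPair_onRow_comm {n : ℕ} {i j k : Fin n} (h1 : i ≠ k) (h3 : j ≠ k)
    (g : List PLetter → List PLetter → Option (List PLetter × List PLetter))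
    (h : List PLetter → Option (List PLetter)) (a : Fin n → List PLetter) :
    (onPair i j g a).bind (onRow k h) = (onRow k h a).bind (onPair i j g) := by
  have e1 : ∀ v w, onRow k h (setTwo a i j v w) =
      (h (a k)).map fun p => Function.update (setTwo a i j v w) k p := fun v w => by
    rw [onRow, setTwo_other h1.symm h3.symm]
  have e2 : ∀ v, onPair i j g (Function.update a k v) =
      (g (a i) (a j)).map fun p => setTwo (Function.update a k v) i j p.1 p.2 := fun v => by
    rw [onPair, Function.update_of_ne h1, Function.update_of_ne h3]
  rw [onPair, onRow]
  cases hg : g (a i) (a j) with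
  | none =>
    cases hh : h (a k) with
    | none => simp
    | some q => simp [e2, hg]
  | some p =>
    cases hh : h (a k) with
    | none => simp [e1, hh]
    | some q =>
      simp only [Option.map_some, Option.bind_some, e1, e2, hg, hh, Option.some.injEq]
      funext m
      simp only [setTwo, Function.update_apply]
      split_ifs <;> simp_all

/-! ### The word of a factorization -/

/-- The same prefix and suffix serve for all replacements of the two rows. That the prefix is empty
for `i = 0` is what lets the queer operators start from the identity. -/
theorem exists_flatten_setTwo {n : ℕ} (a : Fin n → List PLetter) (i j : Fin n)
    (h : j.1 = i.1 + 1) : ∃ A C : List PLetter, (i.1 = 0 → A = []) ∧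
      ∀ v w, (List.ofFn (setTwo a i j v w)).flatten = A ++ (v ++ (w ++ C)) := by
  induction n with
  | zero => exact i.elim0
  | succ n ih =>
    obtain ⟨i, hi⟩ := i
    obtain ⟨j, hj⟩ := j
    simp only at h
    subst h
    cases i with
    | zero =>
      cases n with
      | zero => omega
      | succ n =>
        refine ⟨[], (List.ofFn fun k : Fin n => a k.succ.succ).flatten, fun _ => rfl, fun v w => ?_⟩
        rw [List.ofFn_succ, List.ofFn_succ]
        have e0 : setTwo a ⟨0, hi⟩ ⟨0 + 1, hj⟩ v w 0 = v :=
          setTwo_fst (by simp)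
        have e1 : setTwo a ⟨0, hi⟩ ⟨0 + 1, hj⟩ v w (Fin.succ 0) = w := setTwo_snd
        have e2 : (fun k : Fin n => setTwo a ⟨0, hi⟩ ⟨0 + 1, hj⟩ v w k.succ.succ) =
            fun k => a k.succ.succ := by
          funext k
          refine setTwo_other ?_ ?_ <;> simp [Fin.ext_iff]
        rw [e0, e1, e2]
        simp
    | succ i =>
      obtain ⟨A, C, -, h2⟩ := ih (fun k => a k.succ) ⟨i, by omega⟩ ⟨i + 1, by omega⟩ rfl
      refine ⟨a 0 ++ A, C, fun h => by simp at h, fun v w => ?_⟩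
      rw [List.ofFn_succ]
      have e0 : setTwo a ⟨i + 1, hi⟩ ⟨i + 1 + 1, hj⟩ v w 0 = a 0 := by
        refine setTwo_other ?_ ?_ <;> simp [Fin.ext_iff]
      have e2 : (fun k : Fin n => setTwo a ⟨i + 1, hi⟩ ⟨i + 1 + 1, hj⟩ v w k.succ) =
          setTwo (fun k => a k.succ) ⟨i, by omega⟩ ⟨i + 1, by omega⟩ v w := by
        funext k
        simp only [setTwo, Function.update_apply, Fin.ext_iff, Fin.val_succ, Nat.add_right_cancel_iff]
      rw [e0, e2, List.flatten_cons, h2]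
      simp

theorem exists_flatten_update {n : ℕ} (h : 1 ≤ n) (a : Fin n → List PLetter) :
    ∃ C : List PLetter,
      ∀ v, (List.ofFn (Function.update a (fstIdx h) v)).flatten = v ++ C := by
  cases n with
  | zero => omega
  | succ n =>
    refine ⟨(List.ofFn fun k : Fin n => a k.succ).flatten, fun v => ?_⟩
    rw [List.ofFn_succ]
    have e0 : Function.update a (fstIdx h) v 0 = v := by
      have : fstIdx h = 0 := rfl
      rw [this]; simp
    have e2 : (fun k : Fin n => Function.update a (fstIdx h) v k.succ) = fun k => a k.succ := by
      funext k
      refine Function.update_of_ne ?_ _ _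
      simp [fstIdx, Fin.ext_iff]
    rw [e0, e2]
    simp

theorem mem_incr_iff {n : ℕ} {z : Perm ℤ} {a : Fin n → List PLetter} :
    a ∈ Incr n z ↔ (∀ i, (a i).Pairwise (· < ·)) ∧ Leads 1 (List.ofFn a).flatten z := by
  rw [← isPrimedInvWord_iff]; rfl

theorem rowPair_of_incr {n : ℕ} {z : Perm ℤ} {a : Fin n → List PLetter} (ha : a ∈ Incr n z)
    {i j : Fin n} (h : j.1 = i.1 + 1) : RowPair (a i) (a j) := by
  obtain ⟨h1, h2⟩ := mem_incr_iff.1 ha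
  obtain ⟨A, C, -, h4⟩ := exists_flatten_setTwo a i j h
  have h5 := h4 (a i) (a j)
  rw [setTwo_self] at h5
  rw [h5, ← List.append_assoc (a i)] at h2
  obtain ⟨u, k1, k2⟩ := leads_append.1 h2
  obtain ⟨t, k3, -⟩ := leads_append.1 k2
  have hu := k1.involutive one_involutive
  obtain ⟨s, k4, k5⟩ := leads_append.1 k3
  exact ⟨valSorted_of_leads hu (h1 i) k4, valSorted_of_leads (k4.involutive hu) (h1 j) k5,
    u, t, hu, k3⟩

theorem firstRows_of_incr {n : ℕ} {z : Perm ℤ} {a : Fin n → List PLetter} (ha : a ∈ Incr n z)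
    {i j : Fin n} (hi : i.1 = 0) (hj : j.1 = 1) : FirstRows (a i) (a j) := by
  obtain ⟨hv, hw, -⟩ := rowPair_of_incr ha (i := i) (j := j) (by omega)
  obtain ⟨h1, h2⟩ := mem_incr_iff.1 ha
  obtain ⟨A, C, h3, h4⟩ := exists_flatten_setTwo a i j (by omega)
  have h5 := h4 (a i) (a j)
  rw [setTwo_self, h3 hi] at h5
  rw [h5, List.nil_append, ← List.append_assoc] at h2
  obtain ⟨t, k3, -⟩ := leads_append.1 h2
  exact ⟨hv, hw, t, k3⟩

theorem setTwo_mem_incr {n : ℕ} {z : Perm ℤ} {a : Fin n → List PLetter} (ha : a ∈ Incr n z)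
    {i j : Fin n} (h : j.1 = i.1 + 1) {v w : List PLetter} (hv : ValSorted v) (hw : ValSorted w)
    (hl : ∀ u t : Perm ℤ, Function.Involutive u → (i.1 = 0 → u = 1) → ∀ r : List PLetter,
      Leads u (a i ++ (a j ++ r)) t → Leads u (v ++ (w ++ r)) t) :
    setTwo a i j v w ∈ Incr n z := by
  obtain ⟨h1, h2⟩ := mem_incr_iff.1 ha
  rw [mem_incr_iff]
  constructor
  · intro k
    by_cases hj : k = j
    · rw [hj, setTwo_snd]; exact hw.sorted
    · by_cases hi : k = i
      · rw [hi, setTwo_fst (by rw [Ne, Fin.ext_iff]; omega)]; exact hv.sorted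
      · rw [setTwo_other hi hj]; exact h1 k
  · obtain ⟨A, C, h3, h4⟩ := exists_flatten_setTwo a i j h
    have h5 := h4 (a i) (a j)
    rw [setTwo_self] at h5
    rw [h5] at h2
    rw [h4]
    obtain ⟨u, k1, k2⟩ := leads_append.1 h2
    refine leads_append.2 ⟨u, k1, hl u z (k1.involutive one_involutive) (fun hi => ?_) C k2⟩
    rw [h3 hi] at k1
    exact k1.symm

theorem high_val {n : ℕ} (i : Fin (n - 1)) : (high i).1 = (low i).1 + 1 := rfl

theorem low_ne_high {n : ℕ} (i : Fin (n - 1)) : low i ≠ high i := by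
  rw [Ne, Fin.ext_iff, high_val]; omega

theorem incrF_mem {n : ℕ} {z : Perm ℤ} {i : Fin (n - 1)} {a b : Fin n → List PLetter}
    (ha : a ∈ Incr n z) (hb : incrF i a = some b) : b ∈ Incr n z := by
  rw [incrF_eq] at hb
  obtain ⟨v, w, h1, rfl⟩ := onPair_eq_some_iff.1 hb
  obtain ⟨s, e1, e2, rfl, rfl, -⟩ := exists_slide_of_pairF (rowPair_of_incr ha (high_val i)) h1
  refine setTwo_mem_incr ha (high_val i) s.sorted_v' s.sorted_w' fun u t hu _ r => ?_
  rw [← e1, ← e2, ← List.append_assoc, ← List.append_assoc, leads_append, leads_append]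
  exact fun ⟨y, k1, k2⟩ => ⟨y, (s.leads_iff hu).1 k1, k2⟩

theorem incrE_mem {n : ℕ} {z : Perm ℤ} {i : Fin (n - 1)} {a b : Fin n → List PLetter}
    (ha : a ∈ Incr n z) (hb : incrE i a = some b) : b ∈ Incr n z := by
  rw [incrE_eq] at hb
  obtain ⟨v, w, h1, rfl⟩ := onPair_eq_some_iff.1 hb
  obtain ⟨s, rfl, rfl, e1, e2, -⟩ := exists_slide_of_pairE (rowPair_of_incr ha (high_val i)) h1
  refine setTwo_mem_incr ha (high_val i) s.sorted_v s.sorted_w fun u t hu _ r => ?_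
  rw [← e1, ← e2, ← List.append_assoc, ← List.append_assoc, leads_append, leads_append]
  exact fun ⟨y, k1, k2⟩ => ⟨y, (s.leads_iff hu).2 k1, k2⟩

theorem incrFBar_mem {n : ℕ} {z : Perm ℤ} {h : 2 ≤ n} {a b : Fin n → List PLetter}
    (ha : a ∈ Incr n z) (hb : incrFBar h a = some b) : b ∈ Incr n z := by
  rw [incrFBar_eq] at hb
  obtain ⟨v, w, h1, rfl⟩ := onPair_eq_some_iff.1 hb
  obtain ⟨-, k1, k2, -, -, -, k3⟩ := pairFBar_spec (firstRows_of_incr ha rfl rfl) h1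
  refine setTwo_mem_incr ha rfl k1 k2 fun u t _ hu r => ?_
  rw [hu rfl]
  exact k3 r t

theorem incrEBar_mem {n : ℕ} {z : Perm ℤ} {h : 2 ≤ n} {a b : Fin n → List PLetter}
    (ha : a ∈ Incr n z) (hb : incrEBar h a = some b) : b ∈ Incr n z := by
  rw [incrEBar_eq] at hb
  obtain ⟨v, w, h1, rfl⟩ := onPair_eq_some_iff.1 hb
  obtain ⟨-, k1, k2, -, -, -, k3⟩ := pairEBar_spec (firstRows_of_incr ha rfl rfl) h1
  refine setTwo_mem_incr ha rfl k1 k2 fun u t _ hu r => ?_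
  rw [hu rfl]
  exact k3 r t

/-- The operator `f_0` on the first row. -/
def rowF0 (v : List PLetter) : Option (List PLetter) :=
  match v with
  | [] => none
  | x :: u => if x.primed = true then none else some (⟨x.val, true⟩ :: u)

/-- The operator `e_0` on the first row. -/
def rowE0 (v : List PLetter) : Option (List PLetter) :=
  match v with
  | [] => none
  | x :: u => if x.primed = true then some (⟨x.val, false⟩ :: u) else none

theorem incrF0_eq {n : ℕ} (h : 1 ≤ n) (a : Fin n → List PLetter) :
    incrF0 h a = onRow (fstIdx h) rowF0 a := by
  unfold incrF0 onRow rowF0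
  cases a (fstIdx h) with
  | nil => rfl
  | cons x u => simp only; split_ifs <;> rfl

theorem incrE0_eq {n : ℕ} (h : 1 ≤ n) (a : Fin n → List PLetter) :
    incrE0 h a = onRow (fstIdx h) rowE0 a := by
  unfold incrE0 onRow rowE0
  cases a (fstIdx h) with
  | nil => rfl
  | cons x u => simp only; split_ifs <;> rfl

theorem rowF0_eq_some_iff {v w : List PLetter} :
    rowF0 v = some w ↔ ∃ m u, v = ⟨m, false⟩ :: u ∧ w = ⟨m, true⟩ :: u := by
  cases v with
  | nil => simp [rowF0]
  | cons x u =>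
    obtain ⟨m, p⟩ := x
    cases p <;> simp [rowF0, eq_comm]

theorem rowE0_eq_some_iff {v w : List PLetter} :
    rowE0 v = some w ↔ ∃ m u, v = ⟨m, true⟩ :: u ∧ w = ⟨m, false⟩ :: u := by
  cases v with
  | nil => simp [rowE0]
  | cons x u =>
    obtain ⟨m, p⟩ := x
    cases p <;> simp [rowE0, eq_comm]

/-- The letter is the first of the whole word, hence a commutation, and may carry a prime or not. -/
theorem update_head_mem_incr {n : ℕ} {z : Perm ℤ} (h : 1 ≤ n) {a : Fin n → List PLetter}
    (ha : a ∈ Incr n z) {m : ℤ} {p : Bool} {u : List PLetter} (e : a (fstIdx h) = ⟨m, p⟩ :: u)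
    (q : Bool) : Function.update a (fstIdx h) (⟨m, q⟩ :: u) ∈ Incr n z := by
  obtain ⟨h1, h2⟩ := mem_incr_iff.1 ha
  obtain ⟨C, h4⟩ := exists_flatten_update h a
  have h5 := h4 (a (fstIdx h))
  rw [Function.update_eq_self, e, List.cons_append] at h5
  rw [h5] at h2
  have hs : ValSorted (a (fstIdx h)) := by
    rw [← List.cons_append] at h2
    obtain ⟨t, k1, -⟩ := leads_append.1 h2
    exact valSorted_of_leads one_involutive (h1 _) (e ▸ k1)
  rw [e] at hs
  rw [mem_incr_iff]
  constructor
  · intro k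
    by_cases hk : k = fstIdx h
    · subst hk
      rw [Function.update_self]
      exact ValSorted.sorted (v := ⟨m, q⟩ :: u)
        (List.pairwise_cons.2 ⟨(List.pairwise_cons.1 hs).1, (List.pairwise_cons.1 hs).2⟩)
    · rw [Function.update_of_ne hk]; exact h1 k
  · rw [h4]
    exact ⟨h2.1, fun _ => fixedPair_one m, h2.2.2⟩

theorem incrF0_mem {n : ℕ} {z : Perm ℤ} {h : 1 ≤ n} {a b : Fin n → List PLetter}
    (ha : a ∈ Incr n z) (hb : incrF0 h a = some b) : b ∈ Incr n z := by
  rw [incrF0_eq] at hb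
  obtain ⟨v, h1, rfl⟩ := onRow_eq_some_iff.1 hb
  obtain ⟨m, u, e, rfl⟩ := rowF0_eq_some_iff.1 h1
  exact update_head_mem_incr h ha e true

theorem incrE0_mem {n : ℕ} {z : Perm ℤ} {h : 1 ≤ n} {a b : Fin n → List PLetter}
    (ha : a ∈ Incr n z) (hb : incrE0 h a = some b) : b ∈ Incr n z := by
  rw [incrE0_eq] at hb
  obtain ⟨v, h1, rfl⟩ := onRow_eq_some_iff.1 hb
  obtain ⟨m, u, e, rfl⟩ := rowE0_eq_some_iff.1 h1
  exact update_head_mem_incr h ha e false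

/-! ### Restricting operators to a subset -/

/-- The restriction of a partial operator to a set that it preserves. -/
def restrictOp {α : Type*} {S : Set α} (g : α → Option α)
    (hg : ∀ a ∈ S, ∀ b, g a = some b → b ∈ S) (a : S) : Option S :=
  (g a.1).pmap (fun b hb => ⟨b, hb⟩) fun b hb => hg a.1 a.2 b hb

section restrictOp

variable {α : Type*} {S : Set α} {g h : α → Option α}
  {hg : ∀ a ∈ S, ∀ b, g a = some b → b ∈ S}

theorem map_restrictOp (a : S) : (restrictOp g hg a).map Subtype.val = g a.1 := by
  unfold restrictOp
  rw [Option.map_pmap]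
  simp

theorem eq_some_iff_of_map {o : Option S} {r : Option α} (h : o.map Subtype.val = r) {b : S} :
    o = some b ↔ r = some b.1 := by
  rw [← h, Option.map_eq_some_iff]
  constructor
  · rintro rfl
    exact ⟨b, rfl, rfl⟩
  · rintro ⟨c, rfl, e⟩
    rw [Subtype.ext e]

theorem eq_none_iff_of_map {o : Option S} {r : Option α} (h : o.map Subtype.val = r) :
    o = none ↔ r = none := by
  rw [← h, Option.map_eq_none_iff]

theorem opsCommute_of_map {G H : S → Option S} (hG : ∀ a, (G a).map Subtype.val = g a.1)
    (hH : ∀ a, (H a).map Subtype.val = h a.1) (comm : ∀ a, (g a).bind h = (h a).bind g) :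
    OpsCommute G H := by
  intro a
  have key : ∀ {g h : α → Option α} {G H : S → Option S}, (∀ a, (G a).map Subtype.val = g a.1) →
      (∀ a, (H a).map Subtype.val = h a.1) →
      ((G a).bind H).map Subtype.val = (g a.1).bind h := by
    intro g h G H hG hH
    rw [← hG a]
    cases G a with
    | none => rfl
    | some b => exact hH b
  refine Option.map_injective Subtype.val_injective ?_
  rw [key hG hH, key hH hG, comm]

end restrictOp

end QPlus

/-! ### The crystal structure on increasing factorizations -/

namespace QPlus

open Equiv

/-- Increasing factorizations of primed involution words, with their crystal operators. -/
def incrCrystal (n : ℕ) (hn : 1 ≤ n) (z : Perm ℤ) : CrystalData n (Incr n z) where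
  wt a i := ((a.1 i).length : ℤ)
  e i := restrictOp (incrE i) fun _ ha _ hb => incrE_mem ha hb
  f i := restrictOp (incrF i) fun _ ha _ hb => incrF_mem ha hb
  eBar h := restrictOp (incrEBar h) fun _ ha _ hb => incrEBar_mem ha hb
  fBar h := restrictOp (incrFBar h) fun _ ha _ hb => incrFBar_mem ha hb
  e0 := restrictOp (incrE0 hn) fun _ ha _ hb => incrE0_mem ha hb
  f0 := restrictOp (incrF0 hn) fun _ ha _ hb => incrF0_mem ha hb

section incrCrystal

variable {n : ℕ} {hn : 1 ≤ n} {z : Perm ℤ}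

theorem map_incrCrystal_e (i : Fin (n - 1)) (a : Incr n z) :
    ((incrCrystal n hn z).e i a).map Subtype.val = incrE i a.1 :=
  map_restrictOp (hg := fun _ ha _ hb => incrE_mem ha hb) a

theorem map_incrCrystal_f (i : Fin (n - 1)) (a : Incr n z) :
    ((incrCrystal n hn z).f i a).map Subtype.val = incrF i a.1 :=
  map_restrictOp (hg := fun _ ha _ hb => incrF_mem ha hb) a

theorem map_incrCrystal_eBar (h : 2 ≤ n) (a : Incr n z) :
    ((incrCrystal n hn z).eBar h a).map Subtype.val = incrEBar h a.1 :=
  map_restrictOp (hg := fun _ ha _ hb => incrEBar_mem ha hb) a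

theorem map_incrCrystal_fBar (h : 2 ≤ n) (a : Incr n z) :
    ((incrCrystal n hn z).fBar h a).map Subtype.val = incrFBar h a.1 :=
  map_restrictOp (hg := fun _ ha _ hb => incrFBar_mem ha hb) a

theorem map_incrCrystal_e0 (a : Incr n z) :
    ((incrCrystal n hn z).e0 a).map Subtype.val = incrE0 hn a.1 :=
  map_restrictOp (hg := fun _ ha _ hb => incrE0_mem ha hb) a

theorem map_incrCrystal_f0 (a : Incr n z) :
    ((incrCrystal n hn z).f0 a).map Subtype.val = incrF0 hn a.1 :=
  map_restrictOp (hg := fun _ ha _ hb => incrF0_mem ha hb) a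

theorem incrE_eq_onPair (i : Fin (n - 1)) : incrE i = onPair (low i) (high i) pairE :=
  funext (incrE_eq i)

theorem incrF_eq_onPair (i : Fin (n - 1)) : incrF i = onPair (low i) (high i) pairF :=
  funext (incrF_eq i)

theorem incrEBar_eq_onPair (h : 2 ≤ n) :
    incrEBar h = onPair (fstIdx (Nat.le_of_succ_le h)) (sndIdx h) pairEBar :=
  funext (incrEBar_eq h)

theorem incrFBar_eq_onPair (h : 2 ≤ n) :
    incrFBar h = onPair (fstIdx (Nat.le_of_succ_le h)) (sndIdx h) pairFBar :=
  funext (incrFBar_eq h)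

theorem incrE0_eq_onRow (h : 1 ≤ n) : incrE0 h = onRow (fstIdx h) rowE0 :=
  funext (incrE0_eq h)

theorem incrF0_eq_onRow (h : 1 ≤ n) : incrF0 h = onRow (fstIdx h) rowF0 :=
  funext (incrF0_eq h)

theorem fst_ne_snd (h : 2 ≤ n) : (fstIdx (Nat.le_of_succ_le h) : Fin n) ≠ sndIdx h := by
  simp [fstIdx, sndIdx, Fin.ext_iff]

theorem incrCrystal_f_eq_some_iff {i : Fin (n - 1)} {a b : Incr n z} :
    (incrCrystal n hn z).f i a = some b ↔
      ∃ v w, pairF (a.1 (low i)) (a.1 (high i)) = some (v, w) ∧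
        b.1 = setTwo a.1 (low i) (high i) v w := by
  rw [← onPair_eq_some_iff, ← incrF_eq_onPair]
  exact eq_some_iff_of_map (map_incrCrystal_f _ a)

theorem incrCrystal_e_eq_some_iff {i : Fin (n - 1)} {a b : Incr n z} :
    (incrCrystal n hn z).e i a = some b ↔
      ∃ v w, pairE (a.1 (low i)) (a.1 (high i)) = some (v, w) ∧
        b.1 = setTwo a.1 (low i) (high i) v w := by
  rw [← onPair_eq_some_iff, ← incrE_eq_onPair]
  exact eq_some_iff_of_map (map_incrCrystal_e _ a)

theorem incrCrystal_fBar_eq_some_iff {h : 2 ≤ n} {a b : Incr n z} :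
    (incrCrystal n hn z).fBar h a = some b ↔
      ∃ v w, pairFBar (a.1 (fstIdx (by omega))) (a.1 (sndIdx h)) = some (v, w) ∧
        b.1 = setTwo a.1 (fstIdx (by omega)) (sndIdx h) v w := by
  rw [← onPair_eq_some_iff, ← incrFBar_eq_onPair]
  exact eq_some_iff_of_map (map_incrCrystal_fBar _ a)

theorem incrCrystal_eBar_eq_some_iff {h : 2 ≤ n} {a b : Incr n z} :
    (incrCrystal n hn z).eBar h a = some b ↔
      ∃ v w, pairEBar (a.1 (fstIdx (by omega))) (a.1 (sndIdx h)) = some (v, w) ∧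
        b.1 = setTwo a.1 (fstIdx (by omega)) (sndIdx h) v w := by
  rw [← onPair_eq_some_iff, ← incrEBar_eq_onPair]
  exact eq_some_iff_of_map (map_incrCrystal_eBar _ a)

theorem incrCrystal_e0_eq_some_iff {a b : Incr n z} :
    (incrCrystal n hn z).e0 a = some b ↔
      ∃ m u, a.1 (fstIdx hn) = ⟨m, true⟩ :: u ∧
        b.1 = Function.update a.1 (fstIdx hn) (⟨m, false⟩ :: u) := by
  refine (eq_some_iff_of_map (map_incrCrystal_e0 a)).trans ?_
  rw [incrE0_eq, onRow_eq_some_iff]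
  simp only [rowE0_eq_some_iff]
  constructor
  · rintro ⟨_, ⟨m, u, e, rfl⟩, e'⟩
    exact ⟨m, u, e, e'⟩
  · rintro ⟨m, u, e, e'⟩
    exact ⟨_, ⟨m, u, e, rfl⟩, e'⟩

theorem incrCrystal_f0_eq_some_iff {a b : Incr n z} :
    (incrCrystal n hn z).f0 a = some b ↔
      ∃ m u, a.1 (fstIdx hn) = ⟨m, false⟩ :: u ∧
        b.1 = Function.update a.1 (fstIdx hn) (⟨m, true⟩ :: u) := by
  refine (eq_some_iff_of_map (map_incrCrystal_f0 a)).trans ?_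
  rw [incrF0_eq, onRow_eq_some_iff]
  simp only [rowF0_eq_some_iff]
  constructor
  · rintro ⟨_, ⟨m, u, e, rfl⟩, e'⟩
    exact ⟨m, u, e, e'⟩
  · rintro ⟨m, u, e, e'⟩
    exact ⟨_, ⟨m, u, e, rfl⟩, e'⟩

theorem incrCrystal_e_iff_f (i : Fin (n - 1)) (b c : Incr n z) :
    (incrCrystal n hn z).e i b = some c ↔ (incrCrystal n hn z).f i c = some b := by
  refine (eq_some_iff_of_map (map_incrCrystal_e i b)).trans
    (Iff.trans ?_ (eq_some_iff_of_map (map_incrCrystal_f i c)).symm)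
  rw [incrE_eq_onPair, incrF_eq_onPair]
  exact ⟨onPair_inverse (low_ne_high i) fun _ _ =>
      pairF_of_pairE (rowPair_of_incr b.2 (high_val i)),
    onPair_inverse (low_ne_high i) fun _ _ => pairE_of_pairF (rowPair_of_incr c.2 (high_val i))⟩

theorem incrCrystal_eBar_iff_fBar (h : 2 ≤ n) (b c : Incr n z) :
    (incrCrystal n hn z).eBar h b = some c ↔ (incrCrystal n hn z).fBar h c = some b := by
  refine (eq_some_iff_of_map (map_incrCrystal_eBar h b)).trans
    (Iff.trans ?_ (eq_some_iff_of_map (map_incrCrystal_fBar h c)).symm)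
  rw [incrEBar_eq_onPair, incrFBar_eq_onPair]
  exact ⟨onPair_inverse (fst_ne_snd h) fun _ _ k =>
      (pairEBar_spec (firstRows_of_incr b.2 rfl rfl) k).1,
    onPair_inverse (fst_ne_snd h) fun _ _ k =>
      (pairFBar_spec (firstRows_of_incr c.2 rfl rfl) k).1⟩

theorem incrCrystal_e0_iff_f0 (b c : Incr n z) :
    (incrCrystal n hn z).e0 b = some c ↔ (incrCrystal n hn z).f0 c = some b := by
  rw [incrCrystal_e0_eq_some_iff, incrCrystal_f0_eq_some_iff]
  constructor
  · rintro ⟨m, u, e, e'⟩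
    refine ⟨m, u, by rw [e', Function.update_self], ?_⟩
    rw [e', Function.update_idem, ← e, Function.update_eq_self]
  · rintro ⟨m, u, e, e'⟩
    refine ⟨m, u, by rw [e', Function.update_self], ?_⟩
    rw [e', Function.update_idem, ← e, Function.update_eq_self]

theorem Slide.length_v (s : Slide) : s.v.length = s.v'.length + 1 := by
  rw [s.sorted_v.length_eq_card, s.sorted_v'.length_eq_card, s.vals_v',
    Finset.card_erase_add_one]
  exact s.run.left _ le_rfl (by omega)

theorem Slide.length_w (s : Slide) : s.w'.length = s.w.length + 1 := by
  rw [s.sorted_w.length_eq_card, s.sorted_w'.length_eq_card, s.vals_w',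
    Finset.card_insert_of_notMem s.run.gap]

/-- The effect on the row lengths of moving one letter from the row `j` to the row `i`. -/
theorem length_setTwo_sub {a : Fin n → List PLetter} {i j : Fin n} (hij : i ≠ j)
    {v w : List PLetter} (hv : v.length = (a i).length + 1) (hw : (a j).length = w.length + 1) :
    ((fun k => ((setTwo a i j v w k).length : ℤ)) - fun k => ((a k).length : ℤ)) =
      Pi.single i 1 - Pi.single j 1 := by
  funext k
  simp only [Pi.sub_apply]
  by_cases hj : k = j
  · subst hj
    rw [setTwo_snd, Pi.single_eq_same, Pi.single_eq_of_ne hij.symm, hw]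
    push_cast; ring
  · by_cases hi : k = i
    · subst hi
      rw [setTwo_fst hij, Pi.single_eq_same, Pi.single_eq_of_ne hj, hv]
      push_cast; ring
    · rw [setTwo_other hi hj, Pi.single_eq_of_ne hi, Pi.single_eq_of_ne hj]
      simp

theorem incrCrystal_wt_e (i : Fin (n - 1)) (b c : Incr n z)
    (h : (incrCrystal n hn z).e i b = some c) :
    (incrCrystal n hn z).wt c - (incrCrystal n hn z).wt b =
      Pi.single (low i) 1 - Pi.single (high i) 1 := by
  obtain ⟨v, w, h1, h2⟩ := incrCrystal_e_eq_some_iff.1 h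
  obtain ⟨s, rfl, rfl, e1, e2, -⟩ := exists_slide_of_pairE (rowPair_of_incr b.2 (high_val i)) h1
  simp only [incrCrystal, h2]
  exact length_setTwo_sub (low_ne_high i) (by rw [s.length_v, e1]) (by rw [← e2, s.length_w])

theorem incrCrystal_wt_eBar (h : 2 ≤ n) (b c : Incr n z)
    (hc : (incrCrystal n hn z).eBar h b = some c) :
    (incrCrystal n hn z).wt c - (incrCrystal n hn z).wt b =
      Pi.single (fstIdx (by omega)) 1 - Pi.single (sndIdx h) 1 := by
  obtain ⟨v, w, h1, h2⟩ := incrCrystal_eBar_eq_some_iff.1 hc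
  obtain ⟨-, -, -, -, k1, k2, -⟩ := pairEBar_spec (firstRows_of_incr b.2 rfl rfl) h1
  simp only [incrCrystal, h2]
  exact length_setTwo_sub (fst_ne_snd h) k1 k2

theorem strLen_incrCrystal_f (i : Fin (n - 1)) (b : Incr n z) :
    strLen ((incrCrystal n hn z).f i) b =
      ((unpairedFst (b.1 (low i)) (b.1 (high i))).length : ℕ) := by
  refine strLen_eq (N := fun b : Incr n z => (unpairedFst (b.1 (low i)) (b.1 (high i))).length)
    (fun b => ?_) (fun b c hc => ?_) b
  · rw [← pairF_eq_none_iff]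
    refine (eq_none_iff_of_map (map_incrCrystal_f i b)).trans ?_
    rw [incrF_eq, Option.map_eq_none_iff]
  · obtain ⟨v, w, h1, h2⟩ := incrCrystal_f_eq_some_iff.1 hc
    obtain ⟨s, e1, e2, rfl, rfl, ht⟩ :=
      exists_slide_of_pairF (rowPair_of_incr b.2 (high_val i)) h1
    simp only [h2, setTwo_fst (low_ne_high i), setTwo_snd, ← e1, ← e2]
    exact s.length_unpairedFst_slide ht

theorem strLen_incrCrystal_e (i : Fin (n - 1)) (b : Incr n z) :
    strLen ((incrCrystal n hn z).e i) b =
      ((unpairedSnd (b.1 (low i)) (b.1 (high i))).length : ℕ) := by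
  refine strLen_eq (N := fun b : Incr n z => (unpairedSnd (b.1 (low i)) (b.1 (high i))).length)
    (fun b => ?_) (fun b c hc => ?_) b
  · rw [← pairE_eq_none_iff]
    refine (eq_none_iff_of_map (map_incrCrystal_e i b)).trans ?_
    rw [incrE_eq, Option.map_eq_none_iff]
  · obtain ⟨v, w, h1, h2⟩ := incrCrystal_e_eq_some_iff.1 hc
    obtain ⟨s, rfl, rfl, e1, e2, ht⟩ :=
      exists_slide_of_pairE (rowPair_of_incr b.2 (high_val i)) h1
    simp only [h2, setTwo_fst (low_ne_high i), setTwo_snd, ← e1, ← e2]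
    exact s.length_unpairedSnd_slide ht

/-- The string lengths count records of the height, so primes do not influence them. -/
theorem strLen_incrCrystal_congr {i : Fin (n - 1)} {b c : Incr n z}
    (hl : vals (b.1 (low i)) = vals (c.1 (low i)))
    (hh : vals (b.1 (high i)) = vals (c.1 (high i))) :
    strLen ((incrCrystal n hn z).e i) b = strLen ((incrCrystal n hn z).e i) c ∧
      strLen ((incrCrystal n hn z).f i) b = strLen ((incrCrystal n hn z).f i) c := by
  obtain ⟨b1, b2, -⟩ := rowPair_of_incr b.2 (high_val i)
  obtain ⟨c1, c2, -⟩ := rowPair_of_incr c.2 (high_val i)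
  rw [strLen_incrCrystal_e, strLen_incrCrystal_e, strLen_incrCrystal_f, strLen_incrCrystal_f,
    length_unpairedFst b1 b2, length_unpairedSnd b1 b2, length_unpairedFst c1 c2,
    length_unpairedSnd c1 c2, hl, hh]
  exact ⟨rfl, rfl⟩

theorem incrCrystal_fBar_ne_none_iff (h : 2 ≤ n) (b : Incr n z) :
    (incrCrystal n hn z).fBar h b ≠ none ↔
      StartsLow (b.1 (fstIdx (by omega))) (b.1 (sndIdx h)) := by
  rw [← pairFBar_ne_none_iff (firstRows_of_incr b.2 rfl rfl)]
  refine not_congr ((eq_none_iff_of_map (map_incrCrystal_fBar h b)).trans ?_)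
  rw [incrFBar_eq, Option.map_eq_none_iff]

theorem incrCrystal_eBar_ne_none_iff (h : 2 ≤ n) (b : Incr n z) :
    (incrCrystal n hn z).eBar h b ≠ none ↔
      StartsLow (b.1 (sndIdx h)) (b.1 (fstIdx (by omega))) := by
  rw [← pairEBar_ne_none_iff (firstRows_of_incr b.2 rfl rfl)]
  refine not_congr ((eq_none_iff_of_map (map_incrCrystal_eBar h b)).trans ?_)
  rw [incrEBar_eq, Option.map_eq_none_iff]

-- After the operator has acted, the second row starts with the smallest letter, so it cannot act
-- again.
open Classical in
theorem strLen_incrCrystal_fBar (h : 2 ≤ n) (b : Incr n z) :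
    strLen ((incrCrystal n hn z).fBar h) b =
      (if StartsLow (b.1 (fstIdx (by omega))) (b.1 (sndIdx h)) then 1 else 0 : ℕ) := by
  rw [strLen_eq_ite, ← ite_not]
  · simp only [← incrCrystal_fBar_ne_none_iff (hn := hn) h b, ne_eq]
  · intro b c hc
    by_contra hne
    obtain ⟨v, w, h1, h2⟩ := incrCrystal_fBar_eq_some_iff.1 hc
    obtain ⟨-, -, -, k, -⟩ := pairFBar_spec (firstRows_of_incr b.2 rfl rfl) h1
    have hs := (incrCrystal_fBar_ne_none_iff h c).1 hne
    rw [h2, setTwo_fst (fst_ne_snd h), setTwo_snd] at hs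
    exact k.not_swap hs

open Classical in
theorem strLen_incrCrystal_eBar (h : 2 ≤ n) (b : Incr n z) :
    strLen ((incrCrystal n hn z).eBar h) b =
      (if StartsLow (b.1 (sndIdx h)) (b.1 (fstIdx (by omega))) then 1 else 0 : ℕ) := by
  rw [strLen_eq_ite, ← ite_not]
  · simp only [← incrCrystal_eBar_ne_none_iff (hn := hn) h b, ne_eq]
  · intro b c hc
    by_contra hne
    obtain ⟨v, w, h1, h2⟩ := incrCrystal_eBar_eq_some_iff.1 hc
    obtain ⟨-, -, -, k, -⟩ := pairEBar_spec (firstRows_of_incr b.2 rfl rfl) h1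
    have hs := (incrCrystal_eBar_ne_none_iff h c).1 hne
    rw [h2, setTwo_fst (fst_ne_snd h), setTwo_snd] at hs
    exact k.not_swap hs

theorem incrCrystal_bar_zero (h : 2 ≤ n) (b : Incr n z)
    (hb : (incrCrystal n hn z).wt b (fstIdx (by omega)) = 0 ∧
      (incrCrystal n hn z).wt b (sndIdx h) = 0) :
    strLen ((incrCrystal n hn z).eBar h) b + strLen ((incrCrystal n hn z).fBar h) b = 0 := by
  have h1 : b.1 (fstIdx (by omega)) = [] := List.length_eq_zero_iff.1 (Int.natCast_eq_zero.1 hb.1)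
  have h2 : b.1 (sndIdx h) = [] := List.length_eq_zero_iff.1 (Int.natCast_eq_zero.1 hb.2)
  rw [strLen_incrCrystal_eBar, strLen_incrCrystal_fBar, h1, h2]
  have : ¬ StartsLow [] [] := by simp [StartsLow, vals, unprime]
  simp [this]

theorem incrCrystal_bar_one (h : 2 ≤ n) (b : Incr n z)
    (hb : ¬ ((incrCrystal n hn z).wt b (fstIdx (by omega)) = 0 ∧
      (incrCrystal n hn z).wt b (sndIdx h) = 0)) :
    strLen ((incrCrystal n hn z).eBar h) b + strLen ((incrCrystal n hn z).fBar h) b = 1 := by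
  have hne : ¬ (b.1 (fstIdx (by omega)) = [] ∧ b.1 (sndIdx h) = []) := by
    rintro ⟨h1, h2⟩
    exact hb ⟨by simp [incrCrystal, h1], by simp [incrCrystal, h2]⟩
  rw [strLen_incrCrystal_eBar, strLen_incrCrystal_fBar]
  rcases startsLow_or (firstRows_of_incr b.2 rfl rfl) hne with k | k
  · simp [k, k.not_swap]
  · simp [k, k.not_swap]

theorem vals_eq_of_e0 {b c : Incr n z} (h : (incrCrystal n hn z).e0 b = some c) (k : Fin n) :
    vals (b.1 k) = vals (c.1 k) := by
  obtain ⟨m, u, e, e'⟩ := incrCrystal_e0_eq_some_iff.1 h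
  rw [e']
  by_cases hk : k = fstIdx hn
  · subst hk
    rw [Function.update_self, e]
    simp [vals, unprime]
  · rw [Function.update_of_ne hk]

theorem incrCrystal_wt_e0 {b c : Incr n z} (h : (incrCrystal n hn z).e0 b = some c) :
    (incrCrystal n hn z).wt b = (incrCrystal n hn z).wt c := by
  obtain ⟨m, u, e, e'⟩ := incrCrystal_e0_eq_some_iff.1 h
  funext k
  simp only [incrCrystal, e']
  by_cases hk : k = fstIdx hn
  · subst hk
    rw [Function.update_self, e]
    simp
  · rw [Function.update_of_ne hk]

theorem strLen_incrCrystal_e0 (b : Incr n z) :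
    strLen (incrCrystal n hn z).e0 b =
      (if (incrCrystal n hn z).e0 b = none then 0 else 1 : ℕ) := by
  refine strLen_eq_ite (fun b c hc => ?_) b
  obtain ⟨m, u, e, e'⟩ := incrCrystal_e0_eq_some_iff.1 hc
  refine (eq_none_iff_of_map (map_incrCrystal_e0 c)).2 ?_
  rw [incrE0_eq, onRow, e', Function.update_self]
  rfl

theorem strLen_incrCrystal_f0 (b : Incr n z) :
    strLen (incrCrystal n hn z).f0 b =
      (if (incrCrystal n hn z).f0 b = none then 0 else 1 : ℕ) := by
  refine strLen_eq_ite (fun b c hc => ?_) b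
  obtain ⟨m, u, e, e'⟩ := incrCrystal_f0_eq_some_iff.1 hc
  refine (eq_none_iff_of_map (map_incrCrystal_f0 c)).2 ?_
  rw [incrF0_eq, onRow, e', Function.update_self]
  rfl

theorem incrCrystal_e0_eq_none_iff (b : Incr n z) :
    (incrCrystal n hn z).e0 b = none ↔ rowE0 (b.1 (fstIdx hn)) = none := by
  refine (eq_none_iff_of_map (map_incrCrystal_e0 b)).trans ?_
  rw [incrE0_eq, onRow, Option.map_eq_none_iff]

theorem incrCrystal_f0_eq_none_iff (b : Incr n z) :
    (incrCrystal n hn z).f0 b = none ↔ rowF0 (b.1 (fstIdx hn)) = none := by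
  refine (eq_none_iff_of_map (map_incrCrystal_f0 b)).trans ?_
  rw [incrF0_eq, onRow, Option.map_eq_none_iff]

theorem incrCrystal_zero_zero (b : Incr n z) (hb : (incrCrystal n hn z).wt b (fstIdx hn) = 0) :
    strLen (incrCrystal n hn z).e0 b + strLen (incrCrystal n hn z).f0 b = 0 := by
  have h1 : b.1 (fstIdx hn) = [] := List.length_eq_zero_iff.1 (Int.natCast_eq_zero.1 hb)
  simp only [strLen_incrCrystal_e0, strLen_incrCrystal_f0, incrCrystal_e0_eq_none_iff,
    incrCrystal_f0_eq_none_iff, h1]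
  simp [rowE0, rowF0]

theorem incrCrystal_zero_one (b : Incr n z) (hb : (incrCrystal n hn z).wt b (fstIdx hn) ≠ 0) :
    strLen (incrCrystal n hn z).e0 b + strLen (incrCrystal n hn z).f0 b = 1 := by
  simp only [strLen_incrCrystal_e0, strLen_incrCrystal_f0, incrCrystal_e0_eq_none_iff,
    incrCrystal_f0_eq_none_iff]
  cases h1 : b.1 (fstIdx hn) with
  | nil => simp [incrCrystal, h1] at hb
  | cons x u => cases hx : x.primed <;> simp [rowE0, rowF0, hx]

theorem opsCommute_of_onPair_bar {h : 2 ≤ n} {i : Fin (n - 1)} (hi : 2 ≤ i.1)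
    {p q : List PLetter → List PLetter → Option (List PLetter × List PLetter)}
    {g k : (Fin n → List PLetter) → Option (Fin n → List PLetter)}
    {G K : Incr n z → Option (Incr n z)}
    (hG : ∀ a, (G a).map Subtype.val = g a.1) (hK : ∀ a, (K a).map Subtype.val = k a.1)
    (eg : g = onPair (low i) (high i) p) (ek : k = onPair (fstIdx (by omega)) (sndIdx h) q) :
    OpsCommute G K := by
  refine opsCommute_of_map hG hK fun a => ?_
  subst eg ek
  refine onPair_comm ?_ ?_ ?_ ?_ _ _ _ <;>
    simp only [low, high, fstIdx, sndIdx, Ne, Fin.mk.injEq] <;> omega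

theorem opsCommute_of_onPair_onRow {h : 1 ≤ n} {i : Fin (n - 1)} (hi : 1 ≤ i.1)
    {p : List PLetter → List PLetter → Option (List PLetter × List PLetter)}
    {q : List PLetter → Option (List PLetter)}
    {g k : (Fin n → List PLetter) → Option (Fin n → List PLetter)}
    {G K : Incr n z → Option (Incr n z)}
    (hG : ∀ a, (G a).map Subtype.val = g a.1) (hK : ∀ a, (K a).map Subtype.val = k a.1)
    (eg : g = onPair (low i) (high i) p) (ek : k = onRow (fstIdx h) q) :
    OpsCommute G K := by
  refine opsCommute_of_map hG hK fun a => ?_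
  subst eg ek
  refine onPair_onRow_comm ?_ ?_ _ _ _ <;>
    simp only [low, high, fstIdx, Ne, Fin.mk.injEq] <;> omega

theorem isQPlusCrystal_incrCrystal (hne : (Incr n z).Nonempty) :
    IsQPlusCrystal (incrCrystal n hn z) where
  nonempty := hne.to_subtype
  e_iff_f := incrCrystal_e_iff_f
  wt_e := incrCrystal_wt_e
  strLen_e_finite i b := by rw [strLen_incrCrystal_e]; exact ENat.natCast_ne_top _
  strLen_f_finite i b := by rw [strLen_incrCrystal_f]; exact ENat.natCast_ne_top _
  strLen_sub i b := by
    obtain ⟨b1, b2, -⟩ := rowPair_of_incr b.2 (high_val i)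
    rw [strLen_incrCrystal_e, strLen_incrCrystal_f, ENat.toNat_natCast, ENat.toNat_natCast]
    exact length_unpaired_sub b1 b2
  wt_nonneg b i := Int.natCast_nonneg _
  eBar_iff_fBar := incrCrystal_eBar_iff_fBar
  wt_eBar := incrCrystal_wt_eBar
  strLen_eBar h b c hc i hi := by
    obtain ⟨v, w, -, h2⟩ := incrCrystal_eBar_eq_some_iff.1 hc
    apply strLen_incrCrystal_congr <;> rw [h2, setTwo_other] <;>
      simp only [low, high, fstIdx, sndIdx, Ne, Fin.mk.injEq] <;> omega
  comm_bar h i hi :=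
    ⟨opsCommute_of_onPair_bar hi (map_incrCrystal_e i) (map_incrCrystal_eBar h)
        (incrE_eq_onPair i) (incrEBar_eq_onPair h),
      opsCommute_of_onPair_bar hi (map_incrCrystal_e i) (map_incrCrystal_fBar h)
        (incrE_eq_onPair i) (incrFBar_eq_onPair h),
      opsCommute_of_onPair_bar hi (map_incrCrystal_f i) (map_incrCrystal_eBar h)
        (incrF_eq_onPair i) (incrEBar_eq_onPair h),
      opsCommute_of_onPair_bar hi (map_incrCrystal_f i) (map_incrCrystal_fBar h)
        (incrF_eq_onPair i) (incrFBar_eq_onPair h)⟩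
  strLen_bar_zero := incrCrystal_bar_zero
  strLen_bar_one := incrCrystal_bar_one
  e0_iff_f0 := incrCrystal_e0_iff_f0
  wt_e0 _ _ := incrCrystal_wt_e0
  strLen_e0 b c hc i := strLen_incrCrystal_congr (vals_eq_of_e0 hc _) (vals_eq_of_e0 hc _)
  strLen_bar_e0 h b c hc := by
    have e : ∀ k l, StartsLow (b.1 k) (b.1 l) ↔ StartsLow (c.1 k) (c.1 l) := fun k l => by
      unfold StartsLow
      rw [vals_eq_of_e0 hc, vals_eq_of_e0 hc]
    rw [strLen_incrCrystal_eBar, strLen_incrCrystal_eBar, strLen_incrCrystal_fBar,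
      strLen_incrCrystal_fBar]
    classical exact ⟨congrArg _ (if_congr (e _ _) rfl rfl),
      congrArg _ (if_congr (e _ _) rfl rfl)⟩
  comm_zero i hi :=
    ⟨opsCommute_of_onPair_onRow hi (map_incrCrystal_e i) map_incrCrystal_e0
        (incrE_eq_onPair i) (incrE0_eq_onRow hn),
      opsCommute_of_onPair_onRow hi (map_incrCrystal_e i) map_incrCrystal_f0
        (incrE_eq_onPair i) (incrF0_eq_onRow hn),
      opsCommute_of_onPair_onRow hi (map_incrCrystal_f i) map_incrCrystal_e0
        (incrF_eq_onPair i) (incrE0_eq_onRow hn),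
      opsCommute_of_onPair_onRow hi (map_incrCrystal_f i) map_incrCrystal_f0
        (incrF_eq_onPair i) (incrF0_eq_onRow hn)⟩
  strLen_zero_zero _ := incrCrystal_zero_zero
  strLen_zero_one _ := incrCrystal_zero_one

end incrCrystal

end QPlus

theorem mainTheorem8 (n : ℕ) (hn : 1 ≤ n) (z : Equiv.Perm ℤ)
    (hfin : {i : ℤ | z i ≠ i}.Finite) (hinv : z = z⁻¹) (hlen : QPlus.invShapeLength z ≤ n) :
    ∃ C : QPlus.CrystalData n (QPlus.Incr n z),
      (∀ a i, C.wt a i = ((a.1 i).length : ℤ)) ∧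
      (∀ i a, (C.e i a).map Subtype.val = QPlus.incrE i a.1) ∧
      (∀ i a, (C.f i a).map Subtype.val = QPlus.incrF i a.1) ∧
      (∀ h a, (C.eBar h a).map Subtype.val = QPlus.incrEBar h a.1) ∧
      (∀ h a, (C.fBar h a).map Subtype.val = QPlus.incrFBar h a.1) ∧
      (∀ a, (C.e0 a).map Subtype.val = QPlus.incrE0 hn a.1) ∧
      (∀ a, (C.f0 a).map Subtype.val = QPlus.incrF0 hn a.1) ∧
      QPlus.IsQPlusCrystal C := by
  have hz : Function.Involutive z := fun i => by
    conv_lhs => enter [1]; rw [hinv]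
    exact z.symm_apply_apply i
  exact ⟨QPlus.incrCrystal n hn z, fun _ _ => rfl, QPlus.map_incrCrystal_e, QPlus.map_incrCrystal_f,
    QPlus.map_incrCrystal_eBar, QPlus.map_incrCrystal_fBar, QPlus.map_incrCrystal_e0,
    QPlus.map_incrCrystal_f0,
    QPlus.isQPlusCrystal_incrCrystal (QPlus.incr_nonempty hfin hz hlen)⟩
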